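/- A temporal graph $\mathcal G=(G,\lambda)$ consists of a finite simple graph $G$ and a set $\lambda(e)\subseteq\mathbb N$ of active time-steps for each edge $e$ of $G$. Its lifetime is $\tau=\max\bigcup_e\lambda(e)$, assumed to exist and to satisfy $\tau\ge 1$; its snapshot $G_t$ has the vertices of $G$ and the edges $e$ with $t\in\lambda(e)$. The temporal neighbourhood diversity $tnd$ of $\mathcal G$ is the least $k$ such that $V(G)$ can be partitioned into $k$ non-empty classes $V_1,\dots,V_k$ with $N_{G_t}(u)\setminus\{v\}=N_{G_t}(v)\setminus\{u\}$ for all $u,v$ in a common class and all $1\le t\le\tau$; such a partition is a temporal neighbourhood diversity partition. A reconfigurable sequence is a sequence $T=(T_1,\dots,T_\tau)$ of subsets of $V(G)$ such that for each $1\le t<\tau$ there is a bijection $b:T_t\to T_{t+1}$ with $b(u)=u$ or $u\,b(u)\in E(G_t)$ for all $u\in T_t$; its size is $|T|=|T_1|=\dots=|T_\tau|$. Temporal Dominating Set Reconfiguration asks for a reconfigurable sequence of minimum size such that each $T_t$ is a dominating set of $G_t$; Temporal Independent Set Reconfiguration asks for one of maximum size such that each $T_t$ is an independent set of $G_t$.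 Both problems are solvable in $$\mathcal O\bigl(2^{tnd\cdot\tau}\cdot\tau^{11/2}\cdot tnd^{8}\bigr)$$ time when $\mathcal G$ is given together with a temporal neighbourhood diversity partition into $tnd$ classes and the solution is returned by its numbers of tokens per class. Precisely: there are a constant $C$ and, for each of the two problems, one program for a unit-cost random access machine (natural numbers, addition, truncated subtraction, tests for zero, indirect addressing; no multiplication) such that the following holds for every temporal graph $\mathcal G$ on the vertices $0,\dots,n-1$ with lifetime $\tau\ge1$ and temporal neighbourhood diversity $tnd$ and every temporal neighbourhood diversity partition $V_1,\dots,V_{tnd}$ of $\mathcal G$, each class being listed in some order. Given read-only random access to $\tau$, $n$, $tnd$, the sizes and lists of the classes and the adjacency matrices of the snapshots, the program halts after at most $C\cdot 2^{tnd\cdot\tau}\cdot\tau^{11/2}\cdot tnd^{8}$ steps and outputs numbers $c_{t,i}\le|V_i|$ $(1\le t\le\tau,\ 1\le i\le tnd)$ such that the sets $T_t$ consisting of the first $c_{t,i}$ vertices in the list of $V_i$, for all $i$, form an optimal solution $(T_1,\dots,T_\tau)$ of the problem, and it outputs the size $|T_1|$ of this solution. -/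

import Mathlib

namespace TempReconf

/-! ### Temporal graphs -/

/-- A temporal graph `(G, lam)` on the vertex set `V`: a static graph together with the set of
time-steps at which each of its edges is active. -/
structure TemporalGraph (V : Type) where
  graph : SimpleGraph V
  label : graph.edgeSet → Set ℕ

namespace TemporalGraph

variable {V : Type}

/-- The set of all time-steps at which some edge is active. -/
def activeTimes (G : TemporalGraph V) : Set ℕ := ⋃ e, G.label e

/-- The lifetime: the maximum time-step at which an edge is active. (If there is no such maximum,
because no edge is ever active or the labels are unbounded, this is `0`, so that `1 ≤ G.lifetime`
says that the lifetime is a genuine maximum and is positive.) -/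
noncomputable def lifetime (G : TemporalGraph V) : ℕ := sSup G.activeTimes

/-- The snapshot at time-step `t`: all vertices, and the edges active at time-step `t`. -/
def snapshot (G : TemporalGraph V) (t : ℕ) : SimpleGraph V :=
  SimpleGraph.fromEdgeSet {e | ∃ h : e ∈ G.graph.edgeSet, t ∈ G.label ⟨e, h⟩}

end TemporalGraph

/-! ### Temporal neighbourhood diversity -/

/-- A partition of `V` into `k` (non-empty) classes `V_0, …, V_{k-1}`, each class being
listed without repetition in some order. -/
structure ListedPartition (V : Type) (k : ℕ) where
  cls : Fin k → List V
  nodup : ∀ i, (cls i).Nodup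
  nonempty : ∀ i, cls i ≠ []
  cover : ∀ v, ∃! i, v ∈ cls i

/-- `P` is a temporal neighbourhood partition of `G`: two vertices of the same class have, at each
time-step of `[1, lifetime]`, the same neighbours apart from each other. -/
def IsTNDPartition {V : Type} (G : TemporalGraph V) {k : ℕ} (P : ListedPartition V k) : Prop :=
  ∀ i, ∀ u ∈ P.cls i, ∀ v ∈ P.cls i, ∀ t, 1 ≤ t → t ≤ G.lifetime →
    (G.snapshot t).neighborSet u \ {v} = (G.snapshot t).neighborSet v \ {u}

/-- The temporal neighbourhood diversity: the least number of classes of such a partition. -/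
noncomputable def tnd {V : Type} (G : TemporalGraph V) : ℕ :=
  sInf {k | ∃ P : ListedPartition V k, IsTNDPartition G P}

/-! ### Temporally satisfying reconfiguration problems -/

/-- `S` is reconfigurable into `T` along the edges of `H`: there is a bijection `S → T` under
which every token stays where it is or moves to an adjacent vertex. -/
def Reconfigurable {V : Type} (H : SimpleGraph V) (S T : Finset V) : Prop :=
  ∃ b : S ≃ T, ∀ u : S, (u : V) = (b u : V) ∨ H.Adj (u : V) (b u : V)

/-- `T 1, …, T lifetime` is a reconfigurable sequence of `G`. (The values of `T` at other indices
play no role.) -/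
def IsReconfigurableSequence {V : Type} (G : TemporalGraph V) (T : ℕ → Finset V) : Prop :=
  ∀ t, 1 ≤ t → t < G.lifetime → Reconfigurable (G.snapshot t) (T t) (T (t + 1))

/-- `T` is a reconfigurable sequence each of whose members satisfies, in the snapshot at its
time-step, the property `Pr` of vertex sets. -/
def IsTemporalSolution {V : Type} (Pr : SimpleGraph V → Finset V → Prop) (G : TemporalGraph V)
    (T : ℕ → Finset V) : Prop :=
  IsReconfigurableSequence G T ∧ ∀ t, 1 ≤ t → t ≤ G.lifetime → Pr (G.snapshot t) (T t)

/-- `D` is a dominating set of `H`: every closed neighbourhood meets `D`. -/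
def IsDominatingSet {V : Type} (H : SimpleGraph V) (D : Finset V) : Prop :=
  ∀ v, ∃ u ∈ D, u = v ∨ H.Adj v u

/-- `S` is an independent set of `H`. -/
def IsIndependentSet {V : Type} (H : SimpleGraph V) (S : Finset V) : Prop :=
  H.IsIndepSet (S : Set V)

/-- `T` solves Temporal Dominating Set Reconfiguration on `G`. All sets of a reconfigurable
sequence have the same size, which is the size of `T 1`. -/
def SolvesTDSR {V : Type} (G : TemporalGraph V) (T : ℕ → Finset V) : Prop :=
  IsTemporalSolution IsDominatingSet G T ∧
    ∀ T' : ℕ → Finset V, IsTemporalSolution IsDominatingSet G T' → (T 1).card ≤ (T' 1).card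

/-- `T` solves Temporal Independent Set Reconfiguration on `G`. -/
def SolvesTISR {V : Type} (G : TemporalGraph V) (T : ℕ → Finset V) : Prop :=
  IsTemporalSolution IsIndependentSet G T ∧
    ∀ T' : ℕ → Finset V, IsTemporalSolution IsIndependentSet G T' → (T' 1).card ≤ (T 1).card

/-! ### Random access machines

A structured random access machine with unit cost: registers and an indirectly addressed memory
hold natural numbers, the arithmetic is addition and truncated subtraction, control flow consists
of tests for zero. There is no multiplication. The input is read-only and is accessed entry by
entry. -/

/-- The read-only input: a temporal graph, as the array of the adjacency matrices of its
snapshots, and a listed partition of its vertices. -/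
structure Input where
  lifetime : ℕ
  order : ℕ
  classes : ℕ
  /-- the number of vertices of a class -/
  size : ℕ → ℕ
  /-- the vertex at a given position in the list of a class -/
  member : ℕ → ℕ → ℕ
  /-- the entry `(u, v)` of the adjacency matrix of the snapshot at time-step `t` -/
  adj : ℕ → ℕ → ℕ → ℕ

/-- Programs. The arguments of the basic instructions other than the constant in `const` are
names of registers. -/
inductive Prog
  | const (x c : ℕ)
  | add (x y z : ℕ)
  | sub (x y z : ℕ)
  | load (x y : ℕ)
  | store (x y : ℕ)
  | readLifetime (x : ℕ)
  | readOrder (x : ℕ)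
  | readClasses (x : ℕ)
  | readSize (x i : ℕ)
  | readMember (x i j : ℕ)
  | readAdj (x t u v : ℕ)
  | seq (p q : Prog)
  | ifNonzero (x : ℕ) (p q : Prog)
  | whileNonzero (x : ℕ) (p : Prog)

/-- A configuration: the contents of the registers and of the memory. -/
structure State where
  reg : ℕ → ℕ
  mem : ℕ → ℕ

/-- Everything is zero when a program starts. -/
def State.init : State := ⟨fun _ => 0, fun _ => 0⟩

/-- Assign a value to a register. -/
def State.set (s : State) (x a : ℕ) : State := ⟨Function.update s.reg x a, s.mem⟩

/-- `Exec I p s m s'`: on input `I`, the program `p` started in `s` halts in `s'` after exactly `m`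
steps. Every basic instruction and every test costs one step. -/
inductive Exec (I : Input) : Prog → State → ℕ → State → Prop
  | const (s : State) (x c : ℕ) : Exec I (.const x c) s 1 (s.set x c)
  | add (s : State) (x y z : ℕ) : Exec I (.add x y z) s 1 (s.set x (s.reg y + s.reg z))
  | sub (s : State) (x y z : ℕ) : Exec I (.sub x y z) s 1 (s.set x (s.reg y - s.reg z))
  | load (s : State) (x y : ℕ) : Exec I (.load x y) s 1 (s.set x (s.mem (s.reg y)))
  | store (s : State) (x y : ℕ) :
      Exec I (.store x y) s 1 ⟨s.reg, Function.update s.mem (s.reg x) (s.reg y)⟩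
  | readLifetime (s : State) (x : ℕ) : Exec I (.readLifetime x) s 1 (s.set x I.lifetime)
  | readOrder (s : State) (x : ℕ) : Exec I (.readOrder x) s 1 (s.set x I.order)
  | readClasses (s : State) (x : ℕ) : Exec I (.readClasses x) s 1 (s.set x I.classes)
  | readSize (s : State) (x i : ℕ) :
      Exec I (.readSize x i) s 1 (s.set x (I.size (s.reg i)))
  | readMember (s : State) (x i j : ℕ) :
      Exec I (.readMember x i j) s 1 (s.set x (I.member (s.reg i) (s.reg j)))
  | readAdj (s : State) (x t u v : ℕ) :
      Exec I (.readAdj x t u v) s 1 (s.set x (I.adj (s.reg t) (s.reg u) (s.reg v)))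
  | seq {p q : Prog} {s s₁ s₂ : State} {m₁ m₂ : ℕ} :
      Exec I p s m₁ s₁ → Exec I q s₁ m₂ s₂ → Exec I (.seq p q) s (m₁ + m₂) s₂
  | ifTrue {x : ℕ} {p q : Prog} {s s' : State} {m : ℕ} :
      s.reg x ≠ 0 → Exec I p s m s' → Exec I (.ifNonzero x p q) s (m + 1) s'
  | ifFalse {x : ℕ} {p q : Prog} {s s' : State} {m : ℕ} :
      s.reg x = 0 → Exec I q s m s' → Exec I (.ifNonzero x p q) s (m + 1) s'
  | whileDone {x : ℕ} {p : Prog} {s : State} :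
      s.reg x = 0 → Exec I (.whileNonzero x p) s 1 s
  | whileStep {x : ℕ} {p : Prog} {s s₁ s₂ : State} {m₁ m₂ : ℕ} :
      s.reg x ≠ 0 → Exec I p s m₁ s₁ → Exec I (.whileNonzero x p) s₁ m₂ s₂ →
        Exec I (.whileNonzero x p) s (m₁ + m₂ + 1) s₂

/-! ### Solving a problem on temporal graphs with a given partition -/

open Classical in
/-- The input that presents the temporal graph `G` on the vertices `0, …, n - 1` and the listed
partition `P`. Entries outside the ranges of the arrays read as `0`. -/
noncomputable def inputOf {n k : ℕ} (G : TemporalGraph (Fin n)) (P : ListedPartition (Fin n) k) :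
    Input where
  lifetime := G.lifetime
  order := n
  classes := k
  size i := if h : i < k then (P.cls ⟨i, h⟩).length else 0
  member i j := if h : i < k then ((P.cls ⟨i, h⟩).map Fin.val).getD j 0 else 0
  adj t u v := if h : u < n ∧ v < n then
    (if (G.snapshot t).Adj ⟨u, h.1⟩ ⟨v, h.2⟩ then 1 else 0) else 0

/-- The number of tokens that the memory `mem` puts on class `i` at time-step `t`: the table of
these numbers is stored row by row, from address `0` on, one row of length `k` per time-step
`1, 2, …`. -/
def tokens (k : ℕ) (mem : ℕ → ℕ) (t i : ℕ) : ℕ := mem ((t - 1) * k + i)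

open Classical in
/-- The sequence of vertex sets described by the memory `mem`: the tokens of a class at a
time-step lie on the first vertices in the list of that class. -/
noncomputable def decode {n k : ℕ} (P : ListedPartition (Fin n) k) (mem : ℕ → ℕ) (t : ℕ) :
    Finset (Fin n) :=
  Finset.univ.biUnion fun i : Fin k => ((P.cls i).take (tokens k mem t i)).toFinset

/-- The program `p` solves the problem `Sol` in at most `bound tnd τ` steps: on every temporal graph
`G` of positive lifetime `τ`, presented together with a temporal neighbourhood partition
into `tnd` classes, `p` halts within that time, the numbers of tokens per time-step and class that
it has written to its memory describe a solution of the problem on `G`, and the register `0` holds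
the size of this solution. -/
def SolvesWithin (Sol : ∀ n : ℕ, TemporalGraph (Fin n) → (ℕ → Finset (Fin n)) → Prop)
    (p : Prog) (bound : ℕ → ℕ → ℝ) : Prop :=
  ∀ (n : ℕ) (G : TemporalGraph (Fin n)), 1 ≤ G.lifetime →
    ∀ P : ListedPartition (Fin n) (tnd G), IsTNDPartition G P →
      ∃ (m : ℕ) (s : State), Exec (inputOf G P) p State.init m s ∧
        (m : ℝ) ≤ bound (tnd G) G.lifetime ∧
        (∀ t, 1 ≤ t → t ≤ G.lifetime → ∀ i : Fin (tnd G), tokens (tnd G) s.mem t i ≤ (P.cls i).length) ∧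
        Sol n G (decode P s.mem) ∧
        s.reg 0 = (decode P s.mem 1).card

end TempReconf

namespace TempReconf

/-! ### Reasoning about programs -/

/-! Vertices of one class have the same neighbours apart from each other. So at each time-step a
class is a clique or an independent set, and two classes are completely joined or not joined at all.
Only the numbers of tokens per class matter: a set dominates iff every class either is linked to an
occupied class or holds at least its weight, which is 1 for a clique and the size of the class
otherwise; it is independent iff occupied classes are pairwise unlinked and hold at most their
weights (`isDominatingSet_of_count`, `isIndependentSet_of_count` and their converses). A matrix of
moves between classes is realised by actual tokens, because tokens that stay in a class need not
move at all and all other moves go between completely joined classes (`reconfigurable_of_moves`).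

Guess one bit per cell, that is, per time-step and class, saying which classes are relied on to be
occupied (dominating sets) or allowed to be (independent sets). For a fixed guess the conditions
become lower and upper bounds on the counts (`feasible_of_bounds`, `Feasible.bounds`). The optimum
under these bounds is a maximum flow through an entrance and an exit for each cell. The computation
starts from a position that satisfies all bounds: no tokens for independent sets, a token on every
vertex for dominating sets. The flow then counts the tokens that are added, or removed. Plans of
moves and flows correspond to each other, with the number of units at the sink as score
(`Network.Plan.score_le`, `Preflow.Good.plan`, `Preflow.Good.excess_sink`).

The flow is found by pushing and relabelling on `N = 2τk + 2` nodes. With the largest label of an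
active node as potential, `4N²` passes suffice (`Preflow.MainInv.step`). A pass tries at most `N²`
arcs, and each access to the matrix costs `O(N)` steps, since addresses are computed by repeated
addition. So a guess costs `O(N⁵)`, and the `2^(τk)` guesses cost `O(2^(τk) (τk)⁵)`, which is within
the bound. -/

@[simp] theorem State.set_reg (s : State) (x a y : ℕ) :
    (s.set x a).reg y = if y = x then a else s.reg y := by
  simp [State.set, Function.update_apply]

@[simp] theorem State.set_mem (s : State) (x a : ℕ) : (s.set x a).mem = s.mem := rfl

theorem State.ext' {s s' : State} (h : ∀ r, s.reg r = s'.reg r) (h' : s.mem = s'.mem) :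
    s = s' := by
  cases s; cases s'; simp_all [funext_iff]

/-- Write a value to the memory. -/
def State.put (s : State) (a v : ℕ) : State := ⟨s.reg, Function.update s.mem a v⟩

@[simp] theorem State.put_reg (s : State) (a v : ℕ) : (s.put a v).reg = s.reg := rfl

@[simp] theorem State.put_mem (s : State) (a v : ℕ) :
    (s.put a v).mem = Function.update s.mem a v := rfl

/-- Determinism lets `WP`, an existence statement, be rewritten by equivalences, so that `simp` can
execute straight-line code symbolically. -/
theorem Exec.deterministic {I : Input} {p : Prog} {s s₁ s₂ : State} {m₁ m₂ : ℕ}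
    (h₁ : Exec I p s m₁ s₁) (h₂ : Exec I p s m₂ s₂) : m₁ = m₂ ∧ s₁ = s₂ := by
  induction h₁ generalizing m₂ s₂ with
  | const | add | sub | load | store | readLifetime | readOrder | readClasses | readSize
  | readMember | readAdj => cases h₂; exact ⟨rfl, rfl⟩
  | seq _ _ ih₁ ih₂ =>
    cases h₂ with
    | seq a b =>
      obtain ⟨rfl, rfl⟩ := ih₁ a
      obtain ⟨rfl, rfl⟩ := ih₂ b
      exact ⟨rfl, rfl⟩
  | ifTrue h _ ih =>
    cases h₂ with
    | ifTrue _ a => obtain ⟨rfl, rfl⟩ := ih a; exact ⟨rfl, rfl⟩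
    | ifFalse h' _ => exact absurd h' h
  | ifFalse h _ ih =>
    cases h₂ with
    | ifTrue h' _ => exact absurd h h'
    | ifFalse _ a => obtain ⟨rfl, rfl⟩ := ih a; exact ⟨rfl, rfl⟩
  | whileDone h =>
    cases h₂ with
    | whileDone _ => exact ⟨rfl, rfl⟩
    | whileStep h' _ _ => exact absurd h h'
  | whileStep h _ _ ih₁ ih₂ =>
    cases h₂ with
    | whileDone h' => exact absurd h' h
    | whileStep _ a b =>
      obtain ⟨rfl, rfl⟩ := ih₁ a
      obtain ⟨rfl, rfl⟩ := ih₂ b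
      exact ⟨rfl, rfl⟩

/-- Started in `s` at time `t`, the program halts in a configuration and at a time
which satisfy `Q`. -/
def WP (I : Input) (p : Prog) (s : State) (t : ℕ) (Q : State → ℕ → Prop) : Prop :=
  ∃ m s', Exec I p s m s' ∧ Q s' (t + m)

section rules

variable {I : Input} {s : State} {t : ℕ} {Q : State → ℕ → Prop}

theorem Exec.wp_iff {p : Prog} {m : ℕ} {s' : State} (h : Exec I p s m s') :
    WP I p s t Q ↔ Q s' (t + m) := by
  constructor
  · rintro ⟨m', s'', h', q⟩
    obtain ⟨rfl, rfl⟩ := h.deterministic h'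
    exact q
  · exact fun q => ⟨m, s', h, q⟩

theorem WP.mono {p : Prog} {Q' : State → ℕ → Prop} (h : WP I p s t Q)
    (hQ : ∀ s' t', Q s' t' → Q' s' t') : WP I p s t Q' := by
  obtain ⟨m, s', h, q⟩ := h
  exact ⟨m, s', h, hQ _ _ q⟩

@[simp] theorem wp_const (x c : ℕ) : WP I (.const x c) s t Q ↔ Q (s.set x c) (t + 1) :=
  (Exec.const s x c).wp_iff

@[simp] theorem wp_add (x y z : ℕ) :
    WP I (.add x y z) s t Q ↔ Q (s.set x (s.reg y + s.reg z)) (t + 1) :=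
  (Exec.add s x y z).wp_iff

@[simp] theorem wp_sub (x y z : ℕ) :
    WP I (.sub x y z) s t Q ↔ Q (s.set x (s.reg y - s.reg z)) (t + 1) :=
  (Exec.sub s x y z).wp_iff

@[simp] theorem wp_load (x y : ℕ) :
    WP I (.load x y) s t Q ↔ Q (s.set x (s.mem (s.reg y))) (t + 1) :=
  (Exec.load s x y).wp_iff

@[simp] theorem wp_store (x y : ℕ) :
    WP I (.store x y) s t Q ↔ Q (s.put (s.reg x) (s.reg y)) (t + 1) :=
  (Exec.store s x y).wp_iff

@[simp] theorem wp_readLifetime (x : ℕ) :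
    WP I (.readLifetime x) s t Q ↔ Q (s.set x I.lifetime) (t + 1) :=
  (Exec.readLifetime s x).wp_iff

@[simp] theorem wp_readOrder (x : ℕ) :
    WP I (.readOrder x) s t Q ↔ Q (s.set x I.order) (t + 1) :=
  (Exec.readOrder s x).wp_iff

@[simp] theorem wp_readClasses (x : ℕ) :
    WP I (.readClasses x) s t Q ↔ Q (s.set x I.classes) (t + 1) :=
  (Exec.readClasses s x).wp_iff

@[simp] theorem wp_readSize (x i : ℕ) :
    WP I (.readSize x i) s t Q ↔ Q (s.set x (I.size (s.reg i))) (t + 1) :=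
  (Exec.readSize s x i).wp_iff

@[simp] theorem wp_readMember (x i j : ℕ) :
    WP I (.readMember x i j) s t Q ↔ Q (s.set x (I.member (s.reg i) (s.reg j))) (t + 1) :=
  (Exec.readMember s x i j).wp_iff

@[simp] theorem wp_readAdj (x y u v : ℕ) :
    WP I (.readAdj x y u v) s t Q ↔
      Q (s.set x (I.adj (s.reg y) (s.reg u) (s.reg v))) (t + 1) :=
  (Exec.readAdj s x y u v).wp_iff

@[simp] theorem wp_seq (p q : Prog) :
    WP I (.seq p q) s t Q ↔ WP I p s t (fun s' t' => WP I q s' t' Q) := by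
  constructor
  · rintro ⟨m, s', h, hq⟩
    cases h with
    | seq h₁ h₂ => exact ⟨_, _, h₁, _, _, h₂, by rwa [add_assoc]⟩
  · rintro ⟨m, s', h₁, m', s'', h₂, hq⟩
    exact ⟨_, _, .seq h₁ h₂, by rwa [← add_assoc]⟩

theorem wp_if (x : ℕ) (p q : Prog) :
    WP I (.ifNonzero x p q) s t Q ↔
      (s.reg x ≠ 0 → WP I p s (t + 1) Q) ∧ (s.reg x = 0 → WP I q s (t + 1) Q) := by
  by_cases hx : s.reg x = 0
  · simp only [hx, ne_eq, not_true, false_imp_iff, true_and, true_imp_iff]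
    constructor
    · rintro ⟨m, s', h, hq⟩
      cases h with
      | ifTrue h' _ => exact absurd hx h'
      | ifFalse _ h => exact ⟨_, _, h, by convert hq using 1; ring⟩
    · rintro ⟨m, s', h, hq⟩
      exact ⟨_, _, .ifFalse hx h, by convert hq using 1; ring⟩
  · simp only [hx, ne_eq, not_false_eq_true, true_imp_iff, false_imp_iff, and_true]
    constructor
    · rintro ⟨m, s', h, hq⟩
      cases h with
      | ifTrue _ h => exact ⟨_, _, h, by convert hq using 1; ring⟩
      | ifFalse h' _ => exact absurd h' hx
    · rintro ⟨m, s', h, hq⟩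
      exact ⟨_, _, .ifTrue hx h, by convert hq using 1; ring⟩

theorem wp_if_pos {x : ℕ} {p q : Prog} (hx : s.reg x ≠ 0) :
    WP I (.ifNonzero x p q) s t Q ↔ WP I p s (t + 1) Q := by
  simp [wp_if, hx]

theorem wp_if_neg {x : ℕ} {p q : Prog} (hx : s.reg x = 0) :
    WP I (.ifNonzero x p q) s t Q ↔ WP I q s (t + 1) Q := by
  simp [wp_if, hx]

end rules

/-- The program writes only to registers from `a` on. -/
def Prog.writesFrom (a : ℕ) : Prog → Bool
  | .const x _ | .add x _ _ | .sub x _ _ | .load x _ | .readLifetime x | .readOrder x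
  | .readClasses x | .readSize x _ | .readMember x _ _ | .readAdj x _ _ _ => decide (a ≤ x)
  | .store _ _ => true
  | .seq p q | .ifNonzero _ p q => p.writesFrom a && q.writesFrom a
  | .whileNonzero _ p => p.writesFrom a

/-- Nested loops keep their counters in increasing registers (13 for guesses, 16 for passes, 17 for
nodes, 18 for neighbours). One syntactic check on a loop body therefore protects the constants and
all outer counters. -/
theorem Exec.frame {I : Input} {p : Prog} {s s' : State} {m a : ℕ} (h : Exec I p s m s')
    (ha : p.writesFrom a = true) : ∀ r < a, s'.reg r = s.reg r := by
  induction h with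
  | const | add | sub | load | readLifetime | readOrder | readClasses | readSize
  | readMember | readAdj =>
    intro r hr
    simp only [Prog.writesFrom, decide_eq_true_eq] at ha
    simp [(hr.trans_le ha).ne]
  | store => intro r _; rfl
  | seq _ _ ih₁ ih₂ =>
    simp only [Prog.writesFrom, Bool.and_eq_true] at ha
    intro r hr
    rw [ih₂ ha.2 r hr, ih₁ ha.1 r hr]
  | ifTrue _ _ ih =>
    simp only [Prog.writesFrom, Bool.and_eq_true] at ha
    exact ih ha.1
  | ifFalse _ _ ih =>
    simp only [Prog.writesFrom, Bool.and_eq_true] at ha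
    exact ih ha.2
  | whileDone => intro r _; rfl
  | whileStep _ _ _ ih₁ ih₂ =>
    intro r hr
    rw [ih₂ ha r hr, ih₁ (by simpa [Prog.writesFrom] using ha) r hr]

theorem WP.frame {I : Input} {p : Prog} {s : State} {t : ℕ} {Q : State → ℕ → Prop}
    (a : ℕ) (ha : p.writesFrom a = true) (h : WP I p s t Q) :
    WP I p s t (fun s' t' => (∀ r < a, s'.reg r = s.reg r) ∧ Q s' t') := by
  obtain ⟨m, s', h, q⟩ := h
  exact ⟨m, s', h, h.frame ha, q⟩

/-! ### Loops

Register `0` holds `0` and register `1` holds `1`. A loop counts its register down, and the body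
sees the values `n - 1, …, 0`. -/

/-- The loop over the values below that of the register `c`, in decreasing order. -/
def loop (c : ℕ) (p : Prog) : Prog := .whileNonzero c (.seq (.sub c c 1) p)

/-- Do nothing of interest. -/
def skip : Prog := .const 40 0

/-- The `2` added to the cost `T` of the body pays for the test and the decrement, the final `1` for
the failing test. The decrement subtracts register `1`, which is why the invariant has to provide
its value. -/
theorem wp_loop {I : Input} {s : State} {t : ℕ} {Q : State → ℕ → Prop} {c : ℕ} {p : Prog}
    (n T : ℕ) (Inv : ℕ → State → Prop) (hn : s.reg c = n) (h0 : Inv n s)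
    (h1 : ∀ j s, Inv j s → s.reg 1 = 1)
    (hp : ∀ j < n, ∀ s, s.reg c = j + 1 → Inv (j + 1) s → ∀ t,
      WP I p (s.set c j) t (fun s' t' => s'.reg c = j ∧ Inv j s' ∧ t' ≤ t + T))
    (hQ : ∀ s' t', s'.reg c = 0 → Inv 0 s' → t' ≤ t + (n * (T + 2) + 1) → Q s' t') :
    WP I (loop c p) s t Q := by
  suffices H : ∃ m s', Exec I (loop c p) s m s' ∧ s'.reg c = 0 ∧ Inv 0 s' ∧
      m ≤ n * (T + 2) + 1 by
    obtain ⟨m, s', h, h', h'', hm⟩ := H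
    exact ⟨m, s', h, hQ _ _ h' h'' (by omega)⟩
  clear hQ
  induction n generalizing s with
  | zero => exact ⟨1, s, .whileDone hn, hn, h0, by omega⟩
  | succ n ih =>
    -- The cost bound does not depend on the starting time; at time `0` it bounds the number of
    -- steps itself.
    obtain ⟨m₁, s₁, he, hc, hI, hm⟩ := hp n (by omega) s hn h0 0
    obtain ⟨m₂, s₂, he₂, hc₂, hI₂, hm₂⟩ :=
      ih hc hI (fun j hj s => hp j (by omega) s)
    have hs : Exec I (.sub c c 1) s 1 (s.set c n) := by
      have := Exec.sub (I := I) s c c 1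
      rwa [hn, h1 _ _ h0, Nat.add_sub_cancel] at this
    refine ⟨_, s₂, .whileStep (by omega) (.seq hs he) he₂, hc₂, hI₂, ?_⟩
    have : (n + 1) * (T + 2) = n * (T + 2) + (T + 2) := by ring
    omega

/-- Add the register `y` to the register `x` as often as the register `c` says. -/
def addLoop (c x y : ℕ) : Prog := loop c (.add x x y)

theorem exec_addLoop {I : Input} {c x y : ℕ} (hcx : c ≠ x) (hcy : c ≠ y) (hxy : x ≠ y)
    (hc1 : c ≠ 1) (hx1 : x ≠ 1) (n : ℕ) (s : State) (h1 : s.reg 1 = 1) (hn : s.reg c = n) :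
    Exec I (addLoop c x y) s (3 * n + 1)
      ((s.set c 0).set x (s.reg x + n * s.reg y)) := by
  induction n generalizing s with
  | zero =>
    have e : (s.set c 0).set x (s.reg x + 0 * s.reg y) = s := by
      refine State.ext' ?_ rfl
      intro r
      by_cases hr : r = x <;> by_cases hr' : r = c <;> simp_all
    rw [e]
    exact .whileDone hn
  | succ n ih =>
    have hs : Exec I (.sub c c 1) s 1 (s.set c n) := by
      have := Exec.sub (I := I) s c c 1
      rwa [hn, h1, Nat.add_sub_cancel] at this
    have ha := Exec.add (I := I) (s.set c n) x x y
    have := ih ((s.set c n).set x ((s.set c n).reg x + (s.set c n).reg y))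
      (by simp [h1, hc1.symm, hx1.symm]) (by simp [hcx])
    have e := Exec.whileStep (by omega) (.seq hs ha) this
    have e1 : 1 + 1 + (3 * n + 1) + 1 = 3 * (n + 1) + 1 := by ring
    rw [e1] at e
    refine (congrArg (Exec I _ s _) ?_).mp e
    refine State.ext' ?_ rfl
    intro r
    by_cases hr : r = x
    · subst hr; simp [hcx.symm, hcy.symm, hxy.symm]; ring
    · by_cases hr' : r = c <;> simp [hr, hr', hcx]

/-- Double the register `x` as often as the register `c` says. -/
def doubleLoop (c x : ℕ) : Prog := loop c (.add x x x)

theorem exec_doubleLoop {I : Input} {c x : ℕ} (hcx : c ≠ x)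
    (hc1 : c ≠ 1) (hx1 : x ≠ 1) (n : ℕ) (s : State) (h1 : s.reg 1 = 1) (hn : s.reg c = n) :
    Exec I (doubleLoop c x) s (3 * n + 1) ((s.set c 0).set x (s.reg x * 2 ^ n)) := by
  induction n generalizing s with
  | zero =>
    have e : (s.set c 0).set x (s.reg x * 2 ^ 0) = s := by
      refine State.ext' ?_ rfl
      intro r
      by_cases hr : r = x <;> by_cases hr' : r = c <;> simp_all
    rw [e]
    exact .whileDone hn
  | succ n ih =>
    have hs : Exec I (.sub c c 1) s 1 (s.set c n) := by
      have := Exec.sub (I := I) s c c 1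
      rwa [hn, h1, Nat.add_sub_cancel] at this
    have ha := Exec.add (I := I) (s.set c n) x x x
    have := ih ((s.set c n).set x ((s.set c n).reg x + (s.set c n).reg x))
      (by simp [h1, hc1.symm, hx1.symm]) (by simp [hcx])
    have e := Exec.whileStep (by omega) (.seq hs ha) this
    have e1 : 1 + 1 + (3 * n + 1) + 1 = 3 * (n + 1) + 1 := by ring
    rw [e1] at e
    refine (congrArg (Exec I _ s _) ?_).mp e
    refine State.ext' ?_ rfl
    intro r
    by_cases hr : r = x
    · subst hr; simp [hcx.symm]; ring
    · by_cases hr' : r = c <;> simp [hr, hr', hcx]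

section

variable {I : Input} {s : State} {t : ℕ} {Q : State → ℕ → Prop}

theorem wp_addLoop {c x y : ℕ} (h1 : s.reg 1 = 1) (hcx : c ≠ x) (hcy : c ≠ y) (hxy : x ≠ y)
    (hc1 : c ≠ 1) (hx1 : x ≠ 1) :
    WP I (addLoop c x y) s t Q ↔
      Q ((s.set c 0).set x (s.reg x + s.reg c * s.reg y)) (t + (3 * s.reg c + 1)) :=
  (exec_addLoop hcx hcy hxy hc1 hx1 _ s h1 rfl).wp_iff

theorem wp_doubleLoop {c x : ℕ} (h1 : s.reg 1 = 1) (hcx : c ≠ x) (hc1 : c ≠ 1) (hx1 : x ≠ 1) :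
    WP I (doubleLoop c x) s t Q ↔
      Q ((s.set c 0).set x (s.reg x * 2 ^ s.reg c)) (t + (3 * s.reg c + 1)) :=
  (exec_doubleLoop hcx hc1 hx1 _ s h1 rfl).wp_iff

/-- The address of an entry of the work matrix, whose base address is in register `9` and whose
rows have the length that is in register `6`. -/
def State.loc (s : State) (a b : ℕ) : ℕ := s.reg 9 + b + a * s.reg 6

/-- Compute in register `40` the address of the entry in the row and column that
the registers `r` and `c` say. -/
def addr (r c : ℕ) : Prog := .seq (.add 40 9 c) (.seq (.add 41 r 0) (addLoop 41 40 6))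

/-- Read an entry of the work matrix. -/
def getEntry (x r c : ℕ) : Prog := .seq (addr r c) (.load x 40)

/-- Write an entry of the work matrix. -/
def putEntry (r c x : ℕ) : Prog := .seq (addr r c) (.store 40 x)

/-- The configuration after the computation of an address. -/
def State.withLoc (s : State) (a b : ℕ) : State := (s.set 41 0).set 40 (s.loc a b)

@[simp] theorem State.withLoc_mem (s : State) (a b : ℕ) : (s.withLoc a b).mem = s.mem := rfl

@[simp] theorem State.withLoc_reg (s : State) (a b r : ℕ) :
    (s.withLoc a b).reg r = if r = 40 then s.loc a b else if r = 41 then 0 else s.reg r := by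
  simp [State.withLoc]

/-- Multiplication is repeated addition, so an access costs time linear in the row number. This
accounts for one factor `nodes` in the running time. -/
theorem wp_addr {r c : ℕ} (h0 : s.reg 0 = 0) (h1 : s.reg 1 = 1) (hr : r ≠ 40) :
    WP I (addr r c) s t Q ↔
      Q (s.withLoc (s.reg r) (s.reg c)) (t + (3 * s.reg r + 3)) := by
  unfold addr
  simp only [wp_seq, wp_add]
  rw [wp_addLoop (by simp [h1]) (by decide) (by decide) (by decide) (by decide) (by decide)]
  simp only [State.set_reg, h0, hr, if_false]
  norm_num
  have e : ((((s.set 40 (s.reg 9 + s.reg c)).set 41 (s.reg r)).set 41 0).set 40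
      (s.reg 9 + s.reg c + s.reg r * s.reg 6)) = s.withLoc (s.reg r) (s.reg c) := by
    refine State.ext' ?_ rfl
    intro x
    by_cases h : x = 40 <;> by_cases h' : x = 41 <;> simp [h, h', State.loc]
  rw [e, show t + 1 + 1 + (3 * s.reg r + 1) = t + (3 * s.reg r + 3) by ring]

theorem wp_getEntry {x r c : ℕ} (h0 : s.reg 0 = 0) (h1 : s.reg 1 = 1) (hr : r ≠ 40) :
    WP I (getEntry x r c) s t Q ↔
      Q ((s.withLoc (s.reg r) (s.reg c)).set x (s.mem (s.loc (s.reg r) (s.reg c))))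
        (t + (3 * s.reg r + 4)) := by
  unfold getEntry
  rw [wp_seq, wp_addr h0 h1 hr, wp_load]
  simp [add_assoc]

theorem wp_putEntry {x r c : ℕ} (h0 : s.reg 0 = 0) (h1 : s.reg 1 = 1) (hr : r ≠ 40)
    (hx : x ≠ 40) (hx' : x ≠ 41) :
    WP I (putEntry r c x) s t Q ↔
      Q ((s.withLoc (s.reg r) (s.reg c)).put (s.loc (s.reg r) (s.reg c)) (s.reg x))
        (t + (3 * s.reg r + 4)) := by
  unfold putEntry
  rw [wp_seq, wp_addr h0 h1 hr, wp_store]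
  simp [add_assoc, hx, hx']

end

/-! ### Maximum flows by pushing and relabelling -/

/-- A preflow with labels: the residual capacities, the excesses and the labels. -/
@[ext] structure Preflow (V : Type) where
  R : V → V → ℕ
  e : V → ℕ
  d : V → ℕ

theorem sum_replace {V : Type} [Fintype V] [DecidableEq V] (f : V → ℕ) (v : V) (a : ℕ) :
    (∑ y, if y = v then a else f y) + f v = (∑ y, f y) + a := by
  rw [← Finset.add_sum_erase _ (fun y => if y = v then a else f y) (Finset.mem_univ v),
    ← Finset.add_sum_erase _ f (Finset.mem_univ v)]
  have : ∑ x ∈ Finset.univ.erase v, (if x = v then a else f x) =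
      ∑ x ∈ Finset.univ.erase v, f x :=
    Finset.sum_congr rfl fun x hx => if_neg (Finset.ne_of_mem_erase hx)
  simp only [if_true, this]
  omega

/-- Summing `R x y + R y x` over `X × X` gives twice the inner sum, and these pair sums are all that
a push preserves. -/
theorem sum_inner_eq {V : Type} {R R' : V → V → ℕ}
    (h : ∀ x y, R x y + R y x = R' x y + R' y x) (X : Finset V) :
    ∑ x ∈ X, ∑ y ∈ X, R x y = ∑ x ∈ X, ∑ y ∈ X, R' x y := by
  have h1 : ∀ R : V → V → ℕ, ∑ x ∈ X, ∑ y ∈ X, (R x y + R y x) =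
      2 * ∑ x ∈ X, ∑ y ∈ X, R x y := by
    intro R
    simp only [Finset.sum_add_distrib]
    rw [Finset.sum_comm (f := fun x y => R y x)]
    omega
  have h2 := h1 R
  have h3 := h1 R'
  simp only [h] at h2
  omega

/-- There is an unused label between two labels that are far apart. -/
theorem exists_gap {V : Type} [Fintype V] [DecidableEq V] (d : V → ℕ) {p q : V} {a : ℕ}
    (hp : d p ≤ a) (hq : a + Fintype.card V ≤ d q) :
    ∃ g, a < g ∧ g < a + Fintype.card V ∧ ∀ v, d v ≠ g := by
  by_contra hcon
  push Not at hcon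
  have hpos : 0 < Fintype.card V := Fintype.card_pos_iff.mpr ⟨p⟩
  have hpq : q ≠ p := by rintro rfl; omega
  -- Pigeonhole: the interval contains `card V - 1` labels, but only `card V - 2` vertices differ
  -- from `p` and `q`.
  have hsub : Finset.Ioo a (a + Fintype.card V) ⊆
      ((Finset.univ.erase p).erase q).image d := by
    intro g hg
    rw [Finset.mem_Ioo] at hg
    obtain ⟨v, rfl⟩ := hcon g hg.1 hg.2
    refine Finset.mem_image_of_mem _ ?_
    simp only [Finset.mem_erase, Finset.mem_univ, and_true]
    constructor <;> rintro rfl <;> omega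
  have h1 := (Finset.card_le_card hsub).trans Finset.card_image_le
  rw [Nat.card_Ioo, Finset.card_erase_of_mem (by simp [hpq]),
    Finset.card_erase_of_mem (Finset.mem_univ _), Finset.card_univ] at h1
  have : 1 < Fintype.card V := Fintype.one_lt_card_iff.mpr ⟨q, p, hpq⟩
  omega

namespace Preflow

variable {V : Type} [DecidableEq V]

/-- Push as much excess as possible from `u` to `v`, if `v` is one label below `u`. -/
def push (u v : V) (F : Preflow V) : Preflow V :=
  if F.d u = F.d v + 1 then
    { R := fun x y =>
        if x = u ∧ y = v then F.R u v - min (F.e u) (F.R u v)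
        else if x = v ∧ y = u then F.R v u + min (F.e u) (F.R u v) else F.R x y
      e := fun x =>
        if x = u then F.e u - min (F.e u) (F.R u v)
        else if x = v then F.e v + min (F.e u) (F.R u v) else F.e x
      d := F.d }
  else F

/-- Raise the label of `u`, if `u` has excess. -/
def relabel (u : V) (F : Preflow V) : Preflow V :=
  if F.e u = 0 then F else { F with d := fun x => if x = u then F.d u + 1 else F.d x }

@[simp] theorem push_d (u v : V) (F : Preflow V) : (F.push u v).d = F.d := by
  unfold push; split_ifs <;> rfl

variable [Fintype V]

/-- The sum of the initial capacities of the arcs that leave `x`, the source being saturated. -/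
def base (R₀ : V → V → ℕ) (src x : V) : ℕ := ∑ y, if y = src then 0 else R₀ x y

/-- The invariants of the preflow, relative to the initial residual capacities `R₀`. -/
structure Good (R₀ : V → V → ℕ) (src sink : V) (F : Preflow V) : Prop where
  pair : ∀ x y, F.R x y + F.R y x = R₀ x y + R₀ y x
  out : ∀ x, x ≠ src → ∑ y, F.R x y = base R₀ src x + F.e x
  valid : ∀ x y, 0 < F.R x y → F.d x ≤ F.d y + 1
  dsink : F.d sink = 0
  dsrc : F.d src = Fintype.card V
  dle : ∀ x, F.d x ≤ 2 * Fintype.card V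

variable {R₀ : V → V → ℕ} {src sink : V} {F : Preflow V}

/-- If no residual arc leaves `X`, the residual capacity out of its vertices lies inside `X`, where
the total is that of `R₀`. As the source is outside, this is at most the sum of `base`, and the law
`out` leaves nothing for the excesses. -/
theorem Good.excess_eq_zero (h : Good R₀ src sink F) {X : Finset V} (hs : src ∉ X)
    (hX : ∀ x ∈ X, ∀ y, y ∉ X → F.R x y = 0) {u : V} (hu : u ∈ X) : F.e u = 0 := by
  have h1 : ∑ x ∈ X, ∑ y, F.R x y = ∑ x ∈ X, ∑ y ∈ X, F.R x y := by
    refine Finset.sum_congr rfl fun x hx => ?_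
    exact (Finset.sum_subset (Finset.subset_univ X) fun y _ hy => hX x hx y hy).symm
  have h2 : ∑ x ∈ X, ∑ y, F.R x y = ∑ x ∈ X, base R₀ src x + ∑ x ∈ X, F.e x := by
    rw [← Finset.sum_add_distrib]
    exact Finset.sum_congr rfl fun x hx => h.out x (by rintro rfl; exact hs hx)
  have h3 : ∑ x ∈ X, ∑ y ∈ X, R₀ x y ≤ ∑ x ∈ X, base R₀ src x := by
    refine Finset.sum_le_sum fun x _ => ?_
    unfold base
    calc ∑ y ∈ X, R₀ x y = ∑ y ∈ X, if y = src then 0 else R₀ x y := by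
          refine Finset.sum_congr rfl fun y hy => (if_neg ?_).symm
          rintro rfl; exact hs hy
      _ ≤ _ := Finset.sum_le_sum_of_subset (Finset.subset_univ X)
  have h4 := sum_inner_eq h.pair X
  have h5 := Finset.single_le_sum (f := F.e) (fun _ _ => Nat.zero_le _) hu
  omega

/-- A vertex at label `2 * card V` or higher forces an unused label above that of the source. By
validity no residual arc descends across the gap, so the vertices above it have no excess. -/
theorem Good.label_lt (h : Good R₀ src sink F) {u : V} (hu : 0 < F.e u) :
    F.d u < 2 * Fintype.card V := by
  by_contra hcon
  push Not at hcon
  obtain ⟨g, hg1, hg2, hg⟩ := exists_gap F.d (p := src) (q := u) (a := Fintype.card V)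
    h.dsrc.le (by omega)
  refine hu.ne' (h.excess_eq_zero (X := Finset.univ.filter fun v => g < F.d v) ?_ ?_ ?_)
  · simp [h.dsrc]; omega
  · intro x hx y hy
    simp only [Finset.mem_filter, Finset.mem_univ, true_and] at hx hy
    by_contra h0
    have := h.valid x y (Nat.pos_of_ne_zero h0)
    have := hg y
    omega
  · simp; omega

/-- The only arc that can become residual is the one from `v` back to `u`, and it climbs by one
label. -/
theorem Good.push (h : Good R₀ src sink F) {u : V} (v : V) :
    Good R₀ src sink (F.push u v) := by
  by_cases hd : F.d u = F.d v + 1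
  swap
  · rwa [Preflow.push, if_neg hd]
  have huv : u ≠ v := by rintro rfl; omega
  have hm1 := min_le_left (F.e u) (F.R u v)
  have hm2 := min_le_right (F.e u) (F.R u v)
  rw [Preflow.push, if_pos hd]
  generalize min (F.e u) (F.R u v) = δ at *
  refine ⟨?_, ?_, ?_, h.dsink, h.dsrc, h.dle⟩
  · intro x y
    have := h.pair x y
    by_cases h1 : x = u ∧ y = v
    · obtain ⟨rfl, rfl⟩ := h1
      simp [huv]
      omega
    · by_cases h2 : x = v ∧ y = u
      · obtain ⟨rfl, rfl⟩ := h2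
        simp [huv, huv.symm]
        omega
      · have h3 : ¬ (y = u ∧ x = v) := fun h => h2 ⟨h.2, h.1⟩
        have h4 : ¬ (y = v ∧ x = u) := fun h => h1 ⟨h.2, h.1⟩
        simp only [h1, h2, h3, h4, if_false]
        exact this
  · intro x hx
    have := h.out x hx
    dsimp only
    by_cases hxu : x = u
    · subst hxu
      have h2 := sum_replace (F.R x) v (F.R x v - δ)
      simp only [true_and, huv, false_and, if_false, if_true]
      omega
    · by_cases hxv : x = v
      · subst hxv
        have h2 := sum_replace (F.R x) u (F.R x u + δ)
        simp only [true_and, huv.symm, false_and, if_false, if_true]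
        omega
      · simpa [hxu, hxv] using this
  · intro x y hxy
    dsimp only at hxy ⊢
    by_cases h2 : x = v ∧ y = u
    · obtain ⟨rfl, rfl⟩ := h2
      omega
    · apply h.valid
      by_cases h1 : x = u ∧ y = v
      · obtain ⟨rfl, rfl⟩ := h1
        simp at hxy
        omega
      · simpa [h1, h2] using hxy

/-- By `hs`, a vertex that still has excess has no residual arc to a label one below its own, so all
its residual arcs lead to labels at least as large and it may rise by one. The upper bound on labels
survives by `Good.label_lt`. -/
theorem Good.relabel (h : Good R₀ src sink F) {u : V} (hu1 : u ≠ src) (hu2 : u ≠ sink)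
    (hs : ∀ v, F.d u = F.d v + 1 → F.e u = 0 ∨ F.R u v = 0) :
    Good R₀ src sink (F.relabel u) := by
  by_cases he : F.e u = 0
  · rwa [Preflow.relabel, if_pos he]
  rw [Preflow.relabel, if_neg he]
  refine ⟨h.pair, h.out, ?_, ?_, ?_, ?_⟩
  · intro x y hxy
    have h1 := h.valid x y hxy
    dsimp only at hxy ⊢
    by_cases hx : x = u
    · subst hx
      have h3 : F.d x ≠ F.d y + 1 := fun h3 => by
        rcases hs y h3 with h4 | h4 <;> omega
      by_cases hy : y = x
      · simp [hy]
      · simp [hy]; omega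
    · by_cases hy : y = u
      · subst hy; simp [hx]; omega
      · simpa [hx, hy] using h1
  · simpa [hu2.symm] using h.dsink
  · simpa [hu1.symm] using h.dsrc
  · intro x
    dsimp only
    by_cases hx : x = u
    · have := h.label_lt (Nat.pos_of_ne_zero he)
      simp [hx]; omega
    · simpa [hx] using h.dle x

/-- The flow found is maximum. -/
theorem Good.optimal (h : Good R₀ src sink F)
    (he : ∀ u, u ≠ src → u ≠ sink → F.e u = 0) (hss : sink ≠ src)
    {R : V → V → ℕ} (hp : ∀ x y, R x y + R y x = R₀ x y + R₀ y x)
    (ho : ∀ u, u ≠ src → u ≠ sink → ∑ y, R u y = base R₀ src u) :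
    ∑ y, R sink y ≤ base R₀ src sink + F.e sink := by
  -- The sink has label `0` and the source label `card V`. The vertices below an unused label
  -- between them form a minimum cut: no residual arc enters it.
  obtain ⟨g, hg1, hg2, hg⟩ := exists_gap F.d (p := sink) (q := src) (a := 0)
    h.dsink.le (by rw [h.dsrc]; omega)
  set Y := Finset.univ.filter fun v => F.d v < g with hY
  have hsink : sink ∈ Y := by simp [hY, h.dsink, hg1]
  have hsrc : src ∉ Y := by simp [hY, h.dsrc]; omega
  have hcut : ∀ x, x ∉ Y → ∀ y ∈ Y, F.R x y = 0 := by
    intro x hx y hy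
    simp only [hY, Finset.mem_filter, Finset.mem_univ, true_and] at hx hy
    by_contra h0
    have := h.valid x y (Nat.pos_of_ne_zero h0)
    have := hg x
    omega
  -- Inside `Y` both totals agree. From `Y` to its complement, `F` has all of each pair sum, which
  -- is the most that any `R` can have.
  have key : ∑ x ∈ Y, ∑ y, R x y ≤ ∑ x ∈ Y, ∑ y, F.R x y := by
    have split : ∀ R : V → V → ℕ, ∑ x ∈ Y, ∑ y, R x y =
        ∑ x ∈ Y, ∑ y ∈ Y, R x y + ∑ x ∈ Y, ∑ y ∈ Yᶜ, R x y := by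
      intro R
      rw [← Finset.sum_add_distrib]
      exact Finset.sum_congr rfl fun x _ => (Finset.sum_add_sum_compl Y _).symm
    rw [split R, split F.R, sum_inner_eq (fun x y => (hp x y).trans (h.pair x y).symm)]
    refine Nat.add_le_add_left (Finset.sum_le_sum fun x hx => Finset.sum_le_sum fun y hy => ?_) _
    have h1 := hcut y (by simpa using hy) x hx
    have h2 := hp x y
    have h3 := h.pair x y
    omega
  rw [← Finset.add_sum_erase _ _ hsink, ← Finset.add_sum_erase _ (fun x => ∑ y, F.R x y) hsink,
    h.out sink hss] at key
  -- The remaining vertices of `Y` contribute `base` on both sides, so `key` reduces to the term of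
  -- the sink.
  have heq : ∑ x ∈ Y.erase sink, ∑ y, R x y = ∑ x ∈ Y.erase sink, ∑ y, F.R x y := by
    refine Finset.sum_congr rfl fun x hx => ?_
    have h1 : x ≠ sink := Finset.ne_of_mem_erase hx
    have h2 : x ≠ src := by rintro rfl; exact hsrc (Finset.mem_of_mem_erase hx)
    rw [ho x h2 h1, h.out x h2, he x h2 h1, add_zero]
  omega

/-! ### Scans, passes and the number of passes -/

variable {idx : V → ℕ}

/-- The invariant of the scan of the arcs leaving `u`, started with `F₀`, when the arcs to
the vertices from `j` on have been treated. -/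
structure ScanInv (R₀ : V → V → ℕ) (src sink : V) (idx : V → ℕ) (u : V) (F₀ : Preflow V) (j : ℕ)
    (F : Preflow V) : Prop where
  good : Good R₀ src sink F
  label : F.d = F₀.d
  excess : F.e u ≤ F₀.e u
  active : ∀ v, v ≠ u → 0 < F.e v → 0 < F₀.e v ∨ (0 < F₀.e u ∧ F₀.d u = F₀.d v + 1)
  done : ∀ v, j ≤ idx v → F.d u = F.d v + 1 → F.e u = 0 ∨ F.R u v = 0

theorem ScanInv.start (h : Good R₀ src sink F) {n : ℕ} (hn : ∀ v, idx v < n) (u : V) :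
    ScanInv R₀ src sink idx u F n F :=
  ⟨h, rfl, le_rfl, fun _ _ h => Or.inl h, fun v hv => absurd (hn v) (by omega)⟩

/-- A push from `u` to `v` changes no other arc leaving `u` and only lowers the excess of `u`, so
arcs treated before stay done. A vertex that becomes active lies one label below `u`. -/
theorem ScanInv.step {u v : V} {F₀ : Preflow V} {j : ℕ} (hidx : Function.Injective idx)
    (h : ScanInv R₀ src sink idx u F₀ (j + 1) F) (hv : idx v = j) :
    ScanInv R₀ src sink idx u F₀ j (F.push u v) := by
  have hlt : ∀ w, j ≤ idx w → w ≠ v → j + 1 ≤ idx w := by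
    intro w hw hne
    rcases Nat.eq_or_lt_of_le hw with h1 | h1
    · exact absurd (hidx (h1.symm.trans hv.symm)) hne
    · exact h1
  by_cases hd : F.d u = F.d v + 1
  swap
  · have e : F.push u v = F := by rw [Preflow.push, if_neg hd]
    rw [e]
    refine ⟨h.good, h.label, h.excess, h.active, fun w hw hdw => ?_⟩
    by_cases hwv : w = v
    · subst hwv; exact absurd hdw hd
    · exact h.done w (hlt w hw hwv) hdw
  have huv : u ≠ v := by rintro rfl; omega
  refine ⟨h.good.push v, by rw [push_d]; exact h.label, ?_, ?_, ?_⟩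
  · simp only [Preflow.push, if_pos hd, if_true]
    exact (Nat.sub_le _ _).trans h.excess
  · intro w hw hpos
    simp only [Preflow.push, if_pos hd, hw, if_false] at hpos
    by_cases hwv : w = v
    · subst hwv
      simp only [if_true] at hpos
      by_cases hw0 : 0 < F.e w
      · exact h.active w hw hw0
      · right
        rw [← h.label]
        refine ⟨lt_of_lt_of_le ?_ h.excess, hd⟩
        have := min_le_left (F.e u) (F.R u w)
        omega
    · rw [if_neg hwv] at hpos
      exact h.active w hw hpos
  · intro w hw hdw
    rw [push_d] at hdw
    simp only [Preflow.push, if_pos hd, if_true, true_and, huv, false_and, if_false]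
    by_cases hwv : w = v
    · subst hwv
      simp only [if_true]
      omega
    · rw [if_neg hwv]
      rcases h.done w (hlt w hw hwv) hdw with h1 | h1
      · left; omega
      · right; exact h1

/-- The invariant of a pass, started with `F₀` in which all active vertices have
labels below `H`, when the vertices from `j` on have been treated. -/
structure PassInv (R₀ : V → V → ℕ) (src sink : V) (idx : V → ℕ) (F₀ : Preflow V) (H j : ℕ)
    (F : Preflow V) : Prop where
  good : Good R₀ src sink F
  mono : ∀ x, F₀.d x ≤ F.d x
  todo : ∀ u, u ≠ src → u ≠ sink → idx u < j → 0 < F.e u → F.d u < H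
  done : ∀ u, u ≠ src → u ≠ sink → j ≤ idx u → 0 < F.e u → F.d u < H + 1
  same : F.d = F₀.d → ∀ u, u ≠ src → u ≠ sink → j ≤ idx u → 0 < F.e u → F.d u + 1 < H
  pos : F.d ≠ F₀.d → 0 < H

theorem PassInv.start {n H : ℕ} (h : Good R₀ src sink F)
    (hn : ∀ v, v ≠ src → v ≠ sink → idx v < n)
    (hH : ∀ u, u ≠ src → u ≠ sink → 0 < F.e u → F.d u < H) :
    PassInv R₀ src sink idx F H n F :=
  ⟨h, fun _ => le_rfl, fun u h1 h2 _ => hH u h1 h2,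
    fun u h1 h2 h3 => absurd (hn u h1 h2) (by omega),
    fun _ u h1 h2 h3 => absurd (hn u h1 h2) (by omega), fun h => absurd rfl h⟩

/-- A vertex becomes active only through a push from an active vertex one label higher, whose own
label is below `H`; this gives the margin in `same`. If the treated vertex keeps excess, it is
relabelled, and `same` no longer claims anything. -/
theorem PassInv.step {u : V} {F₀ F' : Preflow V} {H j : ℕ} (hidx : Function.Injective idx)
    (h : PassInv R₀ src sink idx F₀ H (j + 1) F) (hu : idx u = j) (hu1 : u ≠ src)
    (hu2 : u ≠ sink) (hs : ScanInv R₀ src sink idx u F 0 F') :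
    PassInv R₀ src sink idx F₀ H j (F'.relabel u) := by
  have hlt : ∀ w, j ≤ idx w → w ≠ u → j + 1 ≤ idx w := by
    intro w hw hne
    rcases Nat.eq_or_lt_of_le hw with h1 | h1
    · exact absurd (hidx (h1.symm.trans hu.symm)) hne
    · exact h1
  have hnew : ∀ v, v ≠ u → 0 < F'.e v → 0 < F.e v ∨ F.d v + 1 < H := by
    intro v hv hpos
    rcases hs.active v hv hpos with h1 | ⟨h1, h2⟩
    · exact Or.inl h1
    · right
      have := h.todo u hu1 hu2 (by omega) h1
      omega
  have hgood := hs.good.relabel hu1 hu2 (fun v => hs.done v (Nat.zero_le _))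
  have hu0 : 0 < F'.e u → F.d u < H := fun h1 =>
    h.todo u hu1 hu2 (by omega) (lt_of_lt_of_le h1 hs.excess)
  by_cases he : F'.e u = 0
  · have e : F'.relabel u = F' := by rw [Preflow.relabel, if_pos he]
    rw [e] at hgood ⊢
    refine ⟨hgood, fun x => ?_, ?_, ?_, ?_, fun hne => ?_⟩
    · rw [hs.label]; exact h.mono x
    · intro w h1 h2 h3 h4
      rw [hs.label]
      rcases hnew w (by rintro rfl; omega) h4 with h5 | h5
      · exact h.todo w h1 h2 (by omega) h5
      · omega
    · intro w h1 h2 h3 h4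
      rw [hs.label]
      have hwu : w ≠ u := by rintro rfl; omega
      rcases hnew w hwu h4 with h5 | h5
      · exact h.done w h1 h2 (hlt w h3 hwu) h5
      · omega
    · intro hsame w h1 h2 h3 h4
      rw [hs.label] at hsame ⊢
      have hwu : w ≠ u := by rintro rfl; omega
      rcases hnew w hwu h4 with h5 | h5
      · exact h.same hsame w h1 h2 (hlt w h3 hwu) h5
      · omega
    · rw [hs.label] at hne
      exact h.pos hne
  · have hHu := hu0 (Nat.pos_of_ne_zero he)
    have e : F'.relabel u = { F' with d := fun x => if x = u then F'.d u + 1 else F'.d x } := by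
      rw [Preflow.relabel, if_neg he]
    rw [e] at hgood ⊢
    refine ⟨hgood, fun x => ?_, ?_, ?_, ?_, fun _ => by omega⟩
    · have := h.mono x
      dsimp only
      rw [hs.label]
      split_ifs with hx
      · subst hx; omega
      · exact this
    · intro w h1 h2 h3 h4
      have hwu : w ≠ u := by rintro rfl; omega
      simp only [hwu, if_false, hs.label]
      rcases hnew w hwu h4 with h5 | h5
      · exact h.todo w h1 h2 (by omega) h5
      · omega
    · intro w h1 h2 h3 h4
      simp only [hs.label]
      split_ifs with hwu
      · omega
      · rcases hnew w hwu h4 with h5 | h5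
        · exact h.done w h1 h2 (hlt w h3 hwu) h5
        · omega
    · intro hsame
      have h5 := congrFun hsame u
      have h6 := h.mono u
      simp only [if_true, hs.label] at h5
      omega

/-- The invariant of the sequence of passes, after `c` passes. -/
structure MainInv (R₀ : V → V → ℕ) (src sink : V) (c : ℕ) (F : Preflow V) : Prop where
  good : Good R₀ src sink F
  bound : ∃ H, (∀ u, u ≠ src → u ≠ sink → 0 < F.e u → F.d u < H) ∧
    (H = 0 ∨ c + H ≤ 2 * ∑ x, F.d x)

theorem MainInv.start (hsrc : ∀ y, R₀ src y = 0) (hss : sink ≠ src) :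
    MainInv R₀ src sink 0
      ⟨R₀, fun x => R₀ x src, fun x => if x = src then Fintype.card V else 0⟩ := by
  have hc : 0 < Fintype.card V := Fintype.card_pos_iff.mpr ⟨src⟩
  -- The bound `H = 1` is right at the start: only the source has a label other than `0`.
  refine ⟨⟨fun _ _ => rfl, ?_, ?_, ?_, ?_, ?_⟩, 1, ?_, Or.inr ?_⟩
  · intro x _
    have h2 := sum_replace (R₀ x) src 0
    simp only [base]
    omega
  · intro x y hxy
    have : x ≠ src := by rintro rfl; simp [hsrc] at hxy
    simp [this]
  · simp [hss]
  · simp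
  · intro x
    dsimp only
    split_ifs <;> omega
  · intro u hu _ _
    simp [hu]
  · have h3 : ∑ x, (if x = src then Fintype.card V else 0) = Fintype.card V := by simp
    dsimp only
    omega

/-- A pass without relabelling lowers the bound `H` by one. A pass with relabelling raises `H` by
one at most, but also raises the sum of the labels, so `c + H` grows by two and so does the
right-hand side, at least. -/
theorem MainInv.step {c H : ℕ} {F' : Preflow V}
    (hH : H = 0 ∨ c + H ≤ 2 * ∑ x, F.d x)
    (hp : PassInv R₀ src sink idx F H 0 F') : MainInv R₀ src sink (c + 1) F' := by
  refine ⟨hp.good, ?_⟩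
  by_cases hd : F'.d = F.d
  · refine ⟨H - 1, fun u h1 h2 h3 => ?_, ?_⟩
    · have := hp.same hd u h1 h2 (Nat.zero_le _) h3
      omega
    · rw [hd]; omega
  · refine ⟨H + 1, fun u h1 h2 h3 => hp.done u h1 h2 (Nat.zero_le _) h3, Or.inr ?_⟩
    have h0 := hp.pos hd
    have hlt : ∑ x, F.d x < ∑ x, F'.d x := by
      apply Finset.sum_lt_sum (fun x _ => hp.mono x)
      by_contra hcon
      push Not at hcon
      exact hd (funext fun x => le_antisymm (hcon x (Finset.mem_univ x)) (hp.mono x))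
    omega

/-- Labels are at most `2 * card V`, so twice their sum never exceeds `4 * card V ^ 2`, and after
that many passes nothing is left for `H`. -/
theorem MainInv.excess_eq_zero (h : MainInv R₀ src sink (4 * Fintype.card V ^ 2) F) :
    ∀ u, u ≠ src → u ≠ sink → F.e u = 0 := by
  obtain ⟨H, hH, hb⟩ := h.bound
  have h1 : ∑ x, F.d x ≤ ∑ _x : V, 2 * Fintype.card V :=
    Finset.sum_le_sum fun x _ => h.good.dle x
  rw [Finset.sum_const, Finset.card_univ, smul_eq_mul] at h1
  have hH0 : H = 0 := by
    rcases hb with hb | hb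
    · exact hb
    · nlinarith
  intro u h2 h3
  by_contra h4
  have := hH u h2 h3 (Nat.pos_of_ne_zero h4)
  omega

end Preflow

/-! ### The nodes of the network and the layout of the memory -/

/-- The nodes of the network: an entrance and an exit for each time-step and class, the sink and
the source. -/
abbrev Node (τ k : ℕ) : Type := (Fin τ × Fin k ⊕ Fin τ × Fin k) ⊕ Fin 2

namespace Node

variable {τ k : ℕ}

/-- The entrance of a class at a time-step. -/
abbrev ent (t : Fin τ) (i : Fin k) : Node τ k := .inl (.inl (t, i))

/-- The exit of a class at a time-step. -/
abbrev exi (t : Fin τ) (i : Fin k) : Node τ k := .inl (.inr (t, i))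

/-- The sink. -/
abbrev sink : Node τ k := .inr 0

/-- The source. -/
abbrev src : Node τ k := .inr 1

/-- The number of a node. -/
def idx : Node τ k → ℕ
  | .inl (.inl (t, i)) => t * k + i
  | .inl (.inr (t, i)) => τ * k + (t * k + i)
  | .inr j => 2 * (τ * k) + j

theorem cell_lt {t i : ℕ} (ht : t < τ) (hi : i < k) : t * k + i < τ * k := by
  calc t * k + i < (t + 1) * k := by rw [Nat.succ_mul]; omega
    _ ≤ τ * k := Nat.mul_le_mul_right k ht

theorem cell_inj {t i t' i' : ℕ} (hi : i < k) (hi' : i' < k) :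
    t * k + i = t' * k + i' ↔ t = t' ∧ i = i' := by
  constructor
  · intro h
    have h1 := congrArg (· / k) h
    have h2 := congrArg (· % k) h
    have hk : 0 < k := by omega
    simp only [Nat.mul_comm _ k, Nat.mul_add_div hk, Nat.div_eq_of_lt hi, Nat.div_eq_of_lt hi',
      Nat.mul_add_mod, Nat.mod_eq_of_lt hi, Nat.mod_eq_of_lt hi', add_zero] at h1 h2
    exact ⟨h1, h2⟩
  · rintro ⟨rfl, rfl⟩; rfl

theorem idx_lt (v : Node τ k) : v.idx < 2 * (τ * k) + 2 := by
  rcases v with (⟨t, i⟩ | ⟨t, i⟩) | j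
  · have := cell_lt t.2 i.2; simp only [idx]; omega
  · have := cell_lt t.2 i.2; simp only [idx]; omega
  · simp only [idx]; omega

theorem idx_injective : Function.Injective (idx : Node τ k → ℕ) := by
  intro v w h
  rcases v with (⟨t, i⟩ | ⟨t, i⟩) | j <;> rcases w with (⟨t', i'⟩ | ⟨t', i'⟩) | j' <;>
    simp only [idx] at h
  · obtain ⟨h1, h2⟩ := (cell_inj i.2 i'.2).mp h
    rw [Fin.ext h1, Fin.ext h2]
  · have := cell_lt t.2 i.2; omega
  · have := cell_lt t.2 i.2; omega
  · have := cell_lt t'.2 i'.2; omega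
  · obtain ⟨h1, h2⟩ := (cell_inj i.2 i'.2).mp (Nat.add_left_cancel h)
    rw [Fin.ext h1, Fin.ext h2]
  · have := cell_lt t.2 i.2; omega
  · have := cell_lt t'.2 i'.2; omega
  · have := cell_lt t'.2 i'.2; omega
  · rw [Fin.ext (Nat.add_left_cancel h)]

theorem card_eq : Fintype.card (Node τ k) = 2 * (τ * k) + 2 := by
  simp; ring

theorem exists_idx {j : ℕ} (hj : j < 2 * (τ * k) + 2) : ∃ v : Node τ k, v.idx = j := by
  have hinj : Function.Injective (fun v : Node τ k => (⟨v.idx, idx_lt v⟩ : Fin _)) :=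
    fun v w h => idx_injective (Fin.mk.inj_iff.mp h)
  have hb := (Fintype.bijective_iff_injective_and_card _).mpr ⟨hinj, by rw [card_eq]; simp⟩
  obtain ⟨v, hv⟩ := hb.2 ⟨j, hj⟩
  exact ⟨v, by simpa using hv⟩

/-- The sink and the source carry the last two numbers, so a loop over the numbers below `2 * (τ *
k)` visits exactly the inner nodes. -/
theorem idx_lt_iff (v : Node τ k) : v.idx < 2 * (τ * k) ↔ v ≠ src ∧ v ≠ sink := by
  rcases v with (⟨t, i⟩ | ⟨t, i⟩) | j
  · have := cell_lt t.2 i.2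
    simp [idx]; omega
  · have := cell_lt t.2 i.2
    simp [idx]; omega
  · fin_cases j <;> simp [idx]

theorem sink_ne_src : (sink : Node τ k) ≠ src := by simp

end Node

open Node

/-- The number of cells: pairs of a time-step and a class. -/
def Input.cells (I : Input) : ℕ := I.lifetime * I.classes

/-- The number of nodes of the network. -/
def Input.nodes (I : Input) : ℕ := 2 * I.cells + 2

/-- The nodes of the network. -/
abbrev Input.Node (I : Input) : Type := TempReconf.Node I.lifetime I.classes

theorem Input.idx_lt {I : Input} (v : I.Node) : v.idx < I.nodes := Node.idx_lt v

/-- The contents of the registers that are not changed after the initialization. -/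
structure Glob (I : Input) (q : ℕ) (s : State) : Prop where
  r0 : s.reg 0 = 0
  r1 : s.reg 1 = 1
  r2 : s.reg 2 = I.lifetime
  r3 : s.reg 3 = I.classes
  r4 : s.reg 4 = I.order
  r5 : s.reg 5 = I.cells
  r6 : s.reg 6 = I.nodes
  r7 : s.reg 7 = 2 * I.cells
  r8 : s.reg 8 = 2 * I.cells + 1
  r9 : s.reg 9 = 3 * I.cells
  r10 : s.reg 10 = q
  r11 : s.reg 11 = 4 * I.nodes ^ 2
  r12 : s.reg 12 = I.nodes + 1

theorem Glob.of_frame {I : Input} {q : ℕ} {s s' : State} (g : Glob I q s)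
    (h : ∀ r < 13, s'.reg r = s.reg r) : Glob I q s' := by
  constructor <;> rw [h _ (by norm_num)]
  exacts [g.r0, g.r1, g.r2, g.r3, g.r4, g.r5, g.r6, g.r7, g.r8, g.r9, g.r10, g.r11, g.r12]

theorem Glob.set {I : Input} {q : ℕ} {s : State} (g : Glob I q s) {x a : ℕ} (hx : 13 ≤ x) :
    Glob I q (s.set x a) :=
  g.of_frame fun r hr => by simp [(hr.trans_le hx).ne]

/-! ### Representation of a preflow in the memory -/

namespace Preflow

variable {V : Type} [DecidableEq V]

/-- Change a residual capacity. -/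
def setR (F : Preflow V) (x y : V) (a : ℕ) : Preflow V :=
  { F with R := fun x' y' => if x' = x ∧ y' = y then a else F.R x' y' }

/-- Change an excess. -/
def setE (F : Preflow V) (x : V) (a : ℕ) : Preflow V :=
  { F with e := fun x' => if x' = x then a else F.e x' }

/-- Change a label. -/
def setD (F : Preflow V) (x : V) (a : ℕ) : Preflow V :=
  { F with d := fun x' => if x' = x then a else F.d x' }

end Preflow

/-- The memory holds the preflow: the residual capacities row by row, then the excesses,
then the labels. -/
structure Rep (I : Input) (mem : ℕ → ℕ) (F : Preflow I.Node) : Prop where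
  R : ∀ x y, mem (3 * I.cells + y.idx + x.idx * I.nodes) = F.R x y
  e : ∀ y, mem (3 * I.cells + y.idx + I.nodes * I.nodes) = F.e y
  d : ∀ y, mem (3 * I.cells + y.idx + (I.nodes + 1) * I.nodes) = F.d y

theorem loc_inj {N B a b a' b' : ℕ} (hb : b < N) (hb' : b' < N) :
    B + b + a * N = B + b' + a' * N ↔ a = a' ∧ b = b' := by
  rw [← cell_inj hb hb']
  omega

section Rep

variable {I : Input} {mem : ℕ → ℕ} {F : Preflow I.Node}

theorem Rep.setR (h : Rep I mem F) (x y : I.Node) (a : ℕ) :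
    Rep I (Function.update mem (3 * I.cells + y.idx + x.idx * I.nodes) a) (F.setR x y a) := by
  constructor
  · intro x' y'
    rw [Function.update_apply, h.R]
    simp only [loc_inj (I.idx_lt _) (I.idx_lt _), idx_injective.eq_iff, Preflow.setR]
  · intro y'
    rw [Function.update_apply, h.e, if_neg]
    · rfl
    · rw [loc_inj (I.idx_lt _) (I.idx_lt _)]
      have := I.idx_lt x
      omega
  · intro y'
    rw [Function.update_apply, h.d, if_neg]
    · rfl
    · rw [loc_inj (I.idx_lt _) (I.idx_lt _)]
      have := I.idx_lt x
      omega

theorem Rep.setE (h : Rep I mem F) (y : I.Node) (a : ℕ) :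
    Rep I (Function.update mem (3 * I.cells + y.idx + I.nodes * I.nodes) a) (F.setE y a) := by
  constructor
  · intro x' y'
    rw [Function.update_apply, h.R, if_neg]
    · rfl
    · rw [loc_inj (I.idx_lt _) (I.idx_lt _)]
      have := I.idx_lt x'
      omega
  · intro y'
    rw [Function.update_apply, h.e]
    simp only [loc_inj (I.idx_lt _) (I.idx_lt _), idx_injective.eq_iff, Preflow.setE, true_and]
  · intro y'
    rw [Function.update_apply, h.d, if_neg]
    · rfl
    · rw [loc_inj (I.idx_lt _) (I.idx_lt _)]
      omega

theorem Rep.setD (h : Rep I mem F) (y : I.Node) (a : ℕ) :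
    Rep I (Function.update mem (3 * I.cells + y.idx + (I.nodes + 1) * I.nodes) a)
      (F.setD y a) := by
  constructor
  · intro x' y'
    rw [Function.update_apply, h.R, if_neg]
    · rfl
    · rw [loc_inj (I.idx_lt _) (I.idx_lt _)]
      have := I.idx_lt x'
      omega
  · intro y'
    rw [Function.update_apply, h.e, if_neg]
    · rfl
    · rw [loc_inj (I.idx_lt _) (I.idx_lt _)]
      omega
  · intro y'
    rw [Function.update_apply, h.d]
    simp only [loc_inj (I.idx_lt _) (I.idx_lt _), idx_injective.eq_iff, Preflow.setD, true_and]

/-- Below address `3 * I.cells` lie, in blocks of `I.cells`, the recorded table, the lower bounds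
and the digits of the guess; the work matrix starts above them. -/
theorem update_low {p b c a : ℕ} (hp : p < 3 * I.cells) :
    Function.update mem (3 * I.cells + b + c) a p = mem p := by
  rw [Function.update_of_ne (by omega)]

end Rep

/-! ### The flow program -/

/-- Push from the node in register `17` to the one in register `18`, given the labels allow it. -/
def pushBody : Prog :=
  .seq (getEntry 30 6 17) <| .seq (getEntry 31 17 18) <| .seq (.sub 32 30 31) <|
  .seq (.sub 32 30 32) <| .seq (.sub 31 31 32) <| .seq (putEntry 17 18 31) <|
  .seq (.sub 30 30 32) <| .seq (putEntry 6 17 30) <| .seq (getEntry 30 18 17) <|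
  .seq (.add 30 30 32) <| .seq (putEntry 18 17 30) <| .seq (getEntry 30 6 18) <|
  .seq (.add 30 30 32) (putEntry 6 18 30)

/-- Push from the node in register `17` to the one in register `18`. -/
def pushCode : Prog :=
  .seq (getEntry 30 12 17) <| .seq (getEntry 31 12 18) <| .seq (.add 31 31 1) <|
  .seq (.sub 32 30 31) <| .seq (.sub 33 31 30) <| .seq (.add 32 32 33) <|
  .ifNonzero 32 skip pushBody

variable {I : Input} {q : ℕ} {s : State} {F : Preflow I.Node}

theorem wp_pushBody (g : Glob I q s) {u v : I.Node} (huv : F.d u = F.d v + 1)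
    (hu : s.reg 17 = u.idx) (hv : s.reg 18 = v.idx) (h : Rep I s.mem F) (t : ℕ) :
    WP I pushBody s t (fun s' t' => Rep I s'.mem (F.push u v) ∧
      (∀ p < 3 * I.cells, s'.mem p = s.mem p) ∧ t' ≤ t + (24 * I.nodes + 60)) := by
  have hne : u ≠ v := by rintro rfl; omega
  have hu' := I.idx_lt u
  have hv' := I.idx_lt v
  have h1 := h.setR u v (F.R u v - (F.e u - (F.e u - F.R u v)))
  have h2 := h1.setE u (F.e u - (F.e u - (F.e u - F.R u v)))
  have h3 := h2.setR v u (F.R v u + (F.e u - (F.e u - F.R u v)))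
  have h4 := h3.setE v (F.e v + (F.e u - (F.e u - F.R u v)))
  -- The second half of the code reads entries after earlier writes; as `u ≠ v`, these entries still
  -- have their old values.
  have e2 := h2.R v u
  have e3 := h3.e v
  simp only [Preflow.setR, Preflow.setE, hne, hne.symm, and_false, if_false] at e2 e3
  simp [pushBody, wp_getEntry, wp_putEntry, State.loc, g.r0, g.r1, g.r6, g.r9, hu, hv]
  simp only [h.R, h.e, e2, e3]
  refine ⟨?_, fun p hp => by simp only [update_low hp], by omega⟩
  convert h4 using 1
  -- The machine computes the minimum by two truncated subtractions.
  have e : min (F.e u) (F.R u v) = F.e u - (F.e u - F.R u v) := by omega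
  rw [Preflow.push, if_pos huv, e]
  ext x y
  · simp only [Preflow.setR, Preflow.setE]
    by_cases c1 : x = u ∧ y = v
    · obtain ⟨rfl, rfl⟩ := c1
      simp [hne]
    · simp [c1]
  · simp only [Preflow.setR, Preflow.setE]
    by_cases c1 : x = u
    · subst c1; simp [hne]
    · simp [c1]
  · rfl

theorem wp_pushCode (g : Glob I q s) {u v : I.Node}
    (hu : s.reg 17 = u.idx) (hv : s.reg 18 = v.idx) (h : Rep I s.mem F) (t : ℕ) :
    WP I pushCode s t (fun s' t' => Rep I s'.mem (F.push u v) ∧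
      (∀ p < 3 * I.cells, s'.mem p = s.mem p) ∧ t' ≤ t + 72 * I.nodes) := by
  have hN : 2 ≤ I.nodes := by unfold Input.nodes; omega
  simp [pushCode, wp_getEntry, State.loc, g.r0, g.r1, g.r6, g.r9, g.r12, hu, hv]
  simp only [h.d]
  -- The tested register is the sum of the truncated differences in both directions, which vanishes
  -- iff the two values are equal.
  rw [wp_if]
  constructor
  · intro h1
    simp at h1
    simp [skip]
    rw [Preflow.push, if_neg (by omega)]
    exact ⟨h, by omega⟩
  · intro h1
    simp at h1
    refine (wp_pushBody (q := q) (F := F) (u := u) (v := v) ?_ (by omega) (by simpa using hu)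
      (by simpa using hv) (by simpa using h) _).mono ?_
    · exact g.of_frame fun r hr => by simp; split_ifs <;> omega
    · rintro s' t' ⟨h1, h2, h3⟩
      exact ⟨h1, by simpa using h2, by omega⟩

/-- Raise the label of the node in register `17`, if it has excess. -/
def relabelCode : Prog :=
  .seq (getEntry 30 6 17) <| .ifNonzero 30
    (.seq (getEntry 31 12 17) <| .seq (.add 31 31 1) (putEntry 12 17 31)) skip

theorem wp_relabelCode (g : Glob I q s) {u : I.Node}
    (hu : s.reg 17 = u.idx) (h : Rep I s.mem F) (t : ℕ) :
    WP I relabelCode s t (fun s' t' => Rep I s'.mem (F.relabel u) ∧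
      (∀ p < 3 * I.cells, s'.mem p = s.mem p) ∧ t' ≤ t + 19 * I.nodes) := by
  have hN : 2 ≤ I.nodes := by unfold Input.nodes; omega
  simp [relabelCode, wp_getEntry, State.loc, g.r0, g.r1, g.r6, g.r9, hu]
  simp only [h.e]
  rw [wp_if]
  constructor
  · intro h1
    simp at h1
    have h2 := h.setD u (F.d u + 1)
    simp [wp_getEntry, wp_putEntry, State.loc, g.r0, g.r1, g.r6, g.r9, g.r12, hu]
    simp only [h.d]
    refine ⟨?_, fun p hp => by simp only [update_low hp], by omega⟩
    rw [Preflow.relabel, if_neg h1]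
    exact h2
  · intro h1
    simp at h1
    simp [skip]
    rw [Preflow.relabel, if_pos h1]
    exact ⟨h, by omega⟩

/-- Treat the node in register `17`. -/
def dischargeCode : Prog :=
  .seq (.add 18 6 0) <| .seq (loop 18 pushCode) relabelCode

theorem wp_dischargeCode {R₀ : I.Node → I.Node → ℕ} (g : Glob I q s) {u : I.Node}
    (hr : s.reg 17 = u.idx) (h : Rep I s.mem F)
    (hF : F.Good R₀ src sink) (t : ℕ) :
    WP I dischargeCode s t (fun s' t' =>
      (∃ F', F.ScanInv R₀ src sink idx u 0 F' ∧ Rep I s'.mem (F'.relabel u)) ∧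
      (∀ p < 3 * I.cells, s'.mem p = s.mem p) ∧ t' ≤ t + 84 * I.nodes ^ 2) := by
  have hN : 2 ≤ I.nodes := by unfold Input.nodes; omega
  simp only [dischargeCode, wp_seq, wp_add, g.r0, g.r6]
  refine wp_loop I.nodes (72 * I.nodes) (fun j s' => (∀ r < 18, s'.reg r = s.reg r) ∧
    (∀ p < 3 * I.cells, s'.mem p = s.mem p) ∧
    ∃ F', F.ScanInv R₀ src sink idx u j F' ∧ Rep I s'.mem F') (by simp) ?_ ?_ ?_ ?_
  · exact ⟨fun r hr => by simp [hr.ne], fun p _ => rfl, F, .start hF I.idx_lt u, h⟩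
  · rintro j s' ⟨h1, -, -⟩
    rw [h1 1 (by norm_num), g.r1]
  · rintro j hj s' hs' ⟨h1, h2, F', h3, h4⟩ t'
    obtain ⟨v, hv⟩ := Node.exists_idx (τ := I.lifetime) (k := I.classes) hj
    have g' : Glob I q (s'.set 18 j) :=
      (g.of_frame fun r hr => h1 r (by omega)).set (by norm_num)
    refine (WP.frame 30 (by decide) (wp_pushCode (u := u) (v := v) g'
      (by simp [h1 17 (by norm_num), hr]) (by simp [hv]) h4 t')).mono ?_
    rintro s'' t'' ⟨k1, k2, k3, k4⟩
    refine ⟨by simp [k1 18 (by norm_num)], ⟨fun r hr => ?_, fun p hp => ?_, _,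
      h3.step idx_injective hv, k2⟩, k4⟩
    · rw [k1 r (by omega), State.set_reg, if_neg hr.ne, h1 r hr]
    · rw [k3 p hp, State.set_mem, h2 p hp]
  · rintro s' t' - ⟨h1, h2, F', h3, h4⟩ ht
    refine (wp_relabelCode (u := u) (g.of_frame fun r hr => h1 r (by omega))
      (by rw [h1 17 (by norm_num), hr]) h4 t').mono ?_
    rintro s'' t'' ⟨k1, k2, k3⟩
    refine ⟨⟨F', h3, k1⟩, fun p hp => by rw [k2 p hp, h2 p hp], ?_⟩
    nlinarith

/-- Treat all nodes other than the sink and the source. -/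
def passCode : Prog := .seq (.add 17 7 0) (loop 17 dischargeCode)

theorem wp_passCode {R₀ : I.Node → I.Node → ℕ} (g : Glob I q s) {c : ℕ} (h : Rep I s.mem F)
    (hF : F.MainInv R₀ src sink c) (t : ℕ) :
    WP I passCode s t (fun s' t' =>
      (∃ F' : Preflow I.Node, F'.MainInv R₀ src sink (c + 1) ∧ Rep I s'.mem F') ∧
      (∀ p < 3 * I.cells, s'.mem p = s.mem p) ∧ t' ≤ t + 85 * I.nodes ^ 3) := by
  have hN : 2 ≤ I.nodes := by unfold Input.nodes; omega
  obtain ⟨H, hH, hc⟩ := hF.bound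
  simp only [passCode, wp_seq, wp_add, g.r0, g.r7]
  refine wp_loop (2 * I.cells) (84 * I.nodes ^ 2) (fun j s' => (∀ r < 17, s'.reg r = s.reg r) ∧
    (∀ p < 3 * I.cells, s'.mem p = s.mem p) ∧
    ∃ F', F.PassInv R₀ src sink idx H j F' ∧ Rep I s'.mem F') (by simp) ?_ ?_ ?_ ?_
  · exact ⟨fun r hr => by simp [hr.ne], fun p _ => rfl, F,
      .start hF.good (fun v h1 h2 => (Node.idx_lt_iff v).mpr ⟨h1, h2⟩) hH, h⟩
  · rintro j s' ⟨h1, -, -⟩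
    rw [h1 1 (by norm_num), g.r1]
  · rintro j hj s' hs' ⟨h1, h2, F', h3, h4⟩ t'
    obtain ⟨v, hv⟩ := Node.exists_idx (τ := I.lifetime) (k := I.classes) (j := j)
      (by unfold Input.cells at hj; omega)
    obtain ⟨hv1, hv2⟩ := (Node.idx_lt_iff v).mp (hv.trans_lt hj)
    have g' : Glob I q (s'.set 17 j) :=
      (g.of_frame fun r hr => h1 r (by omega)).set (by norm_num)
    refine (WP.frame 18 (by decide) (wp_dischargeCode (u := v) g'
      (by simp [hv]) h4 h3.good t')).mono ?_
    rintro s'' t'' ⟨k1, ⟨F'', k2, k2'⟩, k3, k4⟩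
    refine ⟨by simp [k1 17 (by norm_num)], ⟨fun r hr => ?_, fun p hp => ?_, _,
      h3.step idx_injective hv hv1 hv2 k2, k2'⟩, k4⟩
    · rw [k1 r (by omega), State.set_reg, if_neg hr.ne, h1 r hr]
    · rw [k3 p hp, State.set_mem, h2 p hp]
  · rintro s' t' - ⟨h1, h2, F', h3, h4⟩ ht
    refine ⟨⟨F', .step hc h3, h4⟩, h2, ht.trans ?_⟩
    have : 2 * I.cells ≤ I.nodes := by unfold Input.nodes; omega
    have : 2 * I.cells * (84 * I.nodes ^ 2 + 2) ≤ I.nodes * (84 * I.nodes ^ 2 + 2) :=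
      Nat.mul_le_mul_right _ this
    have : 4 * I.nodes ≤ I.nodes ^ 3 := by nlinarith
    nlinarith

/-- Compute a maximum flow. -/
def flowCode : Prog := .seq (.add 16 11 0) (loop 16 passCode)

theorem wp_flowCode {R₀ : I.Node → I.Node → ℕ} (g : Glob I q s) (h : Rep I s.mem F)
    (hF : F.MainInv R₀ src sink 0) (t : ℕ) :
    WP I flowCode s t (fun s' t' =>
      (∃ F' : Preflow I.Node, F'.Good R₀ src sink ∧ (∀ u, u ≠ src → u ≠ sink → F'.e u = 0) ∧
        Rep I s'.mem F') ∧
      (∀ p < 3 * I.cells, s'.mem p = s.mem p) ∧ t' ≤ t + 342 * I.nodes ^ 5) := by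
  have hN : 2 ≤ I.nodes := by unfold Input.nodes; omega
  simp only [flowCode, wp_seq, wp_add, g.r0, g.r11]
  refine wp_loop (4 * I.nodes ^ 2) (85 * I.nodes ^ 3)
    (fun j s' => (∀ r < 16, s'.reg r = s.reg r) ∧ (∀ p < 3 * I.cells, s'.mem p = s.mem p) ∧
    ∃ (c : ℕ) (F' : Preflow I.Node), c + j = 4 * I.nodes ^ 2 ∧ F'.MainInv R₀ src sink c ∧
      Rep I s'.mem F') (by simp) ?_ ?_ ?_ ?_
  · exact ⟨fun r hr => by simp [hr.ne], fun p _ => rfl, 0, F, by simp, hF, h⟩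
  · rintro j s' ⟨h1, -, -⟩
    rw [h1 1 (by norm_num), g.r1]
  · rintro j hj s' hs' ⟨h1, h2, c, F', hc, h3, h4⟩ t'
    have g' : Glob I q (s'.set 16 j) :=
      (g.of_frame fun r hr => h1 r (by omega)).set (by norm_num)
    refine (WP.frame 17 (by decide) (wp_passCode g' h4 h3 t')).mono ?_
    rintro s'' t'' ⟨k1, ⟨F'', k2, k2'⟩, k3, k4⟩
    refine ⟨by simp [k1 16 (by norm_num)], ⟨fun r hr => ?_, fun p hp => ?_, c + 1, F'',
      by omega, k2, k2'⟩, k4⟩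
    · rw [k1 r (by omega), State.set_reg, if_neg hr.ne, h1 r hr]
    · rw [k3 p hp, State.set_mem, h2 p hp]
  · rintro s' t' - ⟨h1, h2, c, F', hc, h3, h4⟩ ht
    -- Register `11` counts exactly as many passes as `MainInv.excess_eq_zero` asks for.
    have hc' : c = 4 * Fintype.card I.Node ^ 2 := by
      rw [Node.card_eq]; simpa [Input.nodes, Input.cells] using hc
    subst hc'
    refine ⟨⟨F', h3.good, h3.excess_eq_zero, h4⟩, h2, ht.trans ?_⟩
    have h8 : 8 ≤ I.nodes ^ 3 := Nat.pow_le_pow_left hN 3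
    have h4' : 4 ≤ I.nodes ^ 2 := Nat.pow_le_pow_left hN 2
    nlinarith

/-! ### The network of a guess -/

/-- The data of a network on the nodes `Node τ k`: lower and upper bounds for the numbers of
tokens, the numbers of tokens with which the flow computation starts, the sizes of the classes,
a capacity, and the allowed moves. -/
structure Network where
  lo : ℕ → ℕ → ℕ
  hi : ℕ → ℕ → ℕ
  start : ℕ → ℕ
  size : ℕ → ℕ
  cap : ℕ
  ok : ℕ → ℕ → ℕ → Bool

/-- The initial residual capacities, the arcs from the source being saturated. -/
def Network.R (W : Network) {τ k : ℕ} : Node τ k → Node τ k → ℕ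
  | .inl (.inl (t, i)), .inl (.inr (t', j)) =>
      (if t' = t ∧ j = i then W.hi t i - W.start i else 0) +
      (if (t : ℕ) = t' + 1 ∧ j = i then W.start i else 0)
  | .inl (.inr (t, i)), .inl (.inl (t', j)) =>
      (if t' = t ∧ j = i then W.start i - W.lo t i else 0) +
      (if (t' : ℕ) = t + 1 ∧ W.ok t i j = true then W.cap else 0)
  | .inl (.inl (t, i)), .inr z =>
      if (t : ℕ) = 0 then (if z = 1 then W.size i - W.start i else W.start i) else 0
  | .inl (.inr (t, i)), .inr z =>
      if (t : ℕ) + 1 = τ then (if z = 1 then W.start i else W.size i - W.start i) else 0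
  | _, _ => 0

namespace Input

variable (I : Input) (q : ℕ) (β : ℕ → ℕ → Bool)

/-- The first vertices of two classes are adjacent. Time-steps are numbered from `0`. -/
def linked (t i j : ℕ) : Bool := I.adj (t + 1) (I.member i 0) (I.member j 0) != 0

/-- Tokens may move from one class to the other. -/
def allowed (t i j : ℕ) : Bool := i == j || I.linked t i j

/-- `1` if the class is a clique, and its size otherwise. -/
def weight (t i : ℕ) : ℕ :=
  if I.adj (t + 1) (I.member i 0) (I.member i 1) ≠ 0 then 1 else I.size i

/-- Some chosen class is linked to the class `i`. -/
def near (t i : ℕ) : Bool := decide (∃ j < I.classes, β t j = true ∧ I.linked t i j = true)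

/-- The lower bounds that belong to the choice `β` of classes. -/
def lower (t i : ℕ) : ℕ :=
  if q ≠ 0 then (if I.near β t i then (β t i).toNat else I.weight t i) else 0

/-- The upper bounds that belong to the choice `β` of classes. -/
def upper (t i : ℕ) : ℕ :=
  if q ≠ 0 then I.size i
  else if I.near β t i then 0 else if β t i then I.weight t i else 0

/-- The numbers of tokens at the start. -/
def initial (i : ℕ) : ℕ := if q ≠ 0 then I.size i else 0

/-- The network that belongs to the choice `β` of classes. -/
def network : Network where
  lo := I.lower q β
  hi := I.upper q β
  start := I.initial q
  size := I.size
  cap := I.order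
  ok := I.allowed

end Input

/-! ### Building the network -/

/-- Find out whether the class is near a chosen class. -/
def nearBody : Prog :=
  .seq (.add 28 20 27) <| .seq (.add 28 28 7) <| .seq (.load 28 28) <|
  .seq (.readMember 29 27 0) <| .seq (.readAdj 29 19 24 29) <|
  .ifNonzero 28 (.ifNonzero 29 (.const 26 1) skip) skip

/-- Compute the weight of the class. -/
def weightCode : Prog :=
  .seq (.readMember 28 17 1) <| .seq (.readAdj 28 19 24 28) <|
  .ifNonzero 28 (.const 27 1) (.add 27 25 0)

/-- Compute the bounds from the weight and the information whether a chosen class is near. -/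
def selectCode : Prog :=
  .seq (.add 28 22 7) <| .seq (.load 28 28) <|
  .seq (.ifNonzero 10
    (.seq (.add 30 25 0) <| .seq (.add 31 25 0) <|
      .ifNonzero 26 (.add 29 28 0) (.add 29 27 0))
    (.seq (.const 29 0) <| .seq (.const 31 0) <|
      .ifNonzero 26 (.const 30 0) (.ifNonzero 28 (.add 30 27 0) (.const 30 0)))) <|
  .store 23 29

/-- Compute the bounds for the class in register `17` at the time-step in register `16`. -/
def boundsCode : Prog :=
  .seq (.add 19 16 1) <| .seq (.const 20 0) <| .seq (.add 21 16 0) <|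
  .seq (addLoop 21 20 3) <| .seq (.add 22 20 17) <| .seq (.add 23 5 22) <|
  .seq (.readMember 24 17 0) <| .seq (.readSize 25 17) <| .seq (.const 26 0) <|
  .seq (.add 27 3 0) <| .seq (loop 27 nearBody) <| .seq weightCode selectCode

variable {I : Input} {q : ℕ} {s : State} {β : ℕ → ℕ → Bool}

theorem wp_weightCode (g : Glob I q s) {t i : ℕ} (e17 : s.reg 17 = i) (e19 : s.reg 19 = t + 1)
    (e24 : s.reg 24 = I.member i 0) (e25 : s.reg 25 = I.size i) (T : ℕ) :
    WP I weightCode s T (fun s' T' => s'.reg 27 = I.weight t i ∧ s'.mem = s.mem ∧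
      (∀ r < 27, s'.reg r = s.reg r) ∧ T' ≤ T + 4) := by
  refine (WP.frame (Q := fun s' T' => s'.reg 27 = I.weight t i ∧
    s'.mem = s.mem ∧ T' ≤ T + 4) 27 (by decide) ?_).mono fun s' T' h => ⟨h.2.1, h.2.2.1, h.1, h.2.2.2⟩
  simp only [weightCode, wp_seq, wp_readMember, wp_readAdj, wp_if, wp_const, wp_add]
  simp [g.r0, g.r1, e17, e19, e24, e25, Input.weight]
  constructor <;> intro h <;> simp [h]

theorem wp_selectCode (g : Glob I q s) {t i : ℕ} (e22 : s.reg 22 = t * I.classes + i)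
    (e23 : s.reg 23 = I.cells + (t * I.classes + i)) (e25 : s.reg 25 = I.size i)
    (e26 : s.reg 26 = if I.near β t i = true then 1 else 0) (e27 : s.reg 27 = I.weight t i)
    (hb : s.mem (2 * I.cells + (t * I.classes + i)) = (β t i).toNat) (T : ℕ) :
    WP I selectCode s T (fun s' T' => (s'.reg 29 = I.lower q β t i ∧
      s'.reg 30 = I.upper q β t i ∧ s'.reg 31 = I.initial q i) ∧
      s'.mem = Function.update s.mem (I.cells + (t * I.classes + i)) (I.lower q β t i) ∧
      (∀ r < 28, s'.reg r = s.reg r) ∧ T' ≤ T + 9) := by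
  refine (WP.frame (Q := fun s' T' => (s'.reg 29 = I.lower q β t i ∧
    s'.reg 30 = I.upper q β t i ∧ s'.reg 31 = I.initial q i) ∧
    s'.mem = Function.update s.mem (I.cells + (t * I.classes + i)) (I.lower q β t i) ∧
    T' ≤ T + 9) 28 (by decide) ?_).mono fun s' T' h => ⟨h.2.1, h.2.2.1, h.1, h.2.2.2⟩
  rw [add_comm (2 * I.cells)] at hb
  simp only [selectCode, wp_seq, wp_add, wp_load]
  by_cases hq : q = 0
  · rw [wp_if_neg (by simp [g.r10, hq])]
    by_cases hn : I.near β t i = true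
    · simp [wp_if, e26, hn, Input.lower, Input.upper, Input.initial, hq, e23]
    · by_cases hbt : β t i = true
      · simp [wp_if, e26, hn, hbt, hb, Input.lower, Input.upper, Input.initial, hq, e22, e23, e27,
          g.r0, g.r7]

      · simp [wp_if, e26, hn, hbt, hb, Input.lower, Input.upper, Input.initial, hq, e22, e23, e27,
          g.r0, g.r7]

  · rw [wp_if_pos (by simp [g.r10, hq])]
    by_cases hn : I.near β t i = true
    · simp [wp_if, e26, hn, hb, Input.lower, Input.upper, Input.initial, hq, e22, e23, e25, g.r0,
        g.r7]
    · simp [wp_if, e26, hn, hb, Input.lower, Input.upper, Input.initial, hq, e22, e23, e25, g.r0,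
        g.r7, e27]

theorem wp_boundsCode (g : Glob I q s) {t i : ℕ} (ht : t < I.lifetime) (hi : i < I.classes)
    (h16 : s.reg 16 = t) (h17 : s.reg 17 = i)
    (hβ : ∀ j < I.classes, s.mem (2 * I.cells + (t * I.classes + j)) = (β t j).toNat) (T : ℕ) :
    WP I boundsCode s T (fun s' T' =>
      (s'.reg 19 = t + 1 ∧ s'.reg 20 = t * I.classes ∧ s'.reg 22 = t * I.classes + i ∧
        s'.reg 23 = I.cells + (t * I.classes + i) ∧ s'.reg 24 = I.member i 0 ∧
        s'.reg 25 = I.size i ∧ s'.reg 29 = I.lower q β t i ∧ s'.reg 30 = I.upper q β t i ∧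
        s'.reg 31 = I.initial q i) ∧
      s'.mem = Function.update s.mem (I.cells + (t * I.classes + i)) (I.lower q β t i) ∧
      T' ≤ T + 20 * I.nodes) := by
  have hk : I.classes ≤ I.cells := Nat.le_mul_of_pos_left _ (by omega)
  have hτ : I.lifetime ≤ I.cells := Nat.le_mul_of_pos_right _ (by omega)
  have hN : I.nodes = 2 * I.cells + 2 := rfl
  simp only [boundsCode, wp_seq, wp_add, wp_const, wp_readMember, wp_readSize]
  rw [wp_addLoop (by simp [g.r1]) (by decide) (by decide) (by decide) (by decide) (by decide)]
  refine wp_loop I.classes 9 (fun j s' =>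
    (∀ r < 19, s'.reg r = s.reg r) ∧ s'.mem = s.mem ∧
    (s'.reg 19 = t + 1 ∧ s'.reg 20 = t * I.classes ∧ s'.reg 22 = t * I.classes + i ∧
      s'.reg 23 = I.cells + (t * I.classes + i) ∧ s'.reg 24 = I.member i 0 ∧
      s'.reg 25 = I.size i) ∧
    s'.reg 26 = if ∃ j' < I.classes, j ≤ j' ∧ β t j' = true ∧ I.linked t i j' = true
      then 1 else 0) ?_ ?_ ?_ ?_ ?_
  · simp [g.r0, g.r3]
  · refine ⟨fun r hr => ?_, rfl, ?_, ?_⟩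
    · simp; split_ifs <;> omega
    · simp [g.r0, g.r1, g.r3, g.r5, h16, h17]
    · rw [if_neg (by rintro ⟨j', h1, h2, -⟩; omega)]
      simp
  · rintro j s' ⟨h1, -⟩
    rw [h1 1 (by norm_num), g.r1]
  · rintro j hj s' hs' ⟨h1, h2, ⟨e19, e20, e22, e23, e24, e25⟩, e26⟩ T'
    have e7 := (h1 7 (by norm_num)).trans g.r7
    have e0 := (h1 0 (by norm_num)).trans g.r0
    have hb : s.mem (t * I.classes + j + 2 * I.cells) = (β t j).toNat := by
      rw [← hβ j hj]; congr 1; omega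
    have hiff : (∃ j' < I.classes, j ≤ j' ∧ β t j' = true ∧ I.linked t i j' = true) ↔
        (β t j = true ∧ I.linked t i j = true) ∨
        (∃ j' < I.classes, j + 1 ≤ j' ∧ β t j' = true ∧ I.linked t i j' = true) := by
      constructor
      · rintro ⟨j', a1, a2, a3⟩
        rcases Nat.eq_or_lt_of_le a2 with rfl | a4
        · exact Or.inl a3
        · exact Or.inr ⟨j', a1, a4, a3⟩
      · rintro (a3 | ⟨j', a1, a2, a3⟩)
        · exact ⟨j, hj, le_rfl, a3⟩
        · exact ⟨j', a1, by omega, a3⟩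
    have hl : I.adj (t + 1) (I.member i 0) (I.member j 0) ≠ 0 ↔ I.linked t i j = true := by
      simp [Input.linked]
    refine (WP.frame (Q := fun s'' T'' => s''.reg 27 = j ∧ s''.mem = s.mem ∧
      s''.reg 26 = (if ∃ j' < I.classes, j ≤ j' ∧ β t j' = true ∧ I.linked t i j' = true
        then 1 else 0) ∧ T'' ≤ T' + 9) 26 (by decide) ?_).mono ?_
    · simp only [hiff, nearBody, wp_seq, wp_add, wp_load, wp_readMember, wp_readAdj]
      simp [e19, e20, e24, e7, e0, h2, hb]
      by_cases c1 : β t j = true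
      · by_cases c2 : I.linked t i j = true
        · simp [wp_if, c1, c2, hl, skip, add_assoc, h2]
        · have c2' := mt hl.mp c2
          simp only [not_not, ne_eq] at c2'
          simp [wp_if, c1, c2, c2', e26, skip, add_assoc, h2]
      · simp [wp_if, c1, e26, skip, add_assoc, h2]
    · rintro s'' T'' ⟨k1, k2, k3, k4, k5⟩
      have k : ∀ r < 26, s''.reg r = s'.reg r := fun r hr => by
        rw [k1 r hr, State.set_reg, if_neg (by omega)]
      refine ⟨k2, ⟨fun r hr => (k r (by omega)).trans (h1 r hr), k3, ?_, k4⟩, k5⟩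
      simp [k, e19, e20, e22, e23, e24, e25]
  · rintro s' T' - ⟨h1, h2, ⟨e19, e20, e22, e23, e24, e25⟩, e26⟩ hT
    have hnear : s'.reg 26 = if I.near β t i = true then 1 else 0 := by
      rw [e26]; simp [Input.near]
    have g' : Glob I q s' := g.of_frame fun r hr => h1 r (by omega)
    have hT' : T' ≤ T + 14 * I.cells + 20 := by
      simp [h16, g.r0] at hT
      nlinarith
    refine (wp_weightCode g' ((h1 17 (by norm_num)).trans h17) e19 e24 e25 T').mono ?_
    rintro s₁ T₁ ⟨a1, a2, a3, a4⟩
    refine (wp_selectCode (q := q) (β := β) (t := t) (i := i)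
      (g'.of_frame fun r hr => a3 r (by omega))
      (by simp [a3, e22]) (by simp [a3, e23]) (by simp [a3, e25]) (by simp [a3, hnear]) a1
      (by rw [a2, h2, hβ i hi]) T₁).mono ?_
    rintro s₂ T₂ ⟨⟨b1, b2, b3⟩, b4, b5, b6⟩
    refine ⟨⟨?_, ?_, ?_, ?_, ?_, ?_, b1, b2, b3⟩, by rw [b4, a2, h2], by omega⟩ <;>
      rw [b5 _ (by norm_num), a3 _ (by norm_num)] <;> assumption

/-- The capacities of the arcs between the entrance and the exit of the class in register `17` at
the time-step in register `16`. -/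
def coreCode : Prog :=
  .seq (.sub 32 30 31) <| .seq (putEntry 22 23 32) <| .seq (.sub 32 31 29) <|
  .seq (putEntry 23 22 32) <| .sub 32 25 31

/-- The capacities of the arcs leaving the entrance to the previous time-step, or at the first
time-step to the source and the sink. -/
def entryCode : Prog :=
  .ifNonzero 16
    (.seq (.sub 33 20 3) <| .seq (.add 33 33 17) <| .seq (.add 33 33 5) <| putEntry 22 33 31)
    (.seq (putEntry 6 22 32) <| .seq (putEntry 22 8 32) <| putEntry 22 7 31)

/-- The capacity of the arc leaving the exit to the entrance of the class in register `34` at the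
next time-step. -/
def moveBody : Prog :=
  .seq (.readMember 35 34 0) <| .seq (.readAdj 35 19 24 35) <| .seq (.sub 36 34 17) <|
  .seq (.sub 37 17 34) <| .seq (.add 36 36 37) <| .seq (.add 37 33 34) <|
  .ifNonzero 36 (.ifNonzero 35 (putEntry 23 37 4) skip) (putEntry 23 37 4)

/-- The capacities of the arcs leaving the exit to the next time-step, or at the last
time-step to the source and the sink. -/
def exitCode : Prog :=
  .seq (.sub 33 2 19) <| .ifNonzero 33
    (.seq (.add 33 20 3) <| .seq (.add 34 3 0) <| loop 34 moveBody)
    (.seq (putEntry 6 23 31) <| .seq (putEntry 23 8 31) <| putEntry 23 7 32)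

/-- The contents of the registers while the arcs of a class at a time-step are written. -/
structure CellRegs (I : Input) (q : ℕ) (β : ℕ → ℕ → Bool) (t i : ℕ) (s : State) : Prop where
  glob : Glob I q s
  r16 : s.reg 16 = t
  r17 : s.reg 17 = i
  r19 : s.reg 19 = t + 1
  r20 : s.reg 20 = t * I.classes
  r22 : s.reg 22 = t * I.classes + i
  r23 : s.reg 23 = I.cells + (t * I.classes + i)
  r24 : s.reg 24 = I.member i 0
  r25 : s.reg 25 = I.size i
  r29 : s.reg 29 = I.lower q β t i
  r30 : s.reg 30 = I.upper q β t i
  r31 : s.reg 31 = I.initial q i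

theorem CellRegs.of_frame {I : Input} {q : ℕ} {β : ℕ → ℕ → Bool} {t i : ℕ} {s s' : State}
    (c : CellRegs I q β t i s) (h : ∀ r < 32, s'.reg r = s.reg r) : CellRegs I q β t i s' := by
  constructor
  · exact c.glob.of_frame fun r hr => h r (by omega)
  all_goals rw [h _ (by norm_num)]
  exacts [c.r16, c.r17, c.r19, c.r20, c.r22, c.r23, c.r24, c.r25, c.r29, c.r30, c.r31]

section

variable {I : Input} {q : ℕ} {s : State} {β : ℕ → ℕ → Bool} {F : Preflow I.Node}
  {t : Fin I.lifetime} {i : Fin I.classes}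

theorem idx_ent : idx (ent t i) = t * I.classes + i := rfl

/-- This number is also the address of the lower bound of the cell, so one register serves as node
number and as address. -/
theorem idx_exi : idx (exi t i) = I.cells + (t * I.classes + i) := rfl

theorem idx_sink : idx (sink : I.Node) = 2 * I.cells := rfl

theorem idx_src : idx (src : I.Node) = 2 * I.cells + 1 := rfl

theorem wp_coreCode (c : CellRegs I q β t i s) (h : Rep I s.mem F) (T : ℕ) :
    WP I coreCode s T (fun s' T' => s'.reg 32 = I.size i - I.initial q i ∧
      Rep I s'.mem ((F.setR (ent t i) (exi t i) (I.upper q β t i - I.initial q i)).setR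
        (exi t i) (ent t i) (I.initial q i - I.lower q β t i)) ∧
      (∀ p < 3 * I.cells, s'.mem p = s.mem p) ∧ T' ≤ T + 14 * I.nodes) := by
  have hN : 2 ≤ I.nodes := by unfold Input.nodes; omega
  have h1 := I.idx_lt (ent t i)
  have h2 := I.idx_lt (exi t i)
  have g := c.glob
  rw [idx_ent] at h1
  rw [idx_exi] at h2
  simp [coreCode, wp_putEntry, State.loc, g.r0, g.r1, g.r6, g.r9, c.r22, c.r23, c.r29, c.r30,
    c.r31, c.r25]
  exact ⟨(h.setR (ent t i) (exi t i) _).setR (exi t i) (ent t i) _, fun p hp => by simp only [update_low hp],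
    by omega⟩

/-- The arcs leaving an entrance to another time-step, the source and the sink. -/
def Preflow.withEntry (F : Preflow I.Node) (t : Fin I.lifetime) (i : Fin I.classes) (a b : ℕ) :
    Preflow I.Node :=
  if (t : ℕ) ≠ 0 then F.setR (ent t i) (exi ⟨t - 1, by omega⟩ i) b
  else ((F.setE (ent t i) a).setR (ent t i) src a).setR (ent t i) sink b

theorem wp_entryCode (c : CellRegs I q β t i s) (h : Rep I s.mem F)
    (h32 : s.reg 32 = I.size i - I.initial q i) (T : ℕ) :
    WP I entryCode s T (fun s' T' =>
      Rep I s'.mem (F.withEntry t i (I.size i - I.initial q i) (I.initial q i)) ∧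
      (∀ p < 3 * I.cells, s'.mem p = s.mem p) ∧ T' ≤ T + 16 * I.nodes) := by
  have hN : 2 ≤ I.nodes := by unfold Input.nodes; omega
  have h1 := I.idx_lt (ent t i)
  have g := c.glob
  rw [idx_ent] at h1
  unfold Preflow.withEntry entryCode
  by_cases ht : (t : ℕ) = 0
  · rw [if_neg (by simp [ht]), wp_if_neg (by rw [c.r16, ht])]
    simp [wp_putEntry, State.loc, g.r0, g.r1, g.r6, g.r7, g.r8, g.r9, c.r22, c.r31, h32]
    exact ⟨((h.setE (ent t i) _).setR (ent t i) src _).setR (ent t i) sink _,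
      fun p hp => by simp only [update_low hp], by omega⟩
  · rw [if_pos ht, wp_if_pos (by rwa [c.r16])]
    simp [wp_putEntry, State.loc, g.r0, g.r1, g.r3, g.r5, g.r6, g.r9, c.r20, c.r22,
      c.r31, c.r17]
    refine ⟨?_, fun p hp => by simp only [update_low hp], by omega⟩
    have := h.setR (ent t i) (exi ⟨t - 1, by omega⟩ i) (I.initial q i)
    rw [idx_ent, idx_exi, Nat.sub_mul, one_mul] at this
    rwa [add_comm (_ + (i : ℕ)) I.cells]

theorem wp_moveBody (c : CellRegs I q β t i s) (h : Rep I s.mem F) {t' : Fin I.lifetime}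
    (ht : (t' : ℕ) = t + 1) {j : Fin I.classes} (h33 : s.reg 33 = (t + 1) * I.classes)
    (h34 : s.reg 34 = j) (T : ℕ) :
    WP I moveBody s T (fun s' T' =>
      Rep I s'.mem (if I.allowed t i j = true then F.setR (exi t i) (ent t' j) I.order else F) ∧
      (∀ p < 3 * I.cells, s'.mem p = s.mem p) ∧ T' ≤ T + (3 * I.nodes + 12)) := by
  have h1 := I.idx_lt (exi t i)
  have g := c.glob
  rw [idx_exi] at h1
  have hs := h.setR (exi t i) (ent t' j) I.order
  rw [idx_ent, idx_exi, ht] at hs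
  simp only [moveBody, wp_seq, wp_add, wp_sub, wp_readAdj, wp_readMember]
  by_cases hij : (i : ℕ) = j
  · rw [wp_if_neg (by simp [h34, c.r17, hij])]
    simp [wp_putEntry, State.loc, g.r0, g.r1, g.r4, g.r6, g.r9, c.r23, h33, h34]
    rw [if_pos (by simp [Input.allowed, hij])]
    exact ⟨hs, fun p hp => by simp only [update_low hp], by omega⟩
  · rw [wp_if_pos (by simp [h34, c.r17]; omega)]
    by_cases hl : I.linked t i j = true
    · rw [wp_if_pos (by simp [c.r19, c.r24, h34, g.r0]; simpa [Input.linked] using hl)]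
      simp [wp_putEntry, State.loc, g.r0, g.r1, g.r4, g.r6, g.r9, c.r23, h33, h34]
      rw [if_pos (by simp [Input.allowed, hl])]
      exact ⟨hs, fun p hp => by simp only [update_low hp], by omega⟩
    · rw [wp_if_neg (by simp [c.r19, c.r24, h34, g.r0]; simpa [Input.linked] using hl)]
      simp [skip]
      rw [if_neg (by simp [Input.allowed, hl, hij])]
      exact ⟨h, by omega⟩

/-- The arcs leaving an exit to another time-step, the source and the sink. -/
def Preflow.withExit (F : Preflow I.Node) (t : Fin I.lifetime) (i : Fin I.classes) (a b : ℕ) :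
    Preflow I.Node :=
  if (t : ℕ) + 1 ≠ I.lifetime then
    { F with R := fun x y => match y with
      | .inl (.inl (t', j)) =>
        if x = exi t i ∧ (t' : ℕ) = t + 1 ∧ I.allowed t i j = true then I.order else F.R x y
      | _ => F.R x y }
  else ((F.setE (exi t i) b).setR (exi t i) src b).setR (exi t i) sink a

theorem wp_exitCode (c : CellRegs I q β t i s) (h : Rep I s.mem F)
    (h32 : s.reg 32 = I.size i - I.initial q i) (T : ℕ) :
    WP I exitCode s T (fun s' T' =>
      Rep I s'.mem (F.withExit t i (I.size i - I.initial q i) (I.initial q i)) ∧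
      (∀ p < 3 * I.cells, s'.mem p = s.mem p) ∧ T' ≤ T + 9 * I.nodes ^ 2) := by
  have hN : 2 ≤ I.nodes := by unfold Input.nodes; omega
  have hk : I.classes ≤ I.cells := Nat.le_mul_of_pos_left _ (by have := t.2; omega)
  have hN' : I.nodes = 2 * I.cells + 2 := rfl
  have h1 := I.idx_lt (exi t i)
  have g := c.glob
  rw [idx_exi] at h1
  unfold Preflow.withExit exitCode
  simp only [wp_seq, wp_sub]
  by_cases ht : (t : ℕ) + 1 = I.lifetime
  · rw [if_neg (by simp [ht]), wp_if_neg (by simp [g.r2, c.r19, ht])]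
    simp [wp_putEntry, State.loc, g.r0, g.r1, g.r6, g.r7, g.r8, g.r9, c.r23, c.r31, h32]
    exact ⟨((h.setE (exi t i) _).setR (exi t i) src _).setR (exi t i) sink _,
      fun p hp => by simp only [update_low hp], by nlinarith⟩
  · have ht' : (t : ℕ) + 1 < I.lifetime := by omega
    rw [if_pos ht, wp_if_pos (by simp [g.r2, c.r19]; omega)]
    simp only [wp_seq, wp_add]
    refine wp_loop I.classes (3 * I.nodes + 12) (fun j s' => (∀ r < 32, s'.reg r = s.reg r) ∧
      s'.reg 33 = (t + 1) * I.classes ∧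
      (∀ p < 3 * I.cells, s'.mem p = s.mem p) ∧
      Rep I s'.mem { F with R := fun x y => match y with
        | .inl (.inl (t', j')) =>
          if x = exi t i ∧ (t' : ℕ) = t + 1 ∧ j ≤ (j' : ℕ) ∧ I.allowed t i j' = true
          then I.order else F.R x y
        | _ => F.R x y }) ?_ ?_ ?_ ?_ ?_
    · simp [g.r0, g.r3]
    · refine ⟨fun r hr => ?_, ?_, fun p _ => rfl, ?_⟩
      · simp; split_ifs <;> omega
      · simp [g.r3, c.r20]; ring
      · convert h using 1
        swap
        refine Preflow.ext (funext₂ fun x y => ?_) rfl rfl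
        rcases y with (⟨t', j'⟩ | y) | y
        · exact if_neg (by have := j'.2; omega)
        · rfl
        · rfl
        · rfl
    · rintro j s' ⟨h1, -⟩
      rw [h1 1 (by norm_num), g.r1]
    · rintro j hj s' hs' ⟨k1, k2, k3, k4⟩ T'
      refine (WP.frame 35 (by decide) (wp_moveBody (t' := ⟨t + 1, ht'⟩) (j := ⟨j, hj⟩)
        (c.of_frame (s' := s'.set 34 j) fun r hr => ?_) k4 rfl (by simpa using k2) (by simp)
        T')).mono ?_
      · simp [k1 r hr]; omega
      · rintro s'' T'' ⟨l1, l2, l3, l4⟩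
        refine ⟨by simp [l1], ⟨fun r hr => ?_, ?_, fun p hp => ?_, ?_⟩, l4⟩
        · rw [l1 r (by omega), State.set_reg, if_neg (by omega), k1 r hr]
        · simp [l1, k2]
        · rw [l3 p hp, State.set_mem, k3 p hp]
        · convert l2 using 1
          ext x y
          · rcases y with (⟨t', j'⟩ | y) | y
            · by_cases ha : I.allowed t i j = true
              · by_cases hj' : (j' : ℕ) = j
                · obtain rfl : j' = ⟨j, hj⟩ := Fin.ext hj'
                  simp [ha, Preflow.setR, Fin.ext_iff]
                · have e : (j < (j' : ℕ)) ↔ j ≤ (j' : ℕ) := by omega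
                  simp [ha, Preflow.setR, Fin.ext_iff, hj', e]
              · by_cases hj' : (j' : ℕ) = j
                · obtain rfl : j' = ⟨j, hj⟩ := Fin.ext hj'
                  simp [ha]
                · have e : (j < (j' : ℕ)) ↔ j ≤ (j' : ℕ) := by omega
                  simp [ha, e]
            · by_cases ha : I.allowed t i j = true <;> simp [ha, Preflow.setR]
            · by_cases ha : I.allowed t i j = true <;> simp [ha, Preflow.setR]
          · by_cases ha : I.allowed t i j = true <;> simp [ha, Preflow.setR]
          · by_cases ha : I.allowed t i j = true <;> simp [ha, Preflow.setR]
    · rintro s' T' - ⟨k1, k2, k3, k4⟩ hT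
      refine ⟨by simpa using k4, k3, hT.trans ?_⟩
      nlinarith

end

/-! ### Entries of the preflow after a cell has been written -/

section apply

variable {I : Input} (F : Preflow I.Node) (t : Fin I.lifetime) (i : Fin I.classes) (a b : ℕ)

theorem setR_R {V : Type} [DecidableEq V] (F : Preflow V) (x y x' y' : V) (a : ℕ) :
    (F.setR x y a).R x' y' = if x' = x ∧ y' = y then a else F.R x' y' := rfl

theorem withEntry_ent (x : I.Node) (t' j) :
    (F.withEntry t i a b).R x (ent t' j) = F.R x (ent t' j) := by
  unfold Preflow.withEntry
  split_ifs <;> simp [Preflow.setR, Preflow.setE]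

theorem withEntry_exi (x : I.Node) (t' j) : (F.withEntry t i a b).R x (exi t' j) =
    if x = ent t i ∧ (t : ℕ) = t' + 1 ∧ j = i then b else F.R x (exi t' j) := by
  unfold Preflow.withEntry
  split_ifs with h1 h2 h2
  · obtain ⟨rfl, h3, rfl⟩ := h2
    have : t' = ⟨t - 1, by omega⟩ := Fin.ext (by simp; omega)
    simp [Preflow.setR, this]
  · rw [setR_R, if_neg]
    rintro ⟨rfl, h3⟩
    simp only [Sum.inl.injEq, Sum.inr.injEq, Prod.mk.injEq, Fin.ext_iff] at h3
    exact h2 ⟨rfl, by omega, Fin.ext h3.2⟩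
  · omega
  · simp [Preflow.setR, Preflow.setE]

theorem withEntry_inr (x : I.Node) (z : Fin 2) : (F.withEntry t i a b).R x (.inr z) =
    if x = ent t i ∧ (t : ℕ) = 0 then (if z = 1 then a else b) else F.R x (.inr z) := by
  unfold Preflow.withEntry
  by_cases h : (t : ℕ) = 0
  · fin_cases z <;> simp [h, Preflow.setR, Preflow.setE]
  · simp [h, Preflow.setR]

theorem withEntry_e (x : I.Node) : (F.withEntry t i a b).e x =
    if x = ent t i ∧ (t : ℕ) = 0 then a else F.e x := by
  unfold Preflow.withEntry
  by_cases h : (t : ℕ) = 0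
  · simp [h, Preflow.setR, Preflow.setE]
  · simp [h, Preflow.setR]

theorem withEntry_d : (F.withEntry t i a b).d = F.d := by
  unfold Preflow.withEntry
  split_ifs <;> rfl

theorem withExit_ent (x : I.Node) (t' : Fin I.lifetime) (j) :
    (F.withExit t i a b).R x (ent t' j) =
    if x = exi t i ∧ (t' : ℕ) = t + 1 ∧ I.allowed t i j = true then I.order
    else F.R x (ent t' j) := by
  unfold Preflow.withExit
  by_cases h : (t : ℕ) + 1 = I.lifetime
  · have : (t' : ℕ) ≠ t + 1 := by have := t'.2; omega
    simp [h, Preflow.setR, Preflow.setE, this.trans_eq h]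
  · simp [h]

theorem withExit_exi (x : I.Node) (t' j) :
    (F.withExit t i a b).R x (exi t' j) = F.R x (exi t' j) := by
  unfold Preflow.withExit
  by_cases h : (t : ℕ) + 1 = I.lifetime
  · simp [h, Preflow.setR, Preflow.setE]
  · simp [h]

theorem withExit_inr (x : I.Node) (z : Fin 2) : (F.withExit t i a b).R x (.inr z) =
    if x = exi t i ∧ (t : ℕ) + 1 = I.lifetime then (if z = 1 then b else a)
    else F.R x (.inr z) := by
  unfold Preflow.withExit
  by_cases h : (t : ℕ) + 1 = I.lifetime
  · fin_cases z <;> simp [h, Preflow.setR, Preflow.setE]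
  · simp [h]

theorem withExit_e (x : I.Node) : (F.withExit t i a b).e x =
    if x = exi t i ∧ (t : ℕ) + 1 = I.lifetime then b else F.e x := by
  unfold Preflow.withExit
  by_cases h : (t : ℕ) + 1 = I.lifetime
  · simp [h, Preflow.setR, Preflow.setE]
  · simp [h]

theorem withExit_d : (F.withExit t i a b).d = F.d := by
  unfold Preflow.withExit
  split_ifs <;> rfl

end apply

open Classical in
/-- The part of the initial preflow that consists of the arcs leaving the entrances and
exits of the cells in `D`. -/
noncomputable def Network.part (W : Network) {τ k : ℕ} (D : ℕ → ℕ → Prop) :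
    Preflow (Node τ k) where
  R x y := match x with
    | .inl (.inl (t, i)) => if D t i then W.R x y else 0
    | .inl (.inr (t, i)) => if D t i then W.R x y else 0
    | .inr _ => 0
  e x := match x with
    | .inl (.inl (t, i)) => if D t i then W.R x src else 0
    | .inl (.inr (t, i)) => if D t i then W.R x src else 0
    | .inr _ => 0
  d x := if x = src then 2 * (τ * k) + 2 else 0

section

variable {I : Input} {q : ℕ} {s : State} {β : ℕ → ℕ → Bool}

/-- The code of a cell writes all arcs that leave its two nodes and nothing in the rows of other
cells. Since these rows are still zero, the writes amount to adding the cell to `D`. -/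
theorem part_cell {D : ℕ → ℕ → Prop} {t : Fin I.lifetime} {i : Fin I.classes} (hD : ¬ D t i) :
    ((((((I.network q β).part D).setR (ent t i) (exi t i)
      (I.upper q β t i - I.initial q i)).setR (exi t i) (ent t i)
        (I.initial q i - I.lower q β t i)).withEntry t i (I.size i - I.initial q i)
          (I.initial q i)).withExit t i (I.size i - I.initial q i) (I.initial q i)) =
    (I.network q β).part (fun t' i' => D t' i' ∨ (t' = t ∧ i' = i)) := by
  classical
  refine Preflow.ext (funext₂ fun x y => ?_) (funext fun x => ?_) ?_
  · rcases x with (⟨t', i'⟩ | ⟨t', i'⟩) | x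
    · by_cases hc : t' = t ∧ i' = i
      · obtain ⟨rfl, rfl⟩ := hc
        rcases y with (⟨t'', j⟩ | ⟨t'', j⟩) | y
        · rw [withExit_ent, withEntry_ent]
          simp [setR_R, Network.part, Network.R]
        · rw [withExit_exi, withEntry_exi]
          by_cases h1 : t'' = t'
          · subst h1
            simp [setR_R, Network.part, Network.R, hD, Input.network]
          · simp [setR_R, Network.part, Network.R, hD, h1, Input.network]
        · rw [withExit_inr, withEntry_inr]
          simp [setR_R, Network.part, Network.R, hD, Input.network]
      · have hc' : ¬ ((t' : ℕ) = t ∧ (i' : ℕ) = i) := by simpa [Fin.ext_iff] using hc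
        rcases y with (⟨t'', j⟩ | ⟨t'', j⟩) | y
        · rw [withExit_ent, withEntry_ent]
          simp [setR_R, Network.part, hc']
        · rw [withExit_exi, withEntry_exi]
          simp [setR_R, Network.part, hc', hc]
        · rw [withExit_inr, withEntry_inr]
          simp [setR_R, Network.part, hc', hc]
    · by_cases hc : t' = t ∧ i' = i
      · obtain ⟨rfl, rfl⟩ := hc
        rcases y with (⟨t'', j⟩ | ⟨t'', j⟩) | y
        · rw [withExit_ent, withEntry_ent]
          by_cases h1 : t'' = t'
          · subst h1
            simp [setR_R, Network.part, Network.R, hD, Input.network]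
          · simp [setR_R, Network.part, Network.R, hD, h1, Input.network]
            rfl
        · rw [withExit_exi, withEntry_exi]
          simp [setR_R, Network.part, Network.R]
        · rw [withExit_inr, withEntry_inr]
          simp [setR_R, Network.part, Network.R, hD, Input.network]
      · have hc' : ¬ ((t' : ℕ) = t ∧ (i' : ℕ) = i) := by simpa [Fin.ext_iff] using hc
        rcases y with (⟨t'', j⟩ | ⟨t'', j⟩) | y
        · rw [withExit_ent, withEntry_ent]
          simp [setR_R, Network.part, hc', hc]
        · rw [withExit_exi, withEntry_exi]
          simp [setR_R, Network.part, hc']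
        · rw [withExit_inr, withEntry_inr]
          simp [setR_R, Network.part, hc', hc]
    · rcases y with (⟨t'', j⟩ | ⟨t'', j⟩) | y
      · rw [withExit_ent, withEntry_ent]
        simp [setR_R, Network.part]
      · rw [withExit_exi, withEntry_exi]
        simp [setR_R, Network.part]
      · rw [withExit_inr, withEntry_inr]
        simp [setR_R, Network.part]
  · rw [withExit_e, withEntry_e]
    rcases x with (⟨t', i'⟩ | ⟨t', i'⟩) | x
    · by_cases hc : t' = t ∧ i' = i
      · obtain ⟨rfl, rfl⟩ := hc
        simp [Preflow.setR, Network.part, Network.R, hD, Input.network]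
      · have hc' : ¬ ((t' : ℕ) = t ∧ (i' : ℕ) = i) := by simpa [Fin.ext_iff] using hc
        simp [Preflow.setR, Network.part, hc', hc]
    · by_cases hc : t' = t ∧ i' = i
      · obtain ⟨rfl, rfl⟩ := hc
        simp [Preflow.setR, Network.part, Network.R, hD, Input.network]
      · have hc' : ¬ ((t' : ℕ) = t ∧ (i' : ℕ) = i) := by simpa [Fin.ext_iff] using hc
        simp [Preflow.setR, Network.part, hc', hc]
    · simp [Preflow.setR, Network.part]
  · rw [withExit_d, withEntry_d]
    rfl

/-- Treat the class in register `17` at the time-step in register `16`. -/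
def cellCode : Prog := .seq boundsCode <| .seq coreCode <| .seq entryCode exitCode

theorem wp_cellCode (g : Glob I q s) {t : Fin I.lifetime} {i : Fin I.classes}
    (h16 : s.reg 16 = t) (h17 : s.reg 17 = i)
    (hβ : ∀ j < I.classes, s.mem (2 * I.cells + (t * I.classes + j)) = (β t j).toNat)
    {D : ℕ → ℕ → Prop} (hD : ¬ D t i) (h : Rep I s.mem ((I.network q β).part D)) (T : ℕ) :
    WP I cellCode s T (fun s' T' =>
      Rep I s'.mem ((I.network q β).part (fun t' i' => D t' i' ∨ (t' = t ∧ i' = i))) ∧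
      (∀ p < 3 * I.cells, p ≠ I.cells + (t * I.classes + i) → s'.mem p = s.mem p) ∧
      s'.mem (I.cells + (t * I.classes + i)) = I.lower q β t i ∧
      T' ≤ T + 34 * I.nodes ^ 2) := by
  have hN : 2 ≤ I.nodes := by unfold Input.nodes; omega
  have hlt := cell_lt t.2 i.2
  have hcl : I.cells = I.lifetime * I.classes := rfl
  simp only [cellCode, wp_seq]
  refine (WP.frame 19 (by decide) (wp_boundsCode g t.2 i.2 h16 h17 hβ T)).mono ?_
  rintro s₁ T₁ ⟨a1, ⟨b19, b20, b22, b23, b24, b25, b29, b30, b31⟩, a2, a3⟩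
  have c : CellRegs I q β t i s₁ := ⟨g.of_frame fun r hr => a1 r (by omega),
    by rw [a1 _ (by norm_num), h16], by rw [a1 _ (by norm_num), h17],
    b19, b20, b22, b23, b24, b25, b29, b30, b31⟩
  have h' : Rep I s₁.mem ((I.network q β).part D) := by
    have : ∀ p, s₁.mem (3 * I.cells + p) = s.mem (3 * I.cells + p) := fun p => by
      rw [a2, Function.update_of_ne (by omega)]
    refine ⟨fun x y => ?_, fun y => ?_, fun y => ?_⟩
    · rw [add_assoc, this, ← add_assoc, h.R]
    · rw [add_assoc, this, ← add_assoc, h.e]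
    · rw [add_assoc, this, ← add_assoc, h.d]
  refine (WP.frame 32 (by decide) (wp_coreCode c h' T₁)).mono ?_
  rintro s₂ T₂ ⟨c1, c2, c3, c4, c5⟩
  have c' := c.of_frame c1
  refine (WP.frame 33 (by decide) (wp_entryCode c' c3 c2 T₂)).mono ?_
  rintro s₃ T₃ ⟨d1, d3, d4, d5⟩
  have c'' := c'.of_frame fun r hr => d1 r (by omega)
  refine (wp_exitCode c'' d3 (by rw [d1 _ (by norm_num), c2]) T₃).mono ?_
  rintro s₄ T₄ ⟨e1, e2, e3⟩
  rw [part_cell hD] at e1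
  have hlow : ∀ p < 3 * I.cells, s₄.mem p = s₁.mem p := fun p hp => by
    rw [e2 p hp, d4 p hp, c4 p hp]
  refine ⟨e1, fun p hp hne => ?_, ?_, ?_⟩
  · rw [hlow p hp, a2, Function.update_of_ne hne]
  · rw [hlow _ (by omega), a2, Function.update_self]
  · nlinarith

theorem part_congr {W : Network} {τ k : ℕ} {D D' : ℕ → ℕ → Prop}
    (h : ∀ t < τ, ∀ i < k, (D t i ↔ D' t i)) : (W.part D : Preflow (Node τ k)) = W.part D' := by
  classical
  refine Preflow.ext (funext₂ fun x y => ?_) (funext fun x => ?_) rfl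
  · rcases x with (⟨t, i⟩ | ⟨t, i⟩) | x
    · exact if_congr (h t t.2 i i.2) rfl rfl
    · exact if_congr (h t t.2 i i.2) rfl rfl
    · rfl
  · rcases x with (⟨t, i⟩ | ⟨t, i⟩) | x
    · exact if_congr (h t t.2 i i.2) rfl rfl
    · exact if_congr (h t t.2 i i.2) rfl rfl
    · rfl

/-- The arcs and lower bounds of the cells in `D` have been written. -/
structure Built (I : Input) (q : ℕ) (β : ℕ → ℕ → Bool) (mem₀ : ℕ → ℕ) (D : ℕ → ℕ → Prop)
    (mem : ℕ → ℕ) : Prop where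
  rep : Rep I mem ((I.network q β).part D)
  low : ∀ p < 3 * I.cells, (p < I.cells ∨ 2 * I.cells ≤ p) → mem p = mem₀ p
  lower : ∀ t < I.lifetime, ∀ i < I.classes, D t i →
    mem (I.cells + (t * I.classes + i)) = I.lower q β t i

theorem Built.congr {mem₀ mem : ℕ → ℕ} {D D' : ℕ → ℕ → Prop} (b : Built I q β mem₀ D mem)
    (h : ∀ t < I.lifetime, ∀ i < I.classes, (D t i ↔ D' t i)) : Built I q β mem₀ D' mem :=
  ⟨part_congr h ▸ b.rep, b.low, fun t ht i hi hD => b.lower t ht i hi ((h t ht i hi).mpr hD)⟩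

/-- Write the network to the memory. -/
def cellsCode : Prog := .seq (.add 16 2 0) <| loop 16 (.seq (.add 17 3 0) (loop 17 cellCode))

theorem wp_cellsCode (g : Glob I q s) (hk : 0 < I.classes)
    (hβ : ∀ t < I.lifetime, ∀ j < I.classes,
      s.mem (2 * I.cells + (t * I.classes + j)) = (β t j).toNat)
    (h : Rep I s.mem ((I.network q β).part fun _ _ => False)) (T : ℕ) :
    WP I cellsCode s T (fun s' T' =>
      Built I q β s.mem (fun _ _ => True) s'.mem ∧ T' ≤ T + 50 * I.nodes ^ 3) := by
  have hN : I.nodes = 2 * (I.lifetime * I.classes) + 2 := rfl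
  simp only [cellsCode, wp_seq, wp_add]
  refine wp_loop I.lifetime (I.classes * (34 * I.nodes ^ 2 + 2) + 2)
    (fun j s' => (∀ r < 16, s'.reg r = s.reg r) ∧
      Built I q β s.mem (fun t' _ => j ≤ t') s'.mem) (by simp [g.r0, g.r2]) ?_ ?_ ?_ ?_
  · refine ⟨fun r hr => by simp [hr.ne], ?_, fun p _ _ => rfl, fun t ht i hi h => by omega⟩
    rw [part_congr (D' := fun _ _ => False) fun t ht i hi => by simpa using ht]
    exact h
  · rintro j s' ⟨h1, -⟩
    rw [h1 1 (by norm_num), g.r1]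
  · rintro t ht s₁ hs₁ ⟨h1, h2⟩ T₁
    simp only [wp_seq, wp_add]
    refine wp_loop I.classes (34 * I.nodes ^ 2)
      (fun j s' => (∀ r < 17, s'.reg r = (s₁.set 16 t).reg r) ∧
        Built I q β s.mem (fun t' i' => t + 1 ≤ t' ∨ (t' = t ∧ j ≤ i')) s'.mem) ?_ ?_ ?_ ?_ ?_
    · simp [h1, g.r0, g.r3]
    · refine ⟨fun r hr => by simp [hr.ne], h2.congr fun t' ht' i' hi' => ?_⟩
      omega
    · rintro j s' ⟨k1, -⟩
      rw [k1 1 (by norm_num), State.set_reg, if_neg (by norm_num), h1 1 (by norm_num), g.r1]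
    · rintro i hi s₂ hs₂ ⟨k1, k2⟩ T₂
      have k1' : ∀ r < 16, s₂.reg r = s.reg r := fun r hr => by
        rw [k1 r (by omega), State.set_reg, if_neg hr.ne, h1 r hr]
      have hc := cell_lt ht hi
      have hc' : I.cells = I.lifetime * I.classes := rfl
      refine (WP.frame 18 (by decide) (wp_cellCode (q := q) (β := β) (s := s₂.set 17 i)
        (t := ⟨t, ht⟩) (i := ⟨i, hi⟩)
        ((g.of_frame fun r hr => k1' r (by omega)).set (by norm_num)) (by simp [k1])
        (by simp) ?_ ?_ k2.rep T₂)).mono ?_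
      · intro j hj
        have := cell_lt ht hj
        dsimp only
        rw [State.set_mem, k2.low _ (by omega) (by omega), ← hβ t ht j hj]
      · dsimp only; omega
      · rintro s₃ T₃ ⟨l1, l2, l3, l4, l5⟩
        refine ⟨by simp [l1], ⟨fun r hr => ?_, ?_, ?_, ?_⟩, l5⟩
        · rw [l1 r (by omega), State.set_reg, if_neg hr.ne, k1 r hr]
        · rw [part_congr (D' := fun t' i' => t + 1 ≤ t' ∨ (t' = t ∧ i ≤ i'))] at l2
          · exact l2
          · intro t' ht' i' hi'
            dsimp only
            omega
        · intro p hp hp'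
          rw [l3 p hp (by dsimp only; omega), State.set_mem, k2.low p hp hp']
        · intro t' ht' i' hi' hD
          by_cases hti : t' = t ∧ i' = i
          · obtain ⟨rfl, rfl⟩ := hti
            exact l4
          · have := cell_lt ht' hi'
            rw [l3 _ (by omega), State.set_mem, k2.lower t' ht' i' hi' (by omega)]
            intro he
            exact hti ((cell_inj hi' hi).mp (Nat.add_left_cancel he))
    · rintro s' T' - ⟨k1, k2⟩ hT
      refine ⟨by rw [k1 16 (by norm_num)]; simp, ⟨fun r hr => ?_, k2.congr fun t' ht' i' hi' => ?_⟩,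
        by omega⟩
      · rw [k1 r (by omega), State.set_reg, if_neg hr.ne, h1 r hr]
      · omega
  · rintro s' T' - ⟨h1, h2⟩ hT
    refine ⟨h2.congr (by simp), hT.trans ?_⟩
    have e : I.lifetime * (I.classes * (34 * I.nodes ^ 2 + 2) + 2 + 2) =
        (I.lifetime * I.classes) * (34 * I.nodes ^ 2 + 2) + 4 * I.lifetime := by ring
    have hτ : I.lifetime ≤ I.lifetime * I.classes := Nat.le_mul_of_pos_right _ hk
    rw [e]
    generalize I.lifetime * I.classes = K at *
    have h2 : 2 * K ≤ I.nodes := by omega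
    have h3 : 2 * K * (34 * I.nodes ^ 2 + 2) ≤ I.nodes * (34 * I.nodes ^ 2 + 2) :=
      Nat.mul_le_mul_right _ h2
    have h4 : 4 * I.nodes ≤ I.nodes ^ 3 := by
      have : 2 ≤ I.nodes := by omega
      nlinarith
    nlinarith

end

/-! ### Digits of a guess and clearing of the work matrix -/

section

variable {I : Input} {q : ℕ} {s : State}

/-- Write a binary digit of the number in register `13` to the memory. -/
def bitBody : Prog :=
  .seq (.const 17 1) <| .seq (.add 18 16 0) <| .seq (doubleLoop 18 17) <|
  .seq (.sub 19 17 15) <| .seq (.add 20 7 16) <|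
  .ifNonzero 19 (.store 20 0) (.seq (.store 20 1) (.sub 15 15 17))

/-- Write the binary digits of the number in register `13` to the memory. -/
def bitsCode : Prog :=
  .seq (.add 15 13 0) <| .seq (.add 16 5 0) <| loop 16 bitBody

theorem wp_bitsCode (g : Glob I q s) {x : ℕ} (h13 : s.reg 13 = x) (hx : x < 2 ^ I.cells)
    (T : ℕ) :
    WP I bitsCode s T (fun s' T' =>
      (∀ j < I.cells, s'.mem (2 * I.cells + j) = (x.testBit j).toNat) ∧
      (∀ p < 2 * I.cells, s'.mem p = s.mem p) ∧ T' ≤ T + 8 * I.nodes ^ 2) := by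
  have hN : I.nodes = 2 * I.cells + 2 := rfl
  simp only [bitsCode, wp_seq, wp_add]
  refine wp_loop I.cells (3 * I.cells + 10)
    (fun j s' => (∀ r < 15, s'.reg r = s.reg r) ∧ s'.reg 15 = x % 2 ^ j ∧
      (∀ j' < I.cells, j ≤ j' → s'.mem (2 * I.cells + j') = (x.testBit j').toNat) ∧
      (∀ p < 2 * I.cells, s'.mem p = s.mem p)) (by simp [g.r0, g.r5]) ?_ ?_ ?_ ?_
  · refine ⟨fun r hr => ?_, ?_, fun j' h1 h2 => by omega, fun p _ => rfl⟩
    · simp; split_ifs <;> omega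
    · simp [g.r0, h13, Nat.mod_eq_of_lt hx]
  · rintro j s' ⟨h1, -⟩
    rw [h1 1 (by norm_num), g.r1]
  · rintro j hj s' hs' ⟨h1, h2, h3, h4⟩ T'
    -- Going downwards, register `15` holds the remainder of `x` below the current power of two, and
    -- the digit is `1` iff the remainder is at least `2 ^ j`.
    have hmod : x % 2 ^ (j + 1) = x % 2 ^ j + 2 ^ j * (x.testBit j).toNat := by
      rw [Nat.toNat_testBit, Nat.mod_pow_succ]
    have hlt : x % 2 ^ j < 2 ^ j := Nat.mod_lt _ (by positivity)
    have e0 := (h1 0 (by norm_num)).trans g.r0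
    have e1 := (h1 1 (by norm_num)).trans g.r1
    have e7 := (h1 7 (by norm_num)).trans g.r7
    refine (WP.frame (Q := fun s'' T'' => s''.reg 16 = j ∧ s''.reg 15 = x % 2 ^ j ∧
      s''.mem = Function.update s'.mem (2 * I.cells + j) (x.testBit j).toNat ∧
      T'' ≤ T' + (3 * I.cells + 10)) 15 (by decide) ?_).mono ?_
    · simp only [bitBody, wp_seq, wp_const, wp_add]
      rw [wp_doubleLoop (by simp [e1]) (by decide) (by decide) (by decide)]
      simp only [wp_sub]
      by_cases hb : x.testBit j = true
      · rw [hb] at hmod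
        rw [wp_if_neg (by simp [e0, h2, hmod])]
        simp [e0, e1, e7, h2, hmod, hb]
        omega
      · rw [Bool.not_eq_true] at hb
        rw [hb] at hmod
        simp only [Bool.toNat_false, mul_zero, add_zero] at hmod
        rw [wp_if_pos (by simp [e0, h2, hmod]; omega)]
        simp [e0, e7, h2, hmod, hb]
        omega
    · rintro s'' T'' ⟨k1, k2, k3, k4, k5⟩
      refine ⟨k2, ⟨fun r hr => ?_, k3, fun j' hj' hjj => ?_, fun p hp => ?_⟩, k5⟩
      · rw [k1 r hr, State.set_reg, if_neg (by omega), h1 r hr]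
      · rw [k4]
        by_cases he : j' = j
        · subst he; rw [Function.update_self]
        · rw [Function.update_of_ne (by omega), h3 j' hj' (by omega)]
      · rw [k4, Function.update_of_ne (by omega), h4 p hp]
  · rintro s' T' - ⟨h1, h2, h3, h4⟩ hT
    refine ⟨fun j hj => h3 j hj (Nat.zero_le _), h4, ?_⟩
    nlinarith

/-- Fill the work matrix with zeros and set the label of the source. -/
def clearCode : Prog :=
  .seq (.add 16 12 1) <|
  .seq (loop 16 (.seq (.add 17 6 0) (loop 17 (putEntry 16 17 0)))) (putEntry 12 8 6)

theorem wp_clearCode (g : Glob I q s) (β : ℕ → ℕ → Bool) (T : ℕ) :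
    WP I clearCode s T (fun s' T' =>
      Rep I s'.mem ((I.network q β).part fun _ _ => False) ∧
      (∀ p < 3 * I.cells, s'.mem p = s.mem p) ∧ T' ≤ T + 24 * I.nodes ^ 3) := by
  have hN : 2 ≤ I.nodes := by unfold Input.nodes; omega
  simp only [clearCode, wp_seq, wp_add]
  -- Two rows beyond the residual capacities hold the excesses and the labels.
  refine wp_loop (I.nodes + 2) (I.nodes * (3 * I.nodes + 9) + 2)
    (fun j s' => (∀ r < 16, s'.reg r = s.reg r) ∧
      (∀ a < I.nodes + 2, j ≤ a → ∀ b < I.nodes, s'.mem (3 * I.cells + b + a * I.nodes) = 0) ∧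
      (∀ p < 3 * I.cells, s'.mem p = s.mem p)) (by simp [g.r1, g.r12]) ?_ ?_ ?_ ?_
  · exact ⟨fun r hr => by simp [hr.ne], fun a h1 h2 => by omega, fun p _ => rfl⟩
  · rintro j s' ⟨h1, -⟩
    rw [h1 1 (by norm_num), g.r1]
  · rintro a ha s₁ hs₁ ⟨h1, h2, h3⟩ T₁
    simp only [wp_seq, wp_add]
    refine wp_loop I.nodes (3 * I.nodes + 7)
      (fun j s' => (∀ r < 17, s'.reg r = (s₁.set 16 a).reg r) ∧
        (∀ a' < I.nodes + 2, ∀ b < I.nodes, a + 1 ≤ a' ∨ (a' = a ∧ j ≤ b) →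
          s'.mem (3 * I.cells + b + a' * I.nodes) = 0) ∧
        (∀ p < 3 * I.cells, s'.mem p = s.mem p)) ?_ ?_ ?_ ?_ ?_
    · simp [h1, g.r0, g.r6]
    · exact ⟨fun r hr => by simp [hr.ne], fun a' ha' b hb hD => h2 a' ha' (by omega) b hb, h3⟩
    · rintro j s' ⟨k1, -⟩
      rw [k1 1 (by norm_num), State.set_reg, if_neg (by norm_num), h1 1 (by norm_num), g.r1]
    · rintro b hb s₂ hs₂ ⟨k1, k2, k3⟩ T₂
      have k1' : ∀ r < 16, s₂.reg r = s.reg r := fun r hr => by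
        rw [k1 r (by omega), State.set_reg, if_neg hr.ne, h1 r hr]
      have e16 : s₂.reg 16 = a := by rw [k1 16 (by norm_num)]; simp
      have e0 := (k1' 0 (by norm_num)).trans g.r0
      have e1 := (k1' 1 (by norm_num)).trans g.r1
      have e6 := (k1' 6 (by norm_num)).trans g.r6
      have e9 := (k1' 9 (by norm_num)).trans g.r9
      simp [wp_putEntry, State.loc, e0, e1, e6, e9, e16]
      refine ⟨⟨fun r hr => ?_, ?_, fun p hp => ?_⟩, by omega⟩
      · rw [if_neg (by omega), if_neg (by omega), if_neg (by omega), k1 r hr]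
        simp
      · intro a' ha' b' hb' hD
        rw [Function.update_apply]
        split_ifs with he
        · rfl
        · refine k2 a' ha' b' hb' ?_
          rcases hD with hD | ⟨rfl, hD⟩
          · exact Or.inl hD
          · right
            refine ⟨rfl, ?_⟩
            rcases Nat.eq_or_lt_of_le hD with rfl | hD
            · exact absurd rfl he
            · exact hD
      · rw [update_low hp, k3 p hp]
    · rintro s' T' - ⟨k1, k2, k3⟩ hT
      rw [show 3 * I.nodes + 7 + 2 = 3 * I.nodes + 9 from rfl] at hT
      refine ⟨by rw [k1 16 (by norm_num)]; simp, ⟨fun r hr => ?_, fun a' ha' hle b hb => ?_, k3⟩,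
        by omega⟩
      · rw [k1 r (by omega), State.set_reg, if_neg hr.ne, h1 r hr]
      · exact k2 a' ha' b hb (by omega)
  · rintro s' T' - ⟨h1, h2, h3⟩ hT
    have g' : Glob I q s' := g.of_frame fun r hr => h1 r (by omega)
    have hrep : Rep I s'.mem ⟨fun _ _ => 0, fun _ => 0, fun _ => 0⟩ :=
      ⟨fun x y => h2 _ (by have := I.idx_lt x; omega) (Nat.zero_le _) _ (I.idx_lt y),
        fun y => h2 _ (by omega) (Nat.zero_le _) _ (I.idx_lt y),
        fun y => h2 _ (by omega) (Nat.zero_le _) _ (I.idx_lt y)⟩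
    have hrep' := hrep.setD src I.nodes
    rw [idx_src] at hrep'
    simp [wp_putEntry, State.loc, g'.r0, g'.r1, g'.r6, g'.r8, g'.r9, g'.r12]
    refine ⟨?_, fun p hp => ?_, ?_⟩
    · convert hrep' using 1
      refine Preflow.ext (funext₂ fun x y => ?_) (funext fun x => ?_) rfl
      · rcases x with (⟨t, i⟩ | ⟨t, i⟩) | x <;> simp [Network.part, Preflow.setD]
      · rcases x with (⟨t, i⟩ | ⟨t, i⟩) | x <;> simp [Network.part, Preflow.setD]
    · rw [← h3 p hp]
      simp only [add_assoc (3 * I.cells)]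
      rw [Function.update_of_ne (by omega)]
    · have h2 : 4 ≤ I.nodes ^ 2 := Nat.pow_le_pow_left hN 2
      have h3 : I.nodes ^ 3 = I.nodes * I.nodes ^ 2 := by ring
      have h4 : 4 * I.nodes ≤ I.nodes ^ 3 := by nlinarith
      have h5 : 2 * I.nodes ^ 2 ≤ I.nodes ^ 3 := by nlinarith
      nlinarith

end

/-- The choice of classes that is encoded by the binary digits of `x`. -/
def Input.digits (I : Input) (x t i : ℕ) : Bool := x.testBit (t * I.classes + i)

/-- The preflow `F` is a maximum flow in the network for the choice `x`. -/
structure Input.Solved (I : Input) (q x : ℕ) (F : Preflow I.Node) : Prop where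
  good : F.Good (I.network q (I.digits x)).R src sink
  excess : ∀ u, u ≠ src → u ≠ sink → F.e u = 0

/-! ### One round per guess, and the whole program -/

section

variable {I : Input} {q : ℕ} {s : State}

/-- The finished matrix is the starting preflow of `MainInv.start`. The arcs from the source are
saturated, so the excess of a node is its residual capacity back to the source. -/
theorem part_true (W : Network) {τ k : ℕ} :
    (W.part fun _ _ => True) = (⟨W.R, fun x => W.R x src, fun x => if x = src then
      Fintype.card (Node τ k) else 0⟩ : Preflow (Node τ k)) := by
  refine Preflow.ext (funext₂ fun x y => ?_) (funext fun x => ?_) (funext fun x => ?_)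
  · rcases x with (⟨t, i⟩ | ⟨t, i⟩) | x <;> simp [Network.part, Network.R]
  · rcases x with (⟨t, i⟩ | ⟨t, i⟩) | x <;> simp [Network.part, Network.R]
  · rw [Node.card_eq]
    rfl

/-- Record the numbers of tokens if the flow is at least as good as the best one so far, whose
value is in register `14`. -/
def recordBody : Prog :=
  .seq (.add 17 5 16) <| .seq (.load 18 17) <| .seq (getEntry 19 17 16) <|
  .seq (.add 18 18 19) <| .store 16 18

/-- Record the flow if it is at least as good as the best one so far. -/
def recordCode : Prog :=
  .seq (getEntry 16 6 7) <| .seq (.sub 17 14 16) <|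
  .ifNonzero 17 skip (.seq (.add 14 16 0) <| .seq (.add 16 5 0) <| loop 16 recordBody)

/-- The residual capacity from an exit back to its entrance is the number of tokens above the lower
bound, hence the sum. Ties are recorded as well: the best value starts at `0`, so the first round
always writes a table. -/
theorem wp_recordCode (g : Glob I q s) {F : Preflow I.Node} (h : Rep I s.mem F) (T : ℕ) :
    WP I recordCode s T (fun s' T' =>
      ((F.e sink < s.reg 14 ∧ s'.reg 14 = s.reg 14 ∧ s'.mem = s.mem) ∨
        (s.reg 14 ≤ F.e sink ∧ s'.reg 14 = F.e sink ∧
          ∀ (t : Fin I.lifetime) (i : Fin I.classes), s'.mem (t * I.classes + i) =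
            s.mem (I.cells + (t * I.classes + i)) + F.R (exi t i) (ent t i))) ∧
      T' ≤ T + 8 * I.nodes ^ 2) := by
  have hN : I.nodes = 2 * I.cells + 2 := rfl
  have he := h.e sink
  rw [idx_sink] at he
  simp [recordCode, wp_getEntry, State.loc, g.r0, g.r1, g.r6, g.r7, g.r9, he]
  by_cases hb : s.reg 14 ≤ F.e sink
  swap
  · rw [wp_if_pos (by simp; omega)]
    simp [skip]
    refine ⟨by omega, ?_⟩
    nlinarith
  rw [wp_if_neg (by simp; omega)]
  simp only [wp_seq, wp_add]
  refine wp_loop I.cells (6 * I.cells + 8) (fun j s' =>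
    (∀ r < 14, s'.reg r = s.reg r) ∧ s'.reg 14 = F.e sink ∧
    (∀ a < I.cells, j ≤ a → s'.mem a = s.mem (I.cells + a) +
      s.mem (3 * I.cells + a + (I.cells + a) * I.nodes)) ∧
    (∀ p, I.cells ≤ p → s'.mem p = s.mem p)) ?_ ?_ ?_ ?_ ?_
  · simp [g.r0, g.r5]
  · refine ⟨fun r hr => ?_, by simp [g.r0], fun a h1 h2 => by omega, fun p _ => rfl⟩
    simp; split_ifs <;> omega
  · rintro j s' ⟨h1, -⟩
    rw [h1 1 (by norm_num), g.r1]
  · rintro j hj s' hs' ⟨h1, h2, h3, h4⟩ T'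
    have e0 := (h1 0 (by norm_num)).trans g.r0
    have e1 := (h1 1 (by norm_num)).trans g.r1
    have e5 := (h1 5 (by norm_num)).trans g.r5
    have e6 := (h1 6 (by norm_num)).trans g.r6
    have e9 := (h1 9 (by norm_num)).trans g.r9
    -- The loop writes only below address `I.cells`, so the lower bounds and the matrix are read
    -- unchanged.
    have m1 := h4 (I.cells + j) (by omega)
    have m2 := h4 (3 * I.cells + j + (I.cells + j) * I.nodes) (by nlinarith)
    simp [recordBody, wp_getEntry, State.loc, e0, e1, e5, e6, e9, m1, m2]
    refine ⟨⟨fun r hr => ?_, h2, fun a ha hja => ?_, fun p hp => ?_⟩, by omega⟩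
    · rw [← h1 r hr]; split_ifs <;> omega
    · by_cases haj : a = j
      · subst haj; rw [Function.update_self]
      · rw [Function.update_of_ne haj, h3 a ha (by omega)]
    · rw [Function.update_of_ne (by omega), h4 p hp]
  · rintro s' T' - ⟨h1, h2, h3, h4⟩ hT
    refine ⟨Or.inr ⟨hb, h2, fun t i => ?_⟩, ?_⟩
    · rw [h3 _ (cell_lt t.2 i.2) (Nat.zero_le _), ← h.R]
      rfl
    · nlinarith

/-- Treat the choice of classes whose number is in register `13`. -/
def roundCode : Prog :=
  .seq bitsCode <| .seq clearCode <| .seq cellsCode <| .seq flowCode recordCode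

theorem wp_roundCode (g : Glob I q s) (hk : 0 < I.classes) {x : ℕ} (h13 : s.reg 13 = x)
    (hx : x < 2 ^ I.cells) (T : ℕ) :
    WP I roundCode s T (fun s' T' =>
      ∃ F, I.Solved q x F ∧
      ((F.e sink < s.reg 14 ∧ s'.reg 14 = s.reg 14 ∧ ∀ p < I.cells, s'.mem p = s.mem p) ∨
        (s.reg 14 ≤ F.e sink ∧ s'.reg 14 = F.e sink ∧
          ∀ (t : Fin I.lifetime) (i : Fin I.classes), s'.mem (t * I.classes + i) =
            I.lower q (I.digits x) t i + F.R (exi t i) (ent t i))) ∧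
      T' ≤ T + 450 * I.nodes ^ 5) := by
  have hN : 2 ≤ I.nodes := by unfold Input.nodes; omega
  have hcl : I.cells = I.lifetime * I.classes := rfl
  simp only [roundCode, wp_seq]
  refine (WP.frame 15 (by decide) (wp_bitsCode g h13 hx T)).mono ?_
  rintro s₁ T₁ ⟨a1, a2, a3, a4⟩
  refine (WP.frame 15 (by decide) (wp_clearCode (g.of_frame fun r hr => a1 r (by omega))
    (I.digits x) T₁)).mono ?_
  rintro s₂ T₂ ⟨b1, b2, b3, b4⟩
  have b1' : ∀ r < 15, s₂.reg r = s.reg r := fun r hr => (b1 r hr).trans (a1 r hr)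
  refine (WP.frame 15 (by decide) (wp_cellsCode (q := q) (β := I.digits x)
    (g.of_frame fun r hr => b1' r (by omega)) hk ?_ b2 T₂)).mono ?_
  · intro t ht j hj
    have := cell_lt ht hj
    rw [b3 _ (by omega), a2 _ (by omega)]
    rfl
  rintro s₃ T₃ ⟨c1, c2, c3⟩
  have c1' : ∀ r < 15, s₃.reg r = s.reg r := fun r hr => (c1 r hr).trans (b1' r hr)
  have hrep := c2.rep
  rw [part_true] at hrep
  refine (WP.frame 15 (by decide) (wp_flowCode (g.of_frame fun r hr => c1' r (by omega)) hrep
    (Preflow.MainInv.start (fun y => rfl) sink_ne_src) T₃)).mono ?_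
  rintro s₄ T₄ ⟨d1, ⟨F, d2, d3, d4⟩, d5, d6⟩
  have d1' : ∀ r < 15, s₄.reg r = s.reg r := fun r hr => (d1 r hr).trans (c1' r hr)
  refine (wp_recordCode (g.of_frame fun r hr => d1' r (by omega)) d4 T₄).mono ?_
  rintro s₅ T₅ ⟨e1, e2⟩
  rw [d1' 14 (by norm_num)] at e1
  refine ⟨F, ⟨d2, d3⟩, ?_, ?_⟩
  · rcases e1 with ⟨e1, e3, e4⟩ | ⟨e1, e3, e4⟩
    · refine Or.inl ⟨e1, e3, fun p hp => ?_⟩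
      rw [e4, d5 p (by omega), c2.low p (by omega) (Or.inl hp), b3 p (by omega), a3 p (by omega)]
    · refine Or.inr ⟨e1, e3, fun t i => ?_⟩
      have := cell_lt t.2 i.2
      rw [e4, d5 _ (by omega), c2.lower t t.2 i i.2 trivial]
  · have h2 : 4 ≤ I.nodes ^ 2 := Nat.pow_le_pow_left hN 2
    have h3 : 8 ≤ I.nodes ^ 3 := Nat.pow_le_pow_left hN 3
    have e5 : I.nodes ^ 5 = I.nodes ^ 2 * I.nodes ^ 3 := by ring
    nlinarith

/-- Set up the registers; the kind of problem is `q`. -/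
def setupCode (q : ℕ) : Prog :=
  .seq (.const 1 1) <| .seq (.readLifetime 2) <| .seq (.readClasses 3) <|
  .seq (.readOrder 4) <| .seq (.const 10 q) <| .seq (.add 15 2 0) <| .seq (addLoop 15 5 3) <|
  .seq (.add 7 5 5) <| .seq (.add 8 7 1) <| .seq (.add 6 8 1) <| .seq (.add 9 7 5) <|
  .seq (.add 12 6 1) <| .seq (.add 15 6 0) <| .seq (addLoop 15 11 6) <|
  .seq (.add 11 11 11) <| .seq (.add 11 11 11) <| .seq (.const 13 1) <|
  .seq (.add 15 5 0) <| doubleLoop 15 13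

theorem wp_setupCode (T : ℕ) : WP I (setupCode q) State.init T (fun s' T' =>
    Glob I q s' ∧ s'.reg 14 = 0 ∧ s'.reg 13 = 2 ^ I.cells ∧
    T' ≤ T + (3 * I.lifetime + 3 * I.nodes + 3 * I.cells + 20)) := by
  simp only [setupCode, wp_seq, wp_const, wp_readLifetime, wp_readClasses, wp_readOrder, wp_add]
  rw [wp_addLoop (by simp) (by decide) (by decide) (by decide) (by decide) (by decide)]
  rw [wp_addLoop (by simp) (by decide) (by decide) (by decide) (by decide) (by decide)]
  rw [wp_doubleLoop (by simp) (by decide) (by decide) (by decide)]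
  have hi : ∀ r, State.init.reg r = 0 := fun _ => rfl
  refine ⟨?_, by simp [hi], by simp [hi, Input.cells], ?_⟩
  · constructor <;> simp [hi, Input.nodes, Input.cells] <;> ring
  · simp [hi, Input.nodes, Input.cells]
    omega

/-- Compute the size of the solution. -/
def totalCode : Prog :=
  .seq (.const 17 0) <| .seq (.add 15 3 0) <|
  .seq (loop 15 (.seq (.load 16 15) (.add 17 17 16))) (.add 0 17 0)

/-- The row of the first time-step starts at address `0` and gives the size. Register `0` ceases to
be zero only with the very last instruction. -/
theorem wp_totalCode (g : Glob I q s) (T : ℕ) : WP I totalCode s T (fun s' T' =>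
    s'.mem = s.mem ∧ s'.reg 0 = ∑ i ∈ Finset.range I.classes, s.mem i ∧
    T' ≤ T + (4 * I.classes + 4)) := by
  simp only [totalCode, wp_seq, wp_const, wp_add]
  refine wp_loop I.classes 2 (fun j s' => (∀ r < 15, s'.reg r = s.reg r) ∧ s'.mem = s.mem ∧
    s'.reg 17 = ∑ i ∈ Finset.Ico j I.classes, s.mem i) ?_ ?_ ?_ ?_ ?_
  · simp [g.r0, g.r3]
  · refine ⟨fun r hr => ?_, rfl, by simp⟩
    simp; split_ifs <;> omega
  · rintro j s' ⟨h1, -⟩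
    rw [h1 1 (by norm_num), g.r1]
  · rintro j hj s' hs' ⟨h1, h2, h3⟩ T'
    simp [h2, h3]
    refine ⟨fun r hr => ?_, ?_⟩
    · rw [← h1 r hr]; split_ifs <;> omega
    · rw [Finset.sum_eq_sum_Ico_succ_bot hj, add_comm]
  · rintro s' T' - ⟨h1, h2, h3⟩ hT
    have e0 := (h1 0 (by norm_num)).trans g.r0
    simp [h2, h3, e0]
    omega

/-- The program; the kind of problem is `q`. -/
def mainProg (q : ℕ) : Prog := .seq (setupCode q) <| .seq (loop 13 roundCode) totalCode

/-- The program returns the best of the maximum flows for all choices. -/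
theorem exec_mainProg (I : Input) (q : ℕ) (hk : 0 < I.classes) (hτ : 0 < I.lifetime) :
    ∃ m s, Exec I (mainProg q) State.init m s ∧
      m ≤ 500 * (2 ^ I.cells * I.nodes ^ 5) ∧
      s.reg 0 = ∑ i ∈ Finset.range I.classes, s.mem i ∧
      ∃ x F, I.Solved q x F ∧
        (∀ (t : Fin I.lifetime) (i : Fin I.classes), s.mem (t * I.classes + i) =
          I.lower q (I.digits x) t i + F.R (exi t i) (ent t i)) ∧
        ∀ x' < 2 ^ I.cells, ∃ F', I.Solved q x' F' ∧ F'.e sink ≤ F.e sink := by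
  have hN : I.nodes = 2 * I.cells + 2 := rfl
  suffices H : WP I (mainProg q) State.init 0 (fun s m =>
      m ≤ 500 * (2 ^ I.cells * I.nodes ^ 5) ∧
      s.reg 0 = ∑ i ∈ Finset.range I.classes, s.mem i ∧
      ∃ x F, I.Solved q x F ∧
        (∀ (t : Fin I.lifetime) (i : Fin I.classes), s.mem (t * I.classes + i) =
          I.lower q (I.digits x) t i + F.R (exi t i) (ent t i)) ∧
        ∀ x' < 2 ^ I.cells, ∃ F', I.Solved q x' F' ∧ F'.e sink ≤ F.e sink) by
    obtain ⟨m, s, h, h'⟩ := H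
    rw [zero_add] at h'
    exact ⟨m, s, h, h'⟩
  simp only [mainProg, wp_seq]
  refine (wp_setupCode 0).mono ?_
  rintro s T ⟨g, h14, h13, hT⟩
  refine wp_loop (2 ^ I.cells) (450 * I.nodes ^ 5)
    (fun j s' => (∀ r < 13, s'.reg r = s.reg r) ∧
      (∀ x', j ≤ x' → x' < 2 ^ I.cells → ∃ F', I.Solved q x' F' ∧ F'.e sink ≤ s'.reg 14) ∧
      ((j = 2 ^ I.cells ∧ s'.reg 14 = 0) ∨ ∃ x F, I.Solved q x F ∧ s'.reg 14 = F.e sink ∧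
        (∀ (t : Fin I.lifetime) (i : Fin I.classes), s'.mem (t * I.classes + i) =
          I.lower q (I.digits x) t i + F.R (exi t i) (ent t i)))) h13 ?_ ?_ ?_ ?_
  · exact ⟨fun _ _ => rfl, fun x' h1 h2 => by omega, Or.inl ⟨rfl, h14⟩⟩
  · rintro j s' ⟨h1, -⟩
    rw [h1 1 (by norm_num), g.r1]
  · rintro j hj s' hs' ⟨h1, h2, h3⟩ T'
    refine (WP.frame 14 (by decide) (wp_roundCode (q := q) (s := s'.set 13 j) (x := j)
      ((g.of_frame fun r hr => h1 r hr).set (by norm_num)) hk (by simp) hj T')).mono ?_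
    rintro s₁ T₁ ⟨k1, F, k2, k3, k4⟩
    have e14 : (s'.set 13 j).reg 14 = s'.reg 14 := by simp
    rw [e14] at k3
    refine ⟨by simp [k1], ⟨fun r hr => ?_, fun x' hx hx' => ?_, ?_⟩, k4⟩
    · rw [k1 r (by omega), State.set_reg, if_neg hr.ne, h1 r hr]
    · rcases Nat.eq_or_lt_of_le hx with rfl | hx
      · exact ⟨F, k2, by omega⟩
      · obtain ⟨F', l1, l2⟩ := h2 x' hx hx'
        exact ⟨F', l1, by omega⟩
    · right
      rcases k3 with ⟨k3, k5, k6⟩ | ⟨k3, k5, k6⟩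
      -- If nothing has been recorded, the best value is `0`, and no flow can be below it.
      · rcases h3 with ⟨-, h3⟩ | ⟨x, F', l1, l2, l3⟩
        · omega
        · refine ⟨x, F', l1, by omega, fun t i => ?_⟩
          rw [k6 _ (cell_lt t.2 i.2), State.set_mem, l3]
      · exact ⟨j, F, k2, k5, k6⟩
  · rintro s' T' - ⟨h1, h2, h3⟩ hT'
    refine (wp_totalCode (g.of_frame h1) T').mono ?_
    rintro s'' T'' ⟨k1, k2, k3⟩
    refine ⟨?_, by rw [k2, k1], ?_⟩
    · have hc1 : I.lifetime ≤ I.cells := Nat.le_mul_of_pos_right _ hk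
      have hc2 : I.classes ≤ I.cells := Nat.le_mul_of_pos_left _ hτ
      have h1 : 1 ≤ 2 ^ I.cells := Nat.one_le_two_pow
      have h2 : 4 ≤ I.nodes := by omega
      have h5 : I.nodes ≤ I.nodes ^ 5 := Nat.le_self_pow (by norm_num) _
      have h6 : I.nodes ^ 5 ≤ 2 ^ I.cells * I.nodes ^ 5 := Nat.le_mul_of_pos_left _ h1
      have h7 : 2 ^ I.cells ≤ 2 ^ I.cells * I.nodes ^ 5 :=
        Nat.le_mul_of_pos_right _ (by positivity)
      have h8 : 2 ^ I.cells * (450 * I.nodes ^ 5 + 2) =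
        450 * (2 ^ I.cells * I.nodes ^ 5) + 2 * 2 ^ I.cells := by ring
      omega
    · rcases h3 with ⟨h3, -⟩ | ⟨x, F, h3, h4, h5⟩
      · exact absurd h3 (by positivity)
      · refine ⟨x, F, h3, fun t i => by rw [k1, h5], fun x' hx' => ?_⟩
        obtain ⟨F', h6, h7⟩ := h2 x' (Nat.zero_le _) hx'
        exact ⟨F', h6, by omega⟩

end

open Preflow

/-! ### Flows and plans -/

/-- Numbers of tokens `c` together with numbers of moves `f` between the classes that respect the
bounds and the allowed moves of the network. -/
structure Network.Plan (W : Network) {τ k : ℕ} (c : Fin τ → Fin k → ℕ)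
    (f : Fin τ → Fin τ → Fin k → Fin k → ℕ) : Prop where
  lo_le : ∀ (t : Fin τ) (i : Fin k), W.lo t i ≤ c t i
  le_hi : ∀ (t : Fin τ) (i : Fin k), c t i ≤ W.hi t i
  out : ∀ t t' : Fin τ, (t' : ℕ) = t + 1 → ∀ i, ∑ j, f t t' i j = c t i
  into : ∀ t t' : Fin τ, (t' : ℕ) = t + 1 → ∀ j, ∑ i, f t t' i j = c t' j
  ok : ∀ t t' : Fin τ, (t' : ℕ) = t + 1 → ∀ i j, 0 < f t t' i j → W.ok t i j = true

/-- The consistency conditions on the data of a network. -/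
structure Network.Proper (W : Network) (τ k : ℕ) : Prop where
  lo_le : ∀ (t : Fin τ) (i : Fin k), W.lo t i ≤ W.start i
  le_hi : ∀ (t : Fin τ) (i : Fin k), W.start i ≤ W.hi t i
  hi_le : ∀ (t : Fin τ) (i : Fin k), W.hi t i ≤ W.size i
  start : ∀ i : Fin k, W.start i = 0 ∨ W.start i = W.size i
  ok_self : ∀ (t : Fin τ) (i : Fin k), W.ok t i i = true

variable {τ k : ℕ}

theorem sum_cells_single (h : Fin τ → Fin k → ℕ) (t : Fin τ) (i : Fin k)
    (hz : ∀ t' j, ¬ (t' = t ∧ j = i) → h t' j = 0) : ∑ t', ∑ j, h t' j = h t i := by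
  rw [Finset.sum_eq_single t _ (by simp), Finset.sum_eq_single i _ (by simp)]
  · intro j _ hj; exact hz _ _ fun hh => hj hh.2
  · intro t' _ ht; exact Finset.sum_eq_zero fun j _ => hz _ _ fun hh => ht hh.1

theorem sum_cells_row (h : Fin τ → Fin k → ℕ) (t s : Fin τ) (hst : s ≠ t) (i : Fin k)
    (hz : ∀ t' j, ¬ (t' = t ∧ j = i) → t' ≠ s → h t' j = 0) :
    ∑ t', ∑ j, h t' j = h t i + ∑ j, h s j := by
  rw [← Finset.add_sum_erase _ _ (Finset.mem_univ s), add_comm]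
  congr 1
  rw [Finset.sum_eq_single t, Finset.sum_eq_single i _ (by simp)]
  · intro j _ hj; exact hz _ _ (fun hh => hj hh.2) hst.symm
  · intro t' ht hne
    exact Finset.sum_eq_zero fun j _ => hz _ _ (fun hh => hne hh.1) (Finset.ne_of_mem_erase ht)
  · intro ht; simp [hst.symm] at ht

theorem sum_node (g : Node τ k → ℕ) : ∑ y, g y =
    ((∑ t, ∑ i, g (ent t i)) + ∑ t, ∑ i, g (exi t i)) + (g sink + g src) := by
  simp [Fintype.sum_sum_type, Fintype.sum_prod_type, Fin.sum_univ_two]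

section rows

variable (g : Node τ k → ℕ)

theorem sum_ent_first (t : Fin τ) (i : Fin k) (h1 : ∀ t' j, g (ent t' j) = 0)
    (h2 : ∀ t' j, ¬ (t' = t ∧ j = i) → g (exi t' j) = 0) :
    ∑ y, g y = g (exi t i) + (g sink + g src) := by
  rw [sum_node, sum_cells_single (fun t' j => g (exi t' j)) t i h2]; simp [h1]

theorem sum_ent_later (t s : Fin τ) (hst : s ≠ t) (i : Fin k) (h1 : ∀ t' j, g (ent t' j) = 0)
    (h2 : ∀ t' j, ¬ (t' = t ∧ j = i) → t' ≠ s → g (exi t' j) = 0) (h3 : g sink = 0)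
    (h4 : g src = 0) : ∑ y, g y = g (exi t i) + ∑ j, g (exi s j) := by
  rw [sum_node, sum_cells_row (fun t' j => g (exi t' j)) t s hst i h2]; simp [h1, h3, h4]

theorem sum_exi_last (t : Fin τ) (i : Fin k) (h1 : ∀ t' j, g (exi t' j) = 0)
    (h2 : ∀ t' j, ¬ (t' = t ∧ j = i) → g (ent t' j) = 0) :
    ∑ y, g y = g (ent t i) + (g sink + g src) := by
  rw [sum_node, sum_cells_single (fun t' j => g (ent t' j)) t i h2]; simp [h1]

theorem sum_exi_earlier (t s : Fin τ) (hst : s ≠ t) (i : Fin k) (h1 : ∀ t' j, g (exi t' j) = 0)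
    (h2 : ∀ t' j, ¬ (t' = t ∧ j = i) → t' ≠ s → g (ent t' j) = 0) (h3 : g sink = 0)
    (h4 : g src = 0) : ∑ y, g y = g (ent t i) + ∑ j, g (ent s j) := by
  rw [sum_node, sum_cells_row (fun t' j => g (ent t' j)) t s hst i h2]; simp [h1, h3, h4]

theorem sum_sink (t s : Fin τ) (h1 : ∀ t' j, t' ≠ t → g (ent t' j) = 0)
    (h2 : ∀ t' j, t' ≠ s → g (exi t' j) = 0) (h3 : g sink = 0) (h4 : g src = 0) :
    ∑ y, g y = ∑ i, g (ent t i) + ∑ i, g (exi s i) := by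
  rw [sum_node, h3, h4, Finset.sum_eq_single t _ (by simp), Finset.sum_eq_single s _ (by simp)]
  · rfl
  · intro t' _ ht; exact Finset.sum_eq_zero fun j _ => h2 _ _ ht
  · intro t' _ ht; exact Finset.sum_eq_zero fun j _ => h1 _ _ ht

end rows

/-! ### The residual network of a plan -/

variable {W : Network}

/-- The last term is the arc to the sink; in `base_ent_later` the arc back to the previous exit
takes its place. Under `Proper` both totals are `hi`. -/
theorem base_ent_first (t : Fin τ) (ht : (t : ℕ) = 0) (i : Fin k) :
    base W.R src (ent t i) = W.hi t i - W.start i + W.start i := by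
  rw [base, sum_ent_first _ t i]
  · simp [Network.R, ht]
  · intro t' j; simp [Network.R]
  · intro t' j h
    have : ¬ ((t : ℕ) = t' + 1 ∧ j = i) := by omega
    simp only [Network.R, if_neg h, if_neg this]; simp

theorem base_ent_later (t s : Fin τ) (ht : (t : ℕ) = s + 1) (i : Fin k) :
    base W.R src (ent t i) = W.hi t i - W.start i + W.start i := by
  have hst : s ≠ t := by rintro rfl; omega
  rw [base, sum_ent_later _ t s hst i]
  · simp [Network.R, ht, hst]
  · intro t' j; simp [Network.R]
  · intro t' j h h'
    have : ¬ ((t : ℕ) = t' + 1 ∧ j = i) := fun hh => h' (Fin.ext (by omega))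
    simp only [Network.R, if_neg h, if_neg this]; simp
  · simp [Network.R, ht]
  · simp

theorem base_exi_last (t : Fin τ) (ht : (t : ℕ) + 1 = τ) (i : Fin k) :
    base W.R src (exi t i) = W.start i - W.lo t i + (W.size i - W.start i) := by
  have ht' : (t : ℕ) ≠ τ := by omega
  rw [base, sum_exi_last _ t i]
  · simp [Network.R, ht, ht']
  · intro t' j; simp [Network.R]
  · intro t' j h
    have : ¬ ((t' : ℕ) = t + 1 ∧ W.ok t i j = true) := by omega
    simp only [Network.R, if_neg h, if_neg this]; simp

theorem base_exi_earlier (t s : Fin τ) (ht : (s : ℕ) = t + 1) (i : Fin k) :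
    base W.R src (exi t i) =
      W.start i - W.lo t i + ∑ j : Fin k, if W.ok t i j = true then W.cap else 0 := by
  have hst : s ≠ t := by rintro rfl; omega
  rw [base, sum_exi_earlier _ t s hst i]
  · simp [Network.R, ht, hst]
  · intro t' j; simp [Network.R]
  · intro t' j h h'
    have : ¬ ((t' : ℕ) = t + 1 ∧ W.ok t i j = true) := fun hh => h' (Fin.ext (by omega))
    simp only [Network.R, if_neg h, if_neg this]; simp
  · have : (t : ℕ) + 1 ≠ τ := by omega
    simp [Network.R, this]
  · simp

theorem base_sink : base W.R src (sink : Node τ k) = 0 := by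
  rw [base]; refine Finset.sum_eq_zero fun y _ => ?_
  rcases y with (⟨t, i⟩ | ⟨t, i⟩) | j <;> simp [Network.R]

/-- The residual capacities of a plan. -/
def Network.residual (W : Network) (c : Fin τ → Fin k → ℕ)
    (f : Fin τ → Fin τ → Fin k → Fin k → ℕ) : Node τ k → Node τ k → ℕ
  | .inl (.inl (t, i)), .inl (.inr (t', j)) =>
      (if t' = t ∧ j = i then W.hi t i - c t i else 0) +
      (if (t : ℕ) = t' + 1 then f t' t j i else 0)
  | .inl (.inr (t, i)), .inl (.inl (t', j)) =>
      (if t' = t ∧ j = i then c t i - W.lo t i else 0) +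
      (if (t' : ℕ) = t + 1 then
        ((if W.ok t i j = true then W.cap else 0) + if j = i then W.start i else 0) - f t t' i j
      else 0)
  | .inl (.inl (t, i)), .inr z =>
      if (t : ℕ) = 0 then
        (if z = 1 then c t i - W.start i else W.start i - (W.start i - c t i)) else 0
  | .inr z, .inl (.inl (t, i)) =>
      if (t : ℕ) = 0 then
        (if z = 1 then W.size i - W.start i - (c t i - W.start i) else W.start i - c t i) else 0
  | .inl (.inr (t, i)), .inr z =>
      if (t : ℕ) + 1 = τ then
        (if z = 1 then W.start i - c t i else W.size i - W.start i - (c t i - W.start i)) else 0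
  | .inr z, .inl (.inr (t, i)) =>
      if (t : ℕ) + 1 = τ then
        (if z = 1 then W.start i - (W.start i - c t i) else c t i - W.start i) else 0
  | _, _ => 0

variable {c : Fin τ → Fin k → ℕ} {f : Fin τ → Fin τ → Fin k → Fin k → ℕ}

theorem Network.Plan.le_cap (h : W.Plan c f) (hf : ∀ t t' i j, f t t' i j ≤ W.cap)
    {t t' : Fin τ} (ht : (t' : ℕ) = t + 1) (i j : Fin k) :
    f t t' i j ≤ if W.ok t i j = true then W.cap else 0 := by
  split_ifs with ho
  · exact hf _ _ _ _
  · by_contra hcon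
    exact ho (h.ok t t' ht i j (by omega))

theorem Network.Plan.pair_cells (h : W.Plan c f) (hW : W.Proper τ k)
    (hf : ∀ t t' i j, f t t' i j ≤ W.cap) (t t' : Fin τ) (i j : Fin k) :
    W.residual c f (ent t i) (exi t' j) + W.residual c f (exi t' j) (ent t i) =
      W.R (ent t i) (exi t' j) + W.R (exi t' j) (ent t i) := by
  simp only [Network.residual, Network.R]
  by_cases h1 : t' = t ∧ j = i
  · obtain ⟨rfl, rfl⟩ := h1
    have := h.lo_le t' j; have := h.le_hi t' j; have := hW.lo_le t' j; have := hW.le_hi t' j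
    simp; omega
  · have h1' : ¬ (t = t' ∧ i = j) := fun hh => h1 ⟨hh.1.symm, hh.2.symm⟩
    by_cases h2 : (t : ℕ) = t' + 1
    · have := h.le_cap hf h2 j i
      have e : (if i = j then W.start j else 0) = if j = i then W.start i else 0 := by
        by_cases hij : i = j
        · simp [hij]
        · rw [if_neg hij, if_neg (Ne.symm hij)]
      rw [e]
      simp only [if_neg h1, if_neg h1', h2, if_true, true_and]
      omega
    · simp [h1, h1', h2]

theorem Network.Plan.pair (h : W.Plan c f) (hW : W.Proper τ k)
    (hf : ∀ t t' i j, f t t' i j ≤ W.cap) (x y : Node τ k) :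
    W.residual c f x y + W.residual c f y x = W.R x y + W.R y x := by
  have key : ∀ (t : Fin τ) (i : Fin k), W.start i ≤ W.size i ∧ c t i ≤ W.size i := fun t i =>
    ⟨(hW.le_hi t i).trans (hW.hi_le t i), (h.le_hi t i).trans (hW.hi_le t i)⟩
  rcases x with (⟨t, i⟩ | ⟨t, i⟩) | z <;> rcases y with (⟨t', j⟩ | ⟨t', j⟩) | z'
  · rfl
  · exact h.pair_cells hW hf t t' i j
  · have := key t i
    simp only [Network.residual, Network.R]
    split_ifs <;> omega
  · rw [add_comm, add_comm (W.R _ _)]; exact h.pair_cells hW hf t' t j i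
  · rfl
  · have := key t i
    simp only [Network.residual, Network.R]
    split_ifs <;> omega
  · have := key t' j
    simp only [Network.residual, Network.R]
    split_ifs <;> omega
  · have := key t' j
    simp only [Network.residual, Network.R]
    split_ifs <;> omega
  · rfl

theorem Fin.exists_pred {t : Fin τ} (ht : (t : ℕ) ≠ 0) : ∃ s : Fin τ, (t : ℕ) = s + 1 :=
  ⟨⟨t - 1, by omega⟩, by simp; omega⟩

theorem Fin.exists_next {t : Fin τ} (ht : (t : ℕ) + 1 ≠ τ) : ∃ s : Fin τ, (s : ℕ) = t + 1 :=
  ⟨⟨t + 1, by omega⟩, rfl⟩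

/-- At an entrance this is `into`, at an exit it is `out`. At the first and the last time-step the
arcs to the sink and the source play the part of the missing neighbours. -/
theorem Network.Plan.conserved (h : W.Plan c f) (hW : W.Proper τ k)
    (hf : ∀ t t' i j, f t t' i j ≤ W.cap) (u : Node τ k) (h1 : u ≠ src) (h2 : u ≠ sink) :
    ∑ y, W.residual c f u y = base W.R src u := by
  rcases u with (⟨t, i⟩ | ⟨t, i⟩) | z
  · have hb := And.intro (And.intro (h.lo_le t i) (h.le_hi t i))
      (And.intro (hW.lo_le t i) (And.intro (hW.le_hi t i) (hW.hi_le t i)))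
    by_cases ht : (t : ℕ) = 0
    · rw [base_ent_first t ht, sum_ent_first _ t i]
      · simp [Network.residual, ht]; simp only [ht] at hb; omega
      · intro t' j; rfl
      · intro t' j hn
        have : ¬ ((t : ℕ) = t' + 1) := by omega
        simp only [Network.residual, if_neg hn, if_neg this]
    · obtain ⟨s, hs⟩ := Fin.exists_pred ht
      have hst : s ≠ t := by rintro rfl; omega
      rw [base_ent_later t s hs, sum_ent_later _ t s hst i]
      · have := h.into s t hs i
        simp [Network.residual, hs, hst, this]; simp only [hs] at hb; omega
      · intro t' j; rfl
      · intro t' j hn hn'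
        have : ¬ ((t : ℕ) = t' + 1) := fun hh => hn' (Fin.ext (by omega))
        simp only [Network.residual, if_neg hn, if_neg this]
      · simp [Network.residual, ht]
      · simp [Network.residual, ht]
  · have hb := And.intro (And.intro (h.lo_le t i) (h.le_hi t i))
      (And.intro (hW.lo_le t i) (And.intro (hW.le_hi t i) (hW.hi_le t i)))
    by_cases ht : (t : ℕ) + 1 = τ
    · have ht' : (t : ℕ) ≠ τ := by omega
      rw [base_exi_last t ht, sum_exi_last _ t i]
      · simp [Network.residual, ht, ht']; omega
      · intro t' j; rfl
      · intro t' j hn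
        have : ¬ ((t' : ℕ) = t + 1) := by omega
        simp only [Network.residual, if_neg hn, if_neg this]
    · obtain ⟨s, hs⟩ := Fin.exists_next ht
      have hst : s ≠ t := by rintro rfl; omega
      rw [base_exi_earlier t s hs, sum_exi_earlier _ t s hst i]
      · have h3 := h.out t s hs i
        have h4 : ∑ j, W.residual c f (exi t i) (ent s j) + ∑ j, f t s i j =
            (∑ j : Fin k, if W.ok t i j = true then W.cap else 0) + W.start i := by
          rw [← Finset.sum_add_distrib]
          have : ∑ j : Fin k, (if j = i then W.start i else 0) = W.start i := by simp
          rw [← this, ← Finset.sum_add_distrib]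
          refine Finset.sum_congr rfl fun j _ => ?_
          have := h.le_cap hf hs i j
          simp only [Network.residual, hs, hst, false_and, if_false, if_true, zero_add]
          omega
        have h5 : W.residual c f (exi t i) (ent t i) = c t i - W.lo t i := by
          simp [Network.residual]
        change W.residual c f (exi t i) (ent t i) + ∑ j, W.residual c f (exi t i) (ent s j) = _
        omega
      · intro t' j; rfl
      · intro t' j hn hn'
        have : ¬ ((t' : ℕ) = t + 1) := fun hh => hn' (Fin.ext (by omega))
        simp only [Network.residual, if_neg hn, if_neg this]
      · simp [Network.residual, ht]
      · simp [Network.residual, ht]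
  · fin_cases z
    · exact absurd rfl h2
    · exact absurd rfl h1

/-- The number of units that reach the sink in the network of a plan. -/
def Network.score (W : Network) (c : Fin τ → Fin k → ℕ) (a b : Fin τ) : ℕ :=
  ∑ i : Fin k, (W.start i - c a i) + ∑ i : Fin k, (c b i - W.start i)

/-- A plan is a competitor in `Good.optimal`, and the residual capacity out of the sink is its
score. -/
theorem Network.Plan.score_le (h : W.Plan c f) (hW : W.Proper τ k)
    (hf : ∀ t t' i j, f t t' i j ≤ W.cap) {F : Preflow (Node τ k)} (hF : Good W.R src sink F)
    (he : ∀ u, u ≠ src → u ≠ sink → F.e u = 0) {a b : Fin τ} (ha : (a : ℕ) = 0)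
    (hb : (b : ℕ) + 1 = τ) : W.score c a b ≤ F.e sink := by
  have h1 := hF.optimal he sink_ne_src (h.pair hW hf) (h.conserved hW hf)
  rw [base_sink, zero_add] at h1
  refine le_trans (le_of_eq ?_) h1
  rw [sum_sink _ a b]
  · simp [Network.score, Network.residual, ha, hb]
  · intro t j ht
    have : ¬ (t : ℕ) = 0 := fun h => ht (Fin.ext (by omega))
    simp [Network.residual, this]
  · intro t j ht
    have : ¬ (t : ℕ) + 1 = τ := fun h => ht (Fin.ext (by omega))
    simp [Network.residual, this]
  · rfl
  · rfl

/-! ### The plan of a flow -/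

/-- The numbers of tokens given by a flow. -/
def Network.counts (W : Network) (F : Preflow (Node τ k)) (t : Fin τ) (i : Fin k) : ℕ :=
  W.lo t i + F.R (exi t i) (ent t i)

/-- The numbers of moves given by a flow. -/
def Preflow.moves (F : Preflow (Node τ k)) (t t' : Fin τ) (i j : Fin k) : ℕ :=
  F.R (ent t' j) (exi t i)

variable {F : Preflow (Node τ k)}

theorem Preflow.Good.eq_zero (hF : Good W.R src sink F) {x y : Node τ k} (h1 : W.R x y = 0)
    (h2 : W.R y x = 0) : F.R x y = 0 := by
  have := hF.pair x y; omega

theorem Preflow.Good.cells_zero (hF : Good W.R src sink F) {t t' : Fin τ} {i j : Fin k}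
    (h1 : ¬ (t' = t ∧ j = i)) (h2 : (t : ℕ) ≠ t' + 1) :
    F.R (ent t i) (exi t' j) = 0 ∧ F.R (exi t' j) (ent t i) = 0 := by
  have h1' : ¬ (t = t' ∧ i = j) := fun hh => h1 ⟨hh.1.symm, hh.2.symm⟩
  have := hF.pair (ent t i) (exi t' j)
  simp only [Network.R, if_neg h1, if_neg h1', h2, false_and, if_false, add_zero] at this
  omega

theorem Preflow.Good.counts_eq (hF : Good W.R src sink F) (hW : W.Proper τ k) (t : Fin τ)
    (i : Fin k) : F.R (ent t i) (exi t i) + W.counts F t i = W.hi t i := by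
  have := hW.lo_le t i; have := hW.le_hi t i
  simp only [Network.counts]
  have h := hF.pair (ent t i) (exi t i)
  simp [Network.R] at h
  omega

theorem Preflow.Good.row_ent_first (hF : Good W.R src sink F) (hW : W.Proper τ k)
    (he : ∀ u, u ≠ src → u ≠ sink → F.e u = 0) {t : Fin τ} (ht : (t : ℕ) = 0) (i : Fin k) :
    F.R (ent t i) sink + F.R (ent t i) src = W.counts F t i := by
  have h := hF.out (ent t i) (by simp)
  rw [he _ (by simp) (by simp), base_ent_first t ht, sum_ent_first _ t i] at h
  · have := hF.counts_eq hW t i; have := hW.le_hi t i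
    omega
  · intro t' j; exact hF.eq_zero rfl rfl
  · intro t' j hn; exact (hF.cells_zero hn (by omega)).1

theorem Preflow.Good.row_exi_last (hF : Good W.R src sink F) (hW : W.Proper τ k)
    (he : ∀ u, u ≠ src → u ≠ sink → F.e u = 0) {t : Fin τ} (ht : (t : ℕ) + 1 = τ) (i : Fin k) :
    W.counts F t i + (F.R (exi t i) sink + F.R (exi t i) src) = W.size i := by
  have h := hF.out (exi t i) (by simp)
  rw [he _ (by simp) (by simp), base_exi_last t ht, sum_exi_last _ t i] at h
  · have := hW.lo_le t i; have := hW.le_hi t i; have := hW.hi_le t i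
    simp only [Network.counts]
    omega
  · intro t' j; exact hF.eq_zero rfl rfl
  · intro t' j hn
    exact (hF.cells_zero (fun hh => hn ⟨hh.1.symm, hh.2.symm⟩) (by omega)).2

/-- The moves are the backward residual capacities, and the arc from an entrance to its exit has
what is missing from the count to `hi`. So this is the law `out` without excess. -/
theorem Preflow.Good.moves_into (hF : Good W.R src sink F) (hW : W.Proper τ k)
    (he : ∀ u, u ≠ src → u ≠ sink → F.e u = 0) {s t : Fin τ} (ht : (t : ℕ) = s + 1) (j : Fin k) :
    ∑ i, F.moves s t i j = W.counts F t j := by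
  have hst : s ≠ t := by rintro rfl; omega
  have ht0 : (t : ℕ) ≠ 0 := by omega
  have h := hF.out (ent t j) (by simp)
  rw [he _ (by simp) (by simp), base_ent_later t s ht, sum_ent_later _ t s hst j] at h
  · have := hF.counts_eq hW t j; have := hW.le_hi t j
    simp only [Preflow.moves]
    omega
  · intro t' j; exact hF.eq_zero rfl rfl
  · intro t' j hn hn'
    exact (hF.cells_zero hn fun hh => hn' (Fin.ext (by omega))).1
  · exact hF.eq_zero (by simp [Network.R, ht0]) rfl
  · exact hF.eq_zero (by simp [Network.R, ht0]) rfl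

theorem Preflow.Good.moves_pair (hF : Good W.R src sink F) {s t : Fin τ} (ht : (t : ℕ) = s + 1)
    (i j : Fin k) : F.R (exi s i) (ent t j) + F.moves s t i j =
      (if W.ok s i j = true then W.cap else 0) + if j = i then W.start i else 0 := by
  have hst : s ≠ t := by rintro rfl; omega
  have h := hF.pair (exi s i) (ent t j)
  have e : (if i = j then W.start j else 0) = if j = i then W.start i else 0 := by
    by_cases hij : i = j
    · simp [hij]
    · rw [if_neg hij, if_neg (Ne.symm hij)]
  simp only [Network.R, ht, hst, hst.symm, false_and, true_and, if_false, zero_add, e] at h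
  exact h

theorem Preflow.Good.moves_out (hF : Good W.R src sink F) (hW : W.Proper τ k)
    (he : ∀ u, u ≠ src → u ≠ sink → F.e u = 0) {s t : Fin τ} (ht : (t : ℕ) = s + 1) (i : Fin k) :
    ∑ j, F.moves s t i j = W.counts F s i := by
  have hst : t ≠ s := by rintro rfl; omega
  have hs : (s : ℕ) + 1 ≠ τ := by omega
  have h := hF.out (exi s i) (by simp)
  rw [he _ (by simp) (by simp), base_exi_earlier s t ht, sum_exi_earlier _ s t hst i] at h
  · have h4 : ∑ j, F.R (exi s i) (ent t j) + ∑ j, F.moves s t i j =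
        (∑ j : Fin k, if W.ok s i j = true then W.cap else 0) + W.start i := by
      have : ∑ j : Fin k, (if j = i then W.start i else 0) = W.start i := by simp
      rw [← Finset.sum_add_distrib]
      conv_rhs => rw [← this, ← Finset.sum_add_distrib]
      exact Finset.sum_congr rfl fun j _ => hF.moves_pair ht i j
    have := hW.lo_le s i
    simp only [Network.counts]
    omega
  · intro t' j; exact hF.eq_zero rfl rfl
  · intro t' j hn hn'
    exact (hF.cells_zero (fun hh => hn ⟨hh.1.symm, hh.2.symm⟩)
      fun hh => hn' (Fin.ext (by omega))).2
  · exact hF.eq_zero (by simp [Network.R, hs]) rfl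
  · exact hF.eq_zero (by simp [Network.R, hs]) rfl

theorem Preflow.Good.plan (hF : Good W.R src sink F) (hW : W.Proper τ k)
    (he : ∀ u, u ≠ src → u ≠ sink → F.e u = 0) : W.Plan (W.counts F) F.moves where
  lo_le t i := Nat.le_add_right _ _
  le_hi t i := by have := hF.counts_eq hW t i; omega
  out s t ht i := hF.moves_out hW he ht i
  into s t ht j := hF.moves_into hW he ht j
  ok s t ht i j hp := by
    by_contra hcon
    have h := hF.moves_pair ht i j
    have hij : j ≠ i := by rintro rfl; exact hcon (hW.ok_self s j)
    rw [if_neg hcon, if_neg hij] at h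
    omega

theorem Preflow.Good.excess_sink (hF : Good W.R src sink F) (hW : W.Proper τ k)
    (he : ∀ u, u ≠ src → u ≠ sink → F.e u = 0) {a b : Fin τ} (ha : (a : ℕ) = 0)
    (hb : (b : ℕ) + 1 = τ) : F.e sink = W.score (W.counts F) a b := by
  have h := hF.out sink sink_ne_src
  rw [base_sink, zero_add, sum_sink _ a b] at h
  · rw [← h, Network.score]
    congr 1 <;> refine Finset.sum_congr rfl fun i _ => ?_
    · have h1 := hF.row_ent_first hW he ha i
      have h2 := hF.pair (ent a i) sink
      have h3 := hF.pair (ent a i) src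
      simp [Network.R, ha] at h2 h3
      -- As `start` is `0` or the full size, one of the arcs to the sink and to the source has
      -- capacity zero. Hence no flow can merely pass through this node from source to sink, and the
      -- sink receives exactly the truncated difference.
      have h4 := hW.start i
      have := hF.counts_eq hW a i; have := hW.hi_le a i
      omega
    · have h1 := hF.row_exi_last hW he hb i
      have h2 := hF.pair (exi b i) sink
      have h3 := hF.pair (exi b i) src
      simp [Network.R, hb] at h2 h3
      have h4 := hW.start i
      omega
  · intro t j ht
    have : ¬ (t : ℕ) = 0 := fun h => ht (Fin.ext (by omega))
    exact hF.eq_zero rfl (by simp [Network.R, this])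
  · intro t j ht
    have : ¬ (t : ℕ) + 1 = τ := fun h => ht (Fin.ext (by omega))
    exact hF.eq_zero rfl (by simp [Network.R, this])
  · exact hF.eq_zero rfl rfl
  · exact hF.eq_zero rfl rfl

/-! ### Moving tokens between classes -/

/-- Both sides are in bijection with the units of the matrix `g`: the fibres of `p` are cut up along
the rows, those of `r` along the columns. -/
theorem exists_equiv_of_counts {α β ι : Type} [Fintype α] [Fintype β] [Fintype ι] [DecidableEq ι]
    (p : α → ι) (r : β → ι) (g : ι → ι → ℕ)
    (hp : ∀ i, Fintype.card {a // p a = i} = ∑ j, g i j)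
    (hr : ∀ j, Fintype.card {b // r b = j} = ∑ i, g i j) :
    ∃ e : α ≃ β, ∀ a, 0 < g (p a) (r (e a)) := by
  have hp' : ∀ i, Nonempty ({a // p a = i} ≃ Σ j, Fin (g i j)) := fun i =>
    ⟨Fintype.equivOfCardEq (by simp [hp])⟩
  have hr' : ∀ j, Nonempty ((Σ i, Fin (g i j)) ≃ {b // r b = j}) := fun j =>
    ⟨Fintype.equivOfCardEq (by simp [hr])⟩
  choose P _ using fun i => Classical.exists_true_of_nonempty (hp' i)
  choose R _ using fun i => Classical.exists_true_of_nonempty (hr' i)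
  let sw : (Σ i, Σ j, Fin (g i j)) ≃ Σ j, Σ i, Fin (g i j) :=
    ⟨fun x => ⟨x.2.1, x.1, x.2.2⟩, fun x => ⟨x.2.1, x.1, x.2.2⟩, fun _ => rfl, fun _ => rfl⟩
  refine ⟨(Equiv.sigmaFiberEquiv p).symm.trans <| (Equiv.sigmaCongrRight P).trans <| sw.trans <|
    (Equiv.sigmaCongrRight R).trans <| Equiv.sigmaFiberEquiv r, fun a => ?_⟩
  have h1 : r ((Equiv.sigmaFiberEquiv r) (Equiv.sigmaCongrRight R (sw (Equiv.sigmaCongrRight P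
      ((Equiv.sigmaFiberEquiv p).symm a))))) = (P (p a) ⟨a, rfl⟩).1 :=
    (R _ ⟨p a, (P (p a) ⟨a, rfl⟩).2⟩).2
  simp only [Equiv.trans_apply]
  rw [h1]
  exact Fin.pos (P (p a) ⟨a, rfl⟩).2

section classes

set_option linter.unusedSectionVars false

variable {V : Type} [Fintype V] [DecidableEq V] {k : ℕ} (p : V → Fin k)

/-- The number of elements of `S` in a class. -/
def count (S : Finset V) (i : Fin k) : ℕ := (S.filter fun u => p u = i).card

theorem sum_count (S : Finset V) : ∑ i, count p S i = S.card :=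
  (Finset.card_eq_sum_card_fiberwise (f := p) (t := Finset.univ) (by simp)).symm

theorem count_pos {S : Finset V} {i : Fin k} : 0 < count p S i ↔ ∃ u ∈ S, p u = i := by
  simp [count, Finset.card_pos, Finset.Nonempty]

theorem card_fiber (S : Finset V) (i : Fin k) :
    Fintype.card {a : S // p a = i} = count p S i := by
  rw [Fintype.card_subtype, count, ← Finset.card_map (Function.Embedding.subtype (· ∈ S))]
  congr 1; ext u; simp [and_comm]

/-- Adjacency of a vertex to the vertices of a class does not depend on the vertex within its
class. -/
def Twins (H : SimpleGraph V) : Prop :=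
  ∀ u v w, p u = p v → w ≠ u → w ≠ v → H.Adj u w → H.Adj v w

variable {p} {H : SimpleGraph V}

/-- One end of the edge is exchanged at a time; the other end lies in another class, so the
exceptions in `Twins` do not arise. -/
theorem Twins.adj_of_ne (h : Twins p H) {u v u' v' : V} (huv : H.Adj u v) (hne : p u ≠ p v)
    (hu : p u = p u') (hv : p v = p v') : H.Adj u' v' := by
  have h1 : H.Adj u' v := h u u' v hu (fun e => hne (by rw [e])) (fun e => hne (by rw [hu, e])) huv
  exact (h v v' u' hv (fun e => hne (by rw [hu, e])) (fun e => hne (by rw [hu, hv, e])) h1.symm).symm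

/-- A single edge makes its class a clique. Again one end is exchanged at a time, except that `u' =
v` is already an end of the edge and must be kept. -/
theorem Twins.adj_of_eq (h : Twins p H) {u v u' v' : V} (huv : H.Adj u v) (he : p u = p v)
    (hu : p u = p u') (hv : p u = p v') (hne : u' ≠ v') : H.Adj u' v' := by
  have key : ∀ {a b c : V}, H.Adj a b → p a = p b → p c = p b → c ≠ b → H.Adj c b := by
    intro a b c hab hpab hc hcb
    exact h a c b (hpab.trans hc.symm) hab.ne.symm hcb.symm hab
  by_cases h1 : u' = v
  · subst h1
    exact (key huv he (by rw [← hv, he]) hne.symm).symm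
  · have h2 : H.Adj u' v := key huv he (by rw [← hu, he]) h1
    exact (key h2.symm (by rw [← hu, he]) (by rw [← hu, ← hv]) hne.symm).symm

theorem Reconfigurable.card_eq {S T : Finset V} (h : Reconfigurable H S T) : S.card = T.card := by
  obtain ⟨b, -⟩ := h
  simpa using Fintype.card_congr b

theorem Reconfigurable.exists_moves {S T : Finset V} (h : Reconfigurable H S T) :
    ∃ f : Fin k → Fin k → ℕ, (∀ i j, f i j ≤ Fintype.card V) ∧
      (∀ i, ∑ j, f i j = count p S i) ∧ (∀ j, ∑ i, f i j = count p T j) ∧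
      ∀ i j, 0 < f i j → ∃ u w, p u = i ∧ p w = j ∧ (u = w ∨ H.Adj u w) := by
  obtain ⟨b, hb⟩ := h
  refine ⟨fun i j => ((Finset.univ : Finset S).filter fun u : S => p u = i ∧ p (b u) = j).card,
    fun i j => ?_, fun i => ?_, fun j => ?_, fun i j hp => ?_⟩
  · exact (Finset.card_le_univ _).trans (by simp [Finset.card_le_univ])
  · rw [← card_fiber, Fintype.card_subtype, Finset.card_eq_sum_card_fiberwise
      (f := fun u : S => p (b u)) (t := Finset.univ) (by simp)]
    simp [Finset.filter_filter]
  · rw [← card_fiber, ← Fintype.card_congr (b.subtypeEquiv (p := fun u => p (b u) = j)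
      (q := fun u : T => p u = j) fun _ => Iff.rfl), Fintype.card_subtype,
      Finset.card_eq_sum_card_fiberwise (f := fun u : S => p u) (t := Finset.univ) (by simp)]
    simp [Finset.filter_filter, and_comm]
  · obtain ⟨u, hu⟩ := Finset.card_pos.mp hp
    simp only [Finset.mem_filter, Finset.mem_univ, true_and] at hu
    exact ⟨u, b u, hu.1, hu.2, hb u⟩

/-- For each class, `f i i` tokens are left in place on common vertices of `S` and `T`, so moves
within a class need no edges. The other tokens are matched by the matrix with its diagonal removed,
and every matched pair lies in completely joined classes. -/
theorem reconfigurable_of_moves {S T : Finset V} (f : Fin k → Fin k → ℕ)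
    (hS : ∀ i, ∑ j, f i j = count p S i) (hT : ∀ j, ∑ i, f i j = count p T j)
    (hd : ∀ i, f i i ≤ count p (S ∩ T) i)
    (hf : ∀ i j, i ≠ j → 0 < f i j → ∀ u w, p u = i → p w = j → H.Adj u w) :
    Reconfigurable H S T := by
  choose A hA hAc using fun i => Finset.exists_subset_card_eq (hd i)
  let B := Finset.univ.biUnion A
  have hAp : ∀ i u, u ∈ A i → (u ∈ S ∧ u ∈ T) ∧ p u = i := fun i u hu => by
    simpa using hA i hu
  have hB : ∀ u, u ∈ B ↔ u ∈ A (p u) := fun u => by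
    simp only [B, Finset.mem_biUnion, Finset.mem_univ, true_and]
    constructor
    · rintro ⟨i, hi⟩
      rwa [(hAp i u hi).2]
    · exact fun h => ⟨_, h⟩
  have hBS : ∀ u ∈ B, u ∈ S ∧ u ∈ T := fun u hu => (hAp _ u ((hB u).mp hu)).1
  have hcount : ∀ X : Finset V, (∀ u ∈ B, u ∈ X) → ∀ i, count p (X \ B) i + f i i = count p X i := by
    intro X hX i
    rw [← hAc i, count, count, ← Finset.card_union_of_disjoint]
    · congr 1; ext u
      simp only [Finset.mem_union, Finset.mem_filter, Finset.mem_sdiff, hB]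
      constructor
      · rintro (h | h)
        · exact ⟨h.1.1, h.2⟩
        · have := (hAp i u h).2
          exact ⟨hX u ((hB u).mpr (by rwa [this])), this⟩
      · rintro ⟨h1, rfl⟩
        by_cases h : u ∈ A (p u)
        · exact Or.inr h
        · exact Or.inl ⟨⟨h1, h⟩, rfl⟩
    · rw [Finset.disjoint_left]
      intro u hu hu'
      simp only [Finset.mem_filter, Finset.mem_sdiff, hB] at hu
      exact hu.1.2 (by rwa [hu.2])
  have hoff : ∀ g : Fin k → ℕ, ∀ i, (∑ j, if i = j then 0 else g j) + g i = ∑ j, g j := by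
    intro g i
    rw [← Finset.add_sum_erase _ g (Finset.mem_univ i), add_comm,
      ← Finset.add_sum_erase _ (fun j => if i = j then 0 else g j) (Finset.mem_univ i)]
    simp only [if_true, zero_add]
    congr 1
    refine Finset.sum_congr rfl fun j hj => ?_
    rw [if_neg (Finset.ne_of_mem_erase hj).symm]
  obtain ⟨b, hb⟩ := exists_equiv_of_counts (fun u : ↥(S \ B) => p u) (fun u : ↥(T \ B) => p u)
    (fun i j => if i = j then 0 else f i j)
    (fun i => by
      have h1 := hcount S (fun u hu => (hBS u hu).1) i
      have h2 := hoff (f i) i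
      have h3 := hS i
      rw [card_fiber]; omega)
    (fun j => by
      have h1 := hcount T (fun u hu => (hBS u hu).2) j
      have h2 := hoff (fun i => f i j) j
      have h3 := hT j
      simp only [eq_comm (a := j)] at h2
      rw [card_fiber]; omega)
  have hcard : S.card = T.card := by
    rw [← sum_count p S, ← sum_count p T]
    simp only [← hS, ← hT]
    exact Finset.sum_comm
  let φ : S → T := fun u => if h : (u : V) ∈ B then ⟨u, (hBS u h).2⟩ else
    ⟨b ⟨u, Finset.mem_sdiff.mpr ⟨u.2, h⟩⟩, (Finset.mem_sdiff.mp (b _).2).1⟩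
  have hφ1 : ∀ u : S, (h : (u : V) ∈ B) → (φ u : V) = u := fun u h => by simp [φ, h]
  have hφ2 : ∀ u : S, (h : (u : V) ∉ B) → (φ u : V) = b ⟨u, Finset.mem_sdiff.mpr ⟨u.2, h⟩⟩ :=
    fun u h => by simp [φ, h]
  have hφ3 : ∀ u : S, (φ u : V) ∈ B ↔ (u : V) ∈ B := fun u => by
    by_cases h : (u : V) ∈ B
    · simp [hφ1 u h, h]
    · rw [hφ2 u h]
      simp only [h, iff_false]
      exact (Finset.mem_sdiff.mp (b _).2).2
  have hinj : Function.Injective φ := by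
    intro u v huv
    have huv' : (φ u : V) = φ v := by rw [huv]
    by_cases h : (u : V) ∈ B
    · have h' : (v : V) ∈ B := by rwa [← hφ3, ← huv, hφ3]
      rw [hφ1 u h, hφ1 v h'] at huv'
      exact Subtype.ext huv'
    · have h' : (v : V) ∉ B := by rwa [← hφ3, ← huv, hφ3]
      rw [hφ2 u h, hφ2 v h'] at huv'
      have := b.injective (Subtype.ext huv')
      exact Subtype.ext (congrArg (fun x : ↥(S \ B) => (x : V)) this)
  refine ⟨Equiv.ofBijective φ ((Fintype.bijective_iff_injective_and_card φ).mpr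
    ⟨hinj, by simpa using hcard⟩), fun u => ?_⟩
  change (u : V) = φ u ∨ H.Adj u (φ u)
  by_cases h : (u : V) ∈ B
  · exact Or.inl (hφ1 u h).symm
  · right
    have h1 := hb ⟨u, Finset.mem_sdiff.mpr ⟨u.2, h⟩⟩
    rw [hφ2 u h]
    split_ifs at h1 with h2
    · exact absurd h1 (lt_irrefl 0)
    · exact hf _ _ h2 h1 _ _ rfl rfl

/-! ### Dominating and independent sets in terms of counts -/

variable (p H) in
/-- Weights of the classes: `1` for cliques, the size of the class for independent sets. -/
def IsWeight (w : Fin k → ℕ) : Prop := ∀ i,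
  (w i = 1 ∧ ∀ u v, p u = i → p v = i → u ≠ v → H.Adj u v) ∨
  (w i = count p Finset.univ i ∧ ∀ u v, p u = i → p v = i → ¬ H.Adj u v)

variable (p H) in
/-- The relation of adjacency between different classes. -/
def IsLink (l : Fin k → Fin k → Prop) : Prop := ∀ i j,
  (l i j ∧ i ≠ j ∧ ∀ u v, p u = i → p v = j → H.Adj u v) ∨
  (¬ l i j ∧ ∀ u v, p u = i → p v = j → i ≠ j → ¬ H.Adj u v)

variable {w : Fin k → ℕ} {l : Fin k → Fin k → Prop}

theorem count_le (S : Finset V) (i : Fin k) : count p S i ≤ count p Finset.univ i :=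
  Finset.card_le_card (Finset.filter_subset_filter _ (Finset.subset_univ S))

theorem mem_of_count_le {S : Finset V} {u : V}
    (h : count p Finset.univ (p u) ≤ count p S (p u)) : u ∈ S := by
  have := Finset.eq_of_subset_of_card_le
    (Finset.filter_subset_filter (fun v => p v = p u) (Finset.subset_univ S)) h
  have h2 : u ∈ Finset.univ.filter fun v => p v = p u := by simp
  rw [← this] at h2
  exact (Finset.mem_filter.mp h2).1

/-- A class without an occupied linked class has to dominate itself: one token suffices in a clique,
while an independent class must be full. -/
theorem isDominatingSet_of_count {S : Finset V} (hw : IsWeight p H w) (hl : IsLink p H l)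
    (h : ∀ i, (∃ j, 0 < count p S j ∧ l i j) ∨ w i ≤ count p S i) : IsDominatingSet H S := by
  intro v
  rcases h (p v) with ⟨j, hj, hlj⟩ | h1
  · obtain ⟨u, hu, rfl⟩ := (count_pos p).mp hj
    refine ⟨u, hu, Or.inr ?_⟩
    rcases hl (p v) (p u) with h2 | h2
    · exact h2.2.2 v u rfl rfl
    · exact absurd hlj h2.1
  · rcases hw (p v) with h2 | h2
    · obtain ⟨u, hu, huv⟩ := (count_pos p).mp (show 0 < count p S (p v) by omega)
      refine ⟨u, hu, ?_⟩
      by_cases e : u = v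
      · exact Or.inl e
      · exact Or.inr (h2.2 v u rfl huv (Ne.symm e))
    · exact ⟨v, mem_of_count_le (p := p) (by omega), Or.inl rfl⟩

theorem IsDominatingSet.count {S : Finset V} (hS : IsDominatingSet H S) (hw : IsWeight p H w)
    (hl : IsLink p H l) (hp : Function.Surjective p) (i : Fin k) :
    (∃ j, 0 < count p S j ∧ l i j) ∨ w i ≤ TempReconf.count p S i := by
  by_cases hn : ∃ j, 0 < TempReconf.count p S j ∧ l i j
  · exact Or.inl hn
  right
  -- No occupied class is linked to `i`, so the vertices of `i` are dominated from within `i`.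
  have key : ∀ v, p v = i → ∃ u ∈ S, p u = i ∧ (u = v ∨ H.Adj v u) := by
    intro v hv
    obtain ⟨u, hu, h⟩ := hS v
    refine ⟨u, hu, ?_, h⟩
    rcases h with rfl | h
    · exact hv
    · by_contra hne
      rcases hl i (p u) with h2 | h2
      · exact hn ⟨p u, (count_pos p).mpr ⟨u, hu, rfl⟩, h2.1⟩
      · exact h2.2 v u hv rfl (Ne.symm hne) h
  rcases hw i with h2 | h2
  · obtain ⟨v, hv⟩ := hp i
    obtain ⟨u, hu, hui, -⟩ := key v hv
    rw [h2.1]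
    exact (count_pos p).mpr ⟨u, hu, hui⟩
  · rw [h2.1]
    refine Finset.card_le_card fun v hv => ?_
    simp only [Finset.mem_filter, Finset.mem_univ, true_and] at hv ⊢
    obtain ⟨u, hu, hui, rfl | h⟩ := key v hv
    · exact ⟨hu, hv⟩
    · exact absurd h (h2.2 v u hv hui)

theorem isIndependentSet_of_count {S : Finset V} (hw : IsWeight p H w) (hl : IsLink p H l)
    (h : ∀ i, 0 < count p S i → (∀ j, 0 < count p S j → ¬ l i j) ∧ count p S i ≤ w i) :
    IsIndependentSet H S := by
  intro u hu v hv hne hadj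
  have hu' : 0 < count p S (p u) := (count_pos p).mpr ⟨u, hu, rfl⟩
  have hv' : 0 < count p S (p v) := (count_pos p).mpr ⟨v, hv, rfl⟩
  obtain ⟨h1, h2⟩ := h (p u) hu'
  by_cases he : p v = p u
  · rcases hw (p u) with h3 | h3
    · have : 1 < count p S (p u) :=
        Finset.one_lt_card.mpr ⟨u, by simpa using hu, v, by simpa [he] using hv, hne⟩
      omega
    · exact h3.2 u v rfl he hadj
  · rcases hl (p u) (p v) with h3 | h3
    · exact h1 _ hv' h3.1
    · exact h3.2 u v rfl rfl (Ne.symm he) hadj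

theorem IsIndependentSet.count {S : Finset V} (hS : IsIndependentSet H S) (hw : IsWeight p H w)
    (hl : IsLink p H l) (i : Fin k) (hi : 0 < TempReconf.count p S i) :
    (∀ j, 0 < TempReconf.count p S j → ¬ l i j) ∧ TempReconf.count p S i ≤ w i := by
  obtain ⟨u, hu, hui⟩ := (count_pos p).mp hi
  constructor
  · intro j hj hlj
    obtain ⟨v, hv, hvj⟩ := (count_pos p).mp hj
    rcases hl i j with h3 | h3
    · have h4 := h3.2.2 u v hui hvj
      exact hS hu hv h4.ne h4
    · exact h3.1 hlj
  · rcases hw i with h3 | h3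
    · rw [h3.1]
      refine Finset.card_le_one.mpr fun a ha b hb => ?_
      simp only [Finset.mem_filter] at ha hb
      by_contra hne
      exact hS ha.1 hb.1 hne (h3.2 a b ha.2 hb.2 hne)
    · rw [h3.1]
      exact count_le S i

end classes

/-! ### The input of a temporal graph -/

namespace ListedPartition

variable {V : Type} {k : ℕ} (P : ListedPartition V k)

/-- The class of a vertex. -/
noncomputable def index (v : V) : Fin k := (P.cover v).choose

theorem mem_cls_iff {v : V} {i : Fin k} : v ∈ P.cls i ↔ P.index v = i := by
  have h := (P.cover v).choose_spec
  exact ⟨fun hv => (h.2 i hv).symm, fun hi => hi ▸ h.1⟩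

theorem length_pos (i : Fin k) : 0 < (P.cls i).length := List.length_pos_of_ne_nil (P.nonempty i)

theorem index_surjective : Function.Surjective P.index := fun i =>
  ⟨(P.cls i)[0]'(P.length_pos i), P.mem_cls_iff.mp (List.getElem_mem _)⟩

variable [DecidableEq V]

theorem count_univ [Fintype V] (i : Fin k) : count P.index Finset.univ i = (P.cls i).length := by
  rw [count, ← List.toFinset_card_of_nodup (P.nodup i)]
  congr 1; ext v; simp [P.mem_cls_iff]

/-- The first `c i` vertices of each class `i`. -/
noncomputable def place (c : Fin k → ℕ) : Finset V :=
  Finset.univ.biUnion fun i : Fin k => ((P.cls i).take (c i)).toFinset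

theorem mem_place {c : Fin k → ℕ} {v : V} :
    v ∈ P.place c ↔ v ∈ (P.cls (P.index v)).take (c (P.index v)) := by
  simp only [place, Finset.mem_biUnion, Finset.mem_univ, true_and, List.mem_toFinset]
  constructor
  · rintro ⟨i, hi⟩
    rwa [P.mem_cls_iff.mp (List.mem_of_mem_take hi)]
  · exact fun h => ⟨_, h⟩

theorem count_place {c : Fin k → ℕ} {i : Fin k} (hc : c i ≤ (P.cls i).length) :
    count P.index (P.place c) i = c i := by
  have : (P.place c).filter (fun u => P.index u = i) = ((P.cls i).take (c i)).toFinset := by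
    ext v
    simp only [Finset.mem_filter, List.mem_toFinset, P.mem_place]
    constructor
    · rintro ⟨h, rfl⟩; exact h
    · intro h
      have := P.mem_cls_iff.mp (List.mem_of_mem_take h)
      exact ⟨by rwa [this], this⟩
  rw [count, this, List.toFinset_card_of_nodup ((P.nodup i).sublist (List.take_sublist _ _)),
    List.length_take]
  omega

theorem place_mono {c d : Fin k → ℕ} (h : ∀ i, c i ≤ d i) : P.place c ⊆ P.place d := fun _ hv =>
  P.mem_place.mpr ((List.take_sublist_take_left (h _)).subset (P.mem_place.mp hv))

/-- Initial segments of one list are nested. Placing tokens on the first vertices thus provides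
enough common vertices for the tokens that stay. -/
theorem min_le_count_inter {c d : Fin k → ℕ} {i : Fin k} (hc : c i ≤ (P.cls i).length) :
    min (c i) (d i) ≤ count P.index (P.place c ∩ P.place d) i := by
  rw [← P.count_place (c := fun i => min (c i) (d i)) (min_le_of_left_le hc)]
  refine Finset.card_le_card (Finset.filter_subset_filter _ (Finset.subset_inter ?_ ?_))
  · exact P.place_mono fun i => min_le_left _ _
  · exact P.place_mono fun i => min_le_right _ _

end ListedPartition

section

variable {n k : ℕ} {G : TemporalGraph (Fin n)} {P : ListedPartition (Fin n) k}

theorem IsTNDPartition.twins (hP : IsTNDPartition G P) {t : ℕ} (h1 : 1 ≤ t) (h2 : t ≤ G.lifetime) :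
    Twins P.index (G.snapshot t) := by
  intro u v w huv hwu hwv hadj
  have h := hP (P.index u) u (P.mem_cls_iff.mpr rfl) v (P.mem_cls_iff.mpr huv.symm) t h1 h2
  have : w ∈ (G.snapshot t).neighborSet u \ {v} := ⟨hadj, hwv⟩
  rw [h] at this
  exact this.1

theorem inputOf_size (i : Fin k) : (inputOf G P).size i = (P.cls i).length := by
  simp [inputOf]

theorem inputOf_member (i : Fin k) {j : ℕ} (hj : j < (P.cls i).length) :
    (inputOf G P).member i j = ((P.cls i)[j] : Fin n) := by
  simp [inputOf, hj]

theorem inputOf_adj {t : ℕ} (u v : Fin n) :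
    (inputOf G P).adj t u v ≠ 0 ↔ (G.snapshot t).Adj u v := by
  simp [inputOf]

theorem isLink_inputOf (hP : IsTNDPartition G P) {t : ℕ} (ht : t < G.lifetime) :
    IsLink P.index (G.snapshot (t + 1)) fun i j => (inputOf G P).linked t i j = true := by
  intro i j
  have ht' := hP.twins (t := t + 1) (by omega) ht
  have h1 : P.index ((P.cls i)[0]'(P.length_pos i)) = i := P.mem_cls_iff.mp (List.getElem_mem _)
  have h2 : P.index ((P.cls j)[0]'(P.length_pos j)) = j := P.mem_cls_iff.mp (List.getElem_mem _)
  simp only [Input.linked, bne_iff_ne, inputOf_member _ (P.length_pos _), inputOf_adj]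
  by_cases hadj : (G.snapshot (t + 1)).Adj ((P.cls i)[0]'(P.length_pos i))
      ((P.cls j)[0]'(P.length_pos j))
  · have hij : i ≠ j := by rintro rfl; exact hadj.ne rfl
    exact Or.inl ⟨hadj, hij, fun u v hu hv =>
      ht'.adj_of_ne hadj (by rwa [h1, h2]) (by rw [h1, hu]) (by rw [h2, hv])⟩
  · refine Or.inr ⟨hadj, fun u v hu hv hij h => hadj ?_⟩
    exact ht'.adj_of_ne h (by rwa [hu, hv]) (by rw [h1, hu]) (by rw [h2, hv])

theorem isWeight_inputOf (hP : IsTNDPartition G P) {t : ℕ} (ht : t < G.lifetime) :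
    IsWeight P.index (G.snapshot (t + 1)) fun i => (inputOf G P).weight t i := by
  intro i
  have ht' := hP.twins (t := t + 1) (by omega) ht
  have h1 : P.index ((P.cls i)[0]'(P.length_pos i)) = i := P.mem_cls_iff.mp (List.getElem_mem _)
  -- For a class with one vertex, position `1` reads as the default `0` and the adjacency entry says
  -- nothing about the class. The weight is `1` on either outcome of the test.
  by_cases hlen : (P.cls i).length = 1
  · left
    refine ⟨by simp [Input.weight, inputOf_size, hlen], fun u v hu hv huv => absurd ?_ huv⟩
    have : count P.index Finset.univ i ≤ 1 := by rw [P.count_univ, hlen]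
    exact Finset.card_le_one.mp this u (by simpa using hu) v (by simpa using hv)
  have hlen' : 1 < (P.cls i).length := by have := P.length_pos i; omega
  have h2 : P.index ((P.cls i)[1]'hlen') = i := P.mem_cls_iff.mp (List.getElem_mem _)
  have hne : (P.cls i)[0]'(P.length_pos i) ≠ (P.cls i)[1]'hlen' := by
    intro h
    have := (P.nodup i).getElem_inj_iff.mp h
    omega
  simp only [Input.weight, inputOf_member _ (P.length_pos _), inputOf_member _ hlen',
    inputOf_size, P.count_univ]
  by_cases hadj : (G.snapshot (t + 1)).Adj ((P.cls i)[0]'(P.length_pos i)) ((P.cls i)[1]'hlen')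
  · exact Or.inl ⟨if_pos (inputOf_adj _ _ |>.mpr hadj), fun u v hu hv huv =>
      ht'.adj_of_eq hadj (by rw [h1, h2]) (by rw [h1, hu]) (by rw [h1, hv]) huv⟩
  · refine Or.inr ⟨if_neg fun h => hadj (inputOf_adj _ _ |>.mp h), fun u v hu hv h => hadj ?_⟩
    exact ht'.adj_of_eq h (by rw [hu, hv]) (by rw [h1, hu]) (by rw [hu, h2]) hne

theorem near_inputOf {β : ℕ → ℕ → Bool} {t : ℕ} {i : ℕ} : (inputOf G P).near β t i = true ↔
    ∃ j : Fin k, β t j = true ∧ (inputOf G P).linked t i j = true := by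
  simp only [Input.near, decide_eq_true_eq]
  constructor
  · rintro ⟨j, hj, h⟩; exact ⟨⟨j, hj⟩, h⟩
  · rintro ⟨j, h⟩; exact ⟨j, j.2, h⟩

theorem weight_inputOf_pos (t : ℕ) (i : Fin k) : 0 < (inputOf G P).weight t i := by
  have := P.length_pos i
  simp only [Input.weight, inputOf_size]
  split_ifs <;> omega

theorem weight_inputOf_le (t : ℕ) (i : Fin k) : (inputOf G P).weight t i ≤ (P.cls i).length := by
  have := P.length_pos i
  simp only [Input.weight, inputOf_size]
  split_ifs <;> omega

/-- The two starting positions, all vertices or none, satisfy the bounds of every guess; thus the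
flow computation needs no separate search for a feasible start. -/
theorem proper_network (q : ℕ) (β : ℕ → ℕ → Bool) (τ : ℕ) :
    ((inputOf G P).network q β).Proper τ k where
  lo_le t i := by
    have := P.length_pos i
    have := weight_inputOf_le (G := G) (P := P) t i
    have : (β t i).toNat ≤ 1 := Bool.toNat_le _
    simp only [Input.network, Input.lower, Input.initial, inputOf_size]
    split_ifs <;> omega
  le_hi t i := by
    simp only [Input.network, Input.upper, Input.initial, inputOf_size]
    split_ifs <;> omega
  hi_le t i := by
    have := weight_inputOf_le (G := G) (P := P) t i
    simp only [Input.network, Input.upper, inputOf_size]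
    split_ifs <;> omega
  start i := by
    simp only [Input.network, Input.initial]
    split_ifs
    · exact Or.inr rfl
    · exact Or.inl rfl
  ok_self t i := by simp [Input.network, Input.allowed]

/-! ### The two problems -/

/-- The property of vertex sets that belongs to the parameter `q`. -/
def Feasible {V : Type} (q : ℕ) (H : SimpleGraph V) (S : Finset V) : Prop :=
  if q ≠ 0 then IsDominatingSet H S else IsIndependentSet H S

/-- For dominating sets, a chosen class has a positive lower bound whether or not it is near another
chosen class, so being near a chosen class means being linked to an occupied one. For independent
sets, the upper bounds empty every class that is not chosen or is near a chosen one. -/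
theorem feasible_of_bounds (hP : IsTNDPartition G P) {t : ℕ} (ht : t < G.lifetime) {q : ℕ}
    {β : ℕ → ℕ → Bool} {S : Finset (Fin n)}
    (h : ∀ i : Fin k, (inputOf G P).lower q β t i ≤ count P.index S i ∧
      count P.index S i ≤ (inputOf G P).upper q β t i) : Feasible q (G.snapshot (t + 1)) S := by
  by_cases hq : q ≠ 0
  · rw [Feasible, if_pos hq]
    refine isDominatingSet_of_count (isWeight_inputOf hP ht) (isLink_inputOf hP ht) fun i => ?_
    have h1 := (h i).1
    rw [Input.lower, if_pos hq] at h1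
    split_ifs at h1 with hn
    · obtain ⟨j, hj, hl⟩ := near_inputOf.mp hn
      refine Or.inl ⟨j, ?_, hl⟩
      have h2 := (h j).1
      have := weight_inputOf_pos (G := G) (P := P) t j
      rw [Input.lower, if_pos hq, hj] at h2
      split_ifs at h2
      · exact h2
      · omega
    · exact Or.inr h1
  · rw [Feasible, if_neg hq]
    refine isIndependentSet_of_count (isWeight_inputOf hP ht) (isLink_inputOf hP ht) ?_
    have key : ∀ i : Fin k, 0 < count P.index S i → ¬ (inputOf G P).near β t i = true ∧
        β t i = true ∧ count P.index S i ≤ (inputOf G P).weight t i := by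
      intro i hi
      have h1 := (h i).2
      rw [Input.upper, if_neg hq] at h1
      split_ifs at h1 with h2 h3
      · omega
      · exact ⟨h2, h3, h1⟩
      · omega
    intro i hi
    obtain ⟨h1, -, h3⟩ := key i hi
    exact ⟨fun j hj hl => h1 (near_inputOf.mpr ⟨j, (key j hj).2.1, hl⟩), h3⟩

/-- No solution is lost: it meets the bounds of the guess that marks exactly its occupied classes.
-/
theorem Feasible.bounds (hP : IsTNDPartition G P) {t : ℕ} (ht : t < G.lifetime) {q : ℕ}
    {β : ℕ → ℕ → Bool} {S : Finset (Fin n)} (h : Feasible q (G.snapshot (t + 1)) S)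
    (hβ : ∀ i : Fin k, β t i = true ↔ 0 < count P.index S i) (i : Fin k) :
    (inputOf G P).lower q β t i ≤ count P.index S i ∧
      count P.index S i ≤ (inputOf G P).upper q β t i := by
  have hle := count_le (p := P.index) S i
  rw [P.count_univ] at hle
  by_cases hq : q ≠ 0
  · rw [Feasible, if_pos hq] at h
    rw [Input.lower, Input.upper, if_pos hq, if_pos hq, inputOf_size]
    refine ⟨?_, hle⟩
    split_ifs with hn
    · by_cases hb : β t i = true
      · rw [hb]; exact (hβ i).mp hb
      · simp [hb]
    · rcases h.count (isWeight_inputOf hP ht) (isLink_inputOf hP ht) P.index_surjective i with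
        ⟨j, hj, hl⟩ | h1
      · exact absurd (near_inputOf.mpr ⟨j, (hβ j).mpr hj, hl⟩) hn
      · exact h1
  · rw [Feasible, if_neg hq] at h
    rw [Input.lower, Input.upper, if_neg hq, if_neg hq]
    refine ⟨Nat.zero_le _, ?_⟩
    by_cases hi : 0 < count P.index S i
    · obtain ⟨h1, h2⟩ := h.count (isWeight_inputOf hP ht) (isLink_inputOf hP ht) i hi
      have hn : ¬ (inputOf G P).near β t i = true := fun hn => by
        obtain ⟨j, hj, hl⟩ := near_inputOf.mp hn
        exact h1 j ((hβ j).mp hj) hl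
      rw [if_neg hn, if_pos ((hβ i).mpr hi)]
      exact h2
    · omega

theorem IsReconfigurableSequence.card_eq {V : Type} [Fintype V] [DecidableEq V]
    {G : TemporalGraph V} {T : ℕ → Finset V}
    (h : IsReconfigurableSequence G T) {t : ℕ} (ht : t + 1 ≤ G.lifetime) :
    (T (t + 1)).card = (T 1).card := by
  induction t with
  | zero => rfl
  | succ t ih => rw [← (h (t + 1) (by omega) (by omega)).card_eq, ih (by omega)]

theorem exists_testBit (K : ℕ) (b : ℕ → Bool) : ∃ x < 2 ^ K, ∀ j < K, x.testBit j = b j := by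
  refine ⟨(BitVec.ofFnLE fun j : Fin K => b j).toNat, (BitVec.ofFnLE _).isLt, fun j hj => ?_⟩
  rw [BitVec.testBit_toNat]
  simp [hj]

/-- Only cells within the range are prescribed. For this reason `exec_inputOf` returns a choice `γ'`
that merely agrees with `γ` there. -/
theorem exists_digits (I : Input) (β : ℕ → ℕ → Bool) : ∃ x < 2 ^ I.cells,
    ∀ t < I.lifetime, ∀ i < I.classes, I.digits x t i = β t i := by
  obtain ⟨x, hx, h⟩ := exists_testBit I.cells fun j => β (j / I.classes) (j % I.classes)
  refine ⟨x, hx, fun t ht i hi => ?_⟩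
  rw [Input.digits, h _ (Node.cell_lt ht hi), mul_comm, Nat.mul_add_div (by omega),
    Nat.div_eq_of_lt hi, Nat.mul_add_mod, Nat.mod_eq_of_lt hi, add_zero]

end

/-! ### From plans to sequences of sets and back -/

section

variable {n k : ℕ} {G : TemporalGraph (Fin n)} {P : ListedPartition (Fin n) k}

theorem Network.Plan.reconfigurable (hP : IsTNDPartition G P) {q : ℕ} {β : ℕ → ℕ → Bool}
    {c : Fin G.lifetime → Fin k → ℕ} {f : Fin G.lifetime → Fin G.lifetime → Fin k → Fin k → ℕ}
    (h : ((inputOf G P).network q β).Plan c f) {t t' : Fin G.lifetime} (ht : (t' : ℕ) = t + 1) :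
    Reconfigurable (G.snapshot (t + 1)) (P.place (c t)) (P.place (c t')) := by
  have hle : ∀ t i, c t i ≤ (P.cls i).length := fun t i => by
    have := (h.le_hi t i).trans ((proper_network (G := G) (P := P) q β G.lifetime).hi_le t i)
    exact this.trans_eq (inputOf_size (G := G) i)
  refine reconfigurable_of_moves (p := P.index) (f t t') ?_ ?_ ?_ ?_
  · intro i; rw [h.out t t' ht, P.count_place (hle t i)]
  · intro j; rw [h.into t t' ht, P.count_place (hle t' j)]
  · intro i
    refine le_trans (le_min ?_ ?_) (P.min_le_count_inter (hle t i))
    · rw [← h.out t t' ht]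
      exact Finset.single_le_sum (f := fun j => f t t' i j) (fun _ _ => Nat.zero_le _)
        (Finset.mem_univ i)
    · rw [← h.into t t' ht]
      exact Finset.single_le_sum (f := fun j => f t t' j i) (fun _ _ => Nat.zero_le _)
        (Finset.mem_univ i)
  · intro i j hij hpos u w hu hw
    have h1 := h.ok t t' ht i j hpos
    simp only [Input.network, Input.allowed, Bool.or_eq_true, beq_iff_eq, Fin.val_inj, hij,
      false_or] at h1
    rcases isLink_inputOf hP t.2 i j with h2 | h2
    · exact h2.2.2 u w hu hw
    · exact absurd h1 h2.1

theorem exists_plan (hP : IsTNDPartition G P) {q : ℕ} {β : ℕ → ℕ → Bool} {T : ℕ → Finset (Fin n)}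
    (hT : IsTemporalSolution (Feasible q) G T)
    (hβ : ∀ t < G.lifetime, ∀ i : Fin k, β t i = true ↔ 0 < count P.index (T (t + 1)) i) :
    ∃ f : Fin G.lifetime → Fin G.lifetime → Fin k → Fin k → ℕ, (∀ t t' i j, f t t' i j ≤ n) ∧
      ((inputOf G P).network q β).Plan
        (fun (t : Fin G.lifetime) i => count P.index (T (t + 1)) i) f := by
  have key : ∀ t t' : Fin G.lifetime, ∃ f : Fin k → Fin k → ℕ, (∀ i j, f i j ≤ n) ∧
      ((t' : ℕ) = t + 1 → (∀ i, ∑ j, f i j = count P.index (T (t + 1)) i) ∧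
        (∀ j, ∑ i, f i j = count P.index (T (t' + 1)) j) ∧
        ∀ i j, 0 < f i j → (inputOf G P).allowed t i j = true) := by
    intro t t'
    by_cases ht : (t' : ℕ) = t + 1
    · obtain ⟨f, h1, h2, h3, h4⟩ := (hT.1 (t + 1) (by omega)
        (by have := t'.2; omega)).exists_moves (p := P.index)
      refine ⟨f, by simpa using h1, fun _ => ⟨h2, by rw [ht]; exact h3, fun i j hpos => ?_⟩⟩
      obtain ⟨u, w, hu, hw, h5⟩ := h4 i j hpos
      simp only [Input.allowed, Bool.or_eq_true, beq_iff_eq, Fin.val_inj]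
      by_cases hij : i = j
      · exact Or.inl hij
      right
      rcases h5 with rfl | h5
      · exact absurd (hu.symm.trans hw) hij
      rcases isLink_inputOf hP t.2 i j with h6 | h6
      · exact h6.1
      · exact absurd h5 (h6.2 u w hu hw hij)
    -- A plan constrains moves only between consecutive time-steps; elsewhere zero respects the
    -- capacity.
    · exact ⟨fun _ _ => 0, fun _ _ => Nat.zero_le _, fun h => absurd h ht⟩
  choose f hf1 hf2 using key
  have hb := fun (t : Fin G.lifetime) (i : Fin k) =>
    (hT.2 (t + 1) (by omega) t.2).bounds hP t.2 (hβ t t.2) i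
  exact ⟨f, hf1, fun t i => (hb t i).1, fun t i => (hb t i).2, fun t t' ht => (hf2 t t' ht).1,
    fun t t' ht => (hf2 t t' ht).2.1, fun t t' ht => (hf2 t t' ht).2.2⟩

/-- Optimality of a solution: minimality for dominating sets, maximality for independent sets. -/
def Optimal (q : ℕ) (G : TemporalGraph (Fin n)) (T : ℕ → Finset (Fin n)) : Prop :=
  IsTemporalSolution (Feasible q) G T ∧ ∀ T' : ℕ → Finset (Fin n),
    IsTemporalSolution (Feasible q) G T' →
      if q ≠ 0 then (T 1).card ≤ (T' 1).card else (T' 1).card ≤ (T 1).card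

/-- Stated without subtraction: the score is `n` minus the size for dominating sets, and the size
for independent sets, where the tokens are counted at the last time-step. In both problems a larger
score is better. -/
theorem score_eq (q : ℕ) (β : ℕ → ℕ → Bool) {T : ℕ → Finset (Fin n)}
    (hT : IsReconfigurableSequence G T) {a b : Fin G.lifetime} (ha : (a : ℕ) = 0)
    (hb : (b : ℕ) + 1 = G.lifetime) :
    ((inputOf G P).network q β).score
      (fun (t : Fin G.lifetime) i => count P.index (T (t + 1)) i) a b +
      (if q ≠ 0 then (T 1).card else 0) = if q ≠ 0 then n else (T 1).card := by
  have hle : ∀ S i, count P.index S i ≤ (P.cls i).length := fun S i => by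
    rw [← P.count_univ]; exact count_le S i
  simp only [Network.score, Input.network, Input.initial, ha, hb, zero_add, inputOf_size]
  by_cases hq : q ≠ 0
  · simp only [if_pos hq, Nat.sub_eq_zero_of_le (hle _ _), Finset.sum_const_zero, add_zero]
    rw [← sum_count P.index (T 1), ← Finset.sum_add_distrib]
    calc _ = ∑ i, count P.index Finset.univ i := by
          refine Finset.sum_congr rfl fun i _ => ?_
          rw [P.count_univ, Nat.sub_add_cancel (hle _ _)]
      _ = n := by rw [sum_count]; simp
  · simp only [if_neg hq, Nat.zero_sub, Nat.sub_zero, Finset.sum_const_zero, add_zero, zero_add]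
    rw [sum_count, ← hb, hT.card_eq hb.le]

theorem exec_inputOf (P : ListedPartition (Fin n) k) (hτ : 1 ≤ G.lifetime) (hk : 0 < k) (q : ℕ) :
    ∃ m s, Exec (inputOf G P) (mainProg q) State.init m s ∧
      m ≤ 500 * (2 ^ (G.lifetime * k) * (2 * (G.lifetime * k) + 2) ^ 5) ∧
      s.reg 0 = ∑ i ∈ Finset.range k, s.mem i ∧
      ∃ (β : ℕ → ℕ → Bool) (F : Preflow (Node G.lifetime k)),
        Good ((inputOf G P).network q β).R src sink F ∧
        (∀ u, u ≠ src → u ≠ sink → F.e u = 0) ∧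
        (∀ (t : Fin G.lifetime) (i : Fin k),
          s.mem (t * k + i) = ((inputOf G P).network q β).counts F t i) ∧
        ∀ γ : ℕ → ℕ → Bool, ∃ (γ' : ℕ → ℕ → Bool) (F' : Preflow (Node G.lifetime k)),
          (∀ t < G.lifetime, ∀ i < k, γ' t i = γ t i) ∧
          Good ((inputOf G P).network q γ').R src sink F' ∧
          (∀ u, u ≠ src → u ≠ sink → F'.e u = 0) ∧ F'.e sink ≤ F.e sink := by
  obtain ⟨m, s, hexec, hm, hreg, x, F, hF, hc, hopt⟩ := exec_mainProg (inputOf G P) q hk hτ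
  refine ⟨m, s, hexec, hm, hreg, (inputOf G P).digits x, F, hF.good, hF.excess, hc, fun γ => ?_⟩
  obtain ⟨x', hx', hdig⟩ := exists_digits (inputOf G P) γ
  obtain ⟨F', hF', hle⟩ := hopt x' hx'
  exact ⟨(inputOf G P).digits x', F', hdig, hF'.good, hF'.excess, hle⟩

theorem exists_optimal (hP : IsTNDPartition G P) (hτ : 1 ≤ G.lifetime) (hk : 0 < k) (q : ℕ) :
    ∃ m s, Exec (inputOf G P) (mainProg q) State.init m s ∧
      m ≤ 500 * (2 ^ (G.lifetime * k) * (2 * (G.lifetime * k) + 2) ^ 5) ∧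
      (∀ t, 1 ≤ t → t ≤ G.lifetime → ∀ i : Fin k, tokens k s.mem t i ≤ (P.cls i).length) ∧
      Optimal q G (decode P s.mem) ∧ s.reg 0 = (decode P s.mem 1).card := by
  obtain ⟨m, s, hexec, hm, hreg, β, F, hF, he, hc, hopt⟩ := exec_inputOf P hτ hk q
  have hW := proper_network (G := G) (P := P) q β G.lifetime
  have hplan := hF.plan hW he
  set W := (inputOf G P).network q β with hWdef
  have hcounts : ∀ (t : Fin G.lifetime) (i : Fin k), tokens k s.mem (t + 1) i = W.counts F t i :=
    fun t i => hc t i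
  have hdec : ∀ t : Fin G.lifetime, decode P s.mem (t + 1) = P.place (W.counts F t) := by
    intro t
    rw [← funext (hcounts t)]
    simp only [decode, ListedPartition.place]
  have hle : ∀ (t : Fin G.lifetime) (i : Fin k), W.counts F t i ≤ (P.cls i).length := fun t i => by
    have := (hplan.le_hi t i).trans (hW.hi_le t i)
    exact this.trans_eq (inputOf_size (G := G) i)
  have hcount : (fun (t : Fin G.lifetime) i => count P.index (decode P s.mem (t + 1)) i) =
      W.counts F := by
    funext t i
    rw [hdec, P.count_place (hle t i)]
  have hrec : IsReconfigurableSequence G (decode P s.mem) := by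
    intro t h1 h2
    obtain ⟨t, rfl⟩ : ∃ u, t = u + 1 := ⟨t - 1, by omega⟩
    have h := hplan.reconfigurable hP (t := ⟨t, by omega⟩) (t' := ⟨t + 1, by omega⟩) rfl
    rwa [← hdec, ← hdec] at h
  refine ⟨m, s, hexec, hm, ?_, ⟨⟨hrec, ?_⟩, ?_⟩, ?_⟩
  · intro t h1 h2 i
    obtain ⟨t, rfl⟩ : ∃ u, t = u + 1 := ⟨t - 1, by omega⟩
    exact (hcounts ⟨t, by omega⟩ i).trans_le (hle _ i)
  · intro t h1 h2
    obtain ⟨t, rfl⟩ : ∃ u, t = u + 1 := ⟨t - 1, by omega⟩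
    refine feasible_of_bounds (P := P) (β := β) hP h2 fun i => ?_
    have := congrFun (congrFun hcount ⟨t, h2⟩) i
    simp only at this
    rw [this]
    exact ⟨hplan.lo_le ⟨t, h2⟩ i, hplan.le_hi ⟨t, h2⟩ i⟩
  · intro T' hT'
    -- The competitor is compared within the guess that marks the classes it occupies.
    obtain ⟨γ, F', hdig, hF', he', hle'⟩ := hopt fun t i =>
      if h : i < k then decide (0 < count P.index (T' (t + 1)) ⟨i, h⟩) else false
    obtain ⟨f, hf, hplan'⟩ := exists_plan (β := γ) hP hT' fun t ht i => by
      rw [hdig t ht i i.2]; simp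
    have h1 := hplan'.score_le (proper_network q _ G.lifetime) hf hF' he'
      (a := ⟨0, by omega⟩) (b := ⟨G.lifetime - 1, by omega⟩) rfl (by simp; omega)
    have h2 := hF.excess_sink hW he
      (a := ⟨0, by omega⟩) (b := ⟨G.lifetime - 1, by omega⟩) rfl (by simp; omega)
    have h3 := score_eq (P := P) q γ hT'.1
      (a := ⟨0, by omega⟩) (b := ⟨G.lifetime - 1, by omega⟩) rfl (by simp; omega)
    have h4 := score_eq (P := P) q β hrec
      (a := ⟨0, by omega⟩) (b := ⟨G.lifetime - 1, by omega⟩) rfl (by simp; omega)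
    rw [hcount, ← hWdef] at h4
    -- The score of the competitor is at most the maximum flow of its guess, hence at most the
    -- recorded flow, which is the score of the output.
    have h5 := h1.trans (hle'.trans h2.le)
    split_ifs at h3 h4 ⊢ <;> omega
  · rw [hreg, ← sum_count P.index, Finset.sum_range]
    refine Finset.sum_congr rfl fun i _ => ?_
    have h1 := congrFun (congrFun hcount ⟨0, hτ⟩) i
    have h2 := hcounts ⟨0, hτ⟩ i
    simp only [tokens, zero_add, Nat.sub_self, zero_mul] at h1 h2
    rw [h1, ← h2]

end

/-- Since `sSup ∅ = 0`, a positive lifetime requires an active edge, and hence a vertex, which lies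
in some class. -/
theorem classes_pos {n k : ℕ} {G : TemporalGraph (Fin n)} (P : ListedPartition (Fin n) k)
    (hτ : 1 ≤ G.lifetime) : 0 < k := by
  have hne : G.activeTimes.Nonempty := by
    by_contra h
    rw [Set.not_nonempty_iff_eq_empty] at h
    simp [TemporalGraph.lifetime, h] at hτ
  obtain ⟨t, ht⟩ := hne
  obtain ⟨⟨e, -⟩, -⟩ := Set.mem_iUnion.mp ht
  induction e with
  | _ u v => exact Fin.pos (P.index u)

/-- As `τ * k ≥ 1`, there are at most `4 * (τ * k)` nodes, and `500 * 4 ^ 5 = 512000`. Raising the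
exponents from `5` to `11 / 2` and `8` only enlarges the bound. -/
theorem time_bound {k τ : ℕ} (hk : 0 < k) (hτ : 1 ≤ τ) {m : ℕ}
    (hm : m ≤ 500 * (2 ^ (τ * k) * (2 * (τ * k) + 2) ^ 5)) :
    (m : ℝ) ≤ 512000 * (2 ^ (k * τ) * ((τ : ℝ) ^ (11 / 2 : ℝ) * (k : ℝ) ^ 8)) := by
  have h1 : m ≤ 512000 * (2 ^ (k * τ) * (τ ^ 5 * k ^ 8)) := by
    refine hm.trans ?_
    have h2 : 1 ≤ τ * k := Nat.mul_pos hτ hk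
    have h3 : (2 * (τ * k) + 2) ^ 5 ≤ (4 * (τ * k)) ^ 5 := Nat.pow_le_pow_left (by omega) 5
    have h4 : k ^ 5 ≤ k ^ 8 := Nat.pow_le_pow_right hk (by norm_num)
    calc 500 * (2 ^ (τ * k) * (2 * (τ * k) + 2) ^ 5)
        ≤ 500 * (2 ^ (τ * k) * (4 * (τ * k)) ^ 5) := by gcongr
      _ = 512000 * (2 ^ (k * τ) * (τ ^ 5 * k ^ 5)) := by rw [mul_comm τ k]; ring
      _ ≤ _ := by gcongr
  have h2 : (τ : ℝ) ^ 5 ≤ (τ : ℝ) ^ (11 / 2 : ℝ) := by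
    rw [← Real.rpow_natCast]
    exact Real.rpow_le_rpow_of_exponent_le (by exact_mod_cast hτ) (by norm_num)
  calc (m : ℝ) ≤ 512000 * (2 ^ (k * τ) * ((τ : ℝ) ^ 5 * (k : ℝ) ^ 8)) := by exact_mod_cast h1
    _ ≤ _ := by gcongr

end TempReconf

theorem mainTheorem8 :
    ∃ C : ℝ,
      (∃ p : TempReconf.Prog,
        TempReconf.SolvesWithin (fun _ G T => TempReconf.SolvesTDSR G T) p
          (fun k τ => C * (2 ^ (k * τ) * ((τ : ℝ) ^ (11 / 2 : ℝ) * (k : ℝ) ^ 8)))) ∧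
      (∃ p : TempReconf.Prog,
        TempReconf.SolvesWithin (fun _ G T => TempReconf.SolvesTISR G T) p
          (fun k τ => C * (2 ^ (k * τ) * ((τ : ℝ) ^ (11 / 2 : ℝ) * (k : ℝ) ^ 8)))) := by
  -- One program text serves both problems, with a built-in constant: `1` for dominating sets, `0`
  -- for independent sets. `Optimal` then unfolds to the respective problem.
  refine ⟨512000, ⟨TempReconf.mainProg 1, ?_⟩, ⟨TempReconf.mainProg 0, ?_⟩⟩ <;>
    intro n G hτ P hP
  · obtain ⟨m, s, h1, h2, h3, h4, h5⟩ :=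
      TempReconf.exists_optimal hP hτ (TempReconf.classes_pos P hτ) 1
    exact ⟨m, s, h1, TempReconf.time_bound (TempReconf.classes_pos P hτ) hτ h2, h3, h4, h5⟩
  · obtain ⟨m, s, h1, h2, h3, h4, h5⟩ :=
      TempReconf.exists_optimal hP hτ (TempReconf.classes_pos P hτ) 0
    exact ⟨m, s, h1, TempReconf.time_bound (TempReconf.classes_pos P hτ) hτ h2, h3, h4, h5⟩
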